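/- Let $m,k$ be integers with $1\le k\le 2m-1$ and $k\neq 2m-k$. Let $V$ be a vector space of dimension $n=2m$ over a field of characteristic $\neq 2$, and let $\xi$ be a nondegenerate symplectic (alternating) bilinear form on $V$. For subspaces $U,W$ write $U\perp W$ if $\xi(u,w)=0$ for all $u\in U$, $w\in W$; let $U^\perp=\{v\in V:\xi(u,v)=0\text{ for all }u\in U\}$ and $\mathrm{Rad}(U)=U\cap U^\perp$. Let $\mathbf R_j$ be the set of regular $j$-dimensional subspaces (those with $\mathrm{Rad}(U)=0$), and let $(\mathbf{T\text{-}R})_j$ be the set of $j$-dimensional subspaces $U$ with $\dim\mathrm{Rad}(U)\le 1$ (the regular ones if $j$ is even, those whose radical is a point if $j$ is odd). Let $(\mathfrak P,\perp)$ be the symplectic projective space: its points and lines are the subspaces of $V$ of dimension $1$ and $2$, with inclusion as incidence, together with the relation $\perp$. Let $\mathbf P_k=\langle(\mathbf{T\text{-}R})_k,\mathcal P_k\rangle$ be the Grassmann space (space of pencils): $\mathcal P_k$ consists of the nonempty sets $\{U\in(\mathbf{T\text{-}R})_k: H\subseteq U\subseteq B\}$ with $H\in(\mathbf{T\text{-}R})_{k-1}$,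 $B\in(\mathbf{T\text{-}R})_{k+1}$, $H\subseteq B$. Call $U,W\in(\mathbf{T\text{-}R})_k$ adjacent, $U\sim W$, if they are distinct and lie in a common member of $\mathcal P_k$. We say that $(\mathfrak P,\perp)$ can be defined in a structure $\mathfrak M$ built on a family of subspaces of $V$ if it is first-order interpretable in $\mathfrak M$ without parameters, compatibly with inclusion: the points and lines of $\mathfrak P$ are represented by tuples, of a fixed finite length, of elements of $\mathfrak M$; the set of the representing tuples, the relation that two tuples represent the same object, being a point, being a line, incidence and $\perp$ are given by first-order formulas in the language of $\mathfrak M$, and so is the relation that the represented point or line is contained in a given subspace belonging to $\mathfrak M$. In the statements below the formulas depend only on $m$ and $k$, not on the field, on $V$ or on $\xi$. Then: 1. $(\mathfrak P,\perp)$ can be defined in $\langle(\mathbf{T\text{-}R})_k,\sim\rangle$, that is, in terms of the binary adjacency on $(\mathbf{T\text{-}R})_k$. 2. $(\mathfrak P,\perp)$ can be defined in the Grassmann space $\mathbf P_k$ (points, pencils and membership). 3. If $k$ is even, then $(\mathbf{T\text{-}R})_k=\mathbf R_k$, and $(\mathfrak P,\perp)$ can be defined in $\langle\mathbf R_k,\sim\rangle$,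 that is, in terms of the adjacency on the regular $k$-subspaces. -/

import Mathlib

open FirstOrder Module

universe u v

namespace SympGrass

/-! ### First-order definability of one structure in another -/

/-- A parameter-free first-order definition scheme of structures over the (relational) language
`L'` inside structures over the language `L`: the objects to be defined are represented by
`dim`-tuples satisfying `dom`, two tuples represent the same object iff they satisfy `eqv`, and
every relation symbol of `L'` is expressed by a formula of `L`. In addition, `link` expresses a
relation between represented objects and elements of the `L`-structure. -/
structure Scheme (L L' : Language) where
  dim : ℕ
  dom : L.Formula (Fin dim)
  eqv : L.Formula (Fin dim ⊕ Fin dim)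
  rel : ∀ {r : ℕ}, L'.Relations r → L.Formula (Fin r × Fin dim)
  link : L.Formula (Fin dim ⊕ Unit)

/-- The scheme `D` defines the structure `N` in the structure `M`, and it defines the relation
`E` between elements of `N` and elements of `M`: there is a map `code` from the tuples in the
domain of `D` onto `N` under which equality, the relations of `N` and the relation `E` are
expressed by the formulas of `D`. -/
def Scheme.Defines {L L' : Language} [L'.IsRelational] (D : Scheme L L')
    (M : Type*) [L.Structure M] (N : Type*) [L'.Structure N] (E : N → M → Prop) : Prop :=
  ∃ code : {t : Fin D.dim → M // D.dom.Realize t} → N,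
    Function.Surjective code ∧
    (∀ s t, D.eqv.Realize (Sum.elim s.1 t.1) ↔ code s = code t) ∧
    (∀ (r : ℕ) (R : L'.Relations r) (t : Fin r → {t : Fin D.dim → M // D.dom.Realize t}),
      (D.rel R).Realize (fun p => (t p.1).1 p.2) ↔
        Language.Structure.RelMap R (fun i => code (t i))) ∧
    (∀ t (x : M), D.link.Realize (Sum.elim t.1 (fun _ => x)) ↔ E (code t) x)

/-- Relation symbols of an incidence geometry: being a point, being a line, incidence. -/
inductive IncRel : ℕ → Type
  | point : IncRel 1
  | line : IncRel 1
  | inc : IncRel 2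

/-- The language of incidence geometries. -/
def incLang : Language := ⟨fun _ => Empty, IncRel⟩

/-- Relation symbols of a metric projective geometry: being a point, being a line, incidence,
orthogonality. -/
inductive MetricRel : ℕ → Type
  | point : MetricRel 1
  | line : MetricRel 1
  | inc : MetricRel 2
  | perp : MetricRel 2

/-- The language of metric projective geometries. -/
def metricLang : Language := ⟨fun _ => Empty, MetricRel⟩

instance : metricLang.IsRelational := fun _ => inferInstanceAs (IsEmpty Empty)

/-! ### Subspaces of a symplectic space -/

section Geometry

variable {K V : Type*} [Field K] [AddCommGroup V] [Module K V]

/-- Orthogonality of subspaces. -/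
def Perp (ξ : LinearMap.BilinForm K V) (U W : Submodule K V) : Prop :=
  ∀ u ∈ U, ∀ w ∈ W, ξ u w = 0

/-- The radical `U ∩ U^⊥` of a subspace. -/
def rad (ξ : LinearMap.BilinForm K V) (U : Submodule K V) : Submodule K V :=
  U ⊓ ξ.orthogonal U

/-- The regular subspaces of dimension `k`. -/
def Reg (ξ : LinearMap.BilinForm K V) (k : ℕ) : Set (Submodule K V) :=
  {U | finrank K U = k ∧ rad ξ U = ⊥}

/-- The subspaces of dimension `k` whose radical has dimension at most `1`. -/
def TR (ξ : LinearMap.BilinForm K V) (k : ℕ) : Set (Submodule K V) :=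
  {U | finrank K U = k ∧ finrank K (rad ξ U) ≤ 1}

/-- The pencil `{U ∈ TR_k : H ⊆ U ⊆ B}`. -/
def pencil (ξ : LinearMap.BilinForm K V) (k : ℕ) (H B : Submodule K V) :
    Set (Submodule K V) :=
  {U | U ∈ TR ξ k ∧ H ≤ U ∧ U ≤ B}

/-- The nonempty pencils with `H ∈ TR_{k-1}`, `B ∈ TR_{k+1}`, `H ⊆ B` (used for `1 ≤ k`). -/
def pencils (ξ : LinearMap.BilinForm K V) (k : ℕ) : Set (Set (Submodule K V)) :=
  {g | ∃ H ∈ TR ξ (k - 1), ∃ B ∈ TR ξ (k + 1), H ≤ B ∧ g = pencil ξ k H B ∧ g.Nonempty}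

/-- Adjacency: two distinct subspaces are collinear in the space of pencils. -/
def Adjacent (ξ : LinearMap.BilinForm K V) (k : ℕ) (U W : Submodule K V) : Prop :=
  U ≠ W ∧ ∃ g ∈ pencils ξ k, U ∈ g ∧ W ∈ g

/-- The adjacency relation on a family `𝓗` of subspaces, as a graph on `𝓗`. -/
def adjGraph (ξ : LinearMap.BilinForm K V) (k : ℕ) (𝓗 : Set (Submodule K V)) :
    SimpleGraph 𝓗 where
  Adj U W := Adjacent ξ k U.1 W.1
  symm := ⟨fun _ _ h => ⟨h.1.symm, by obtain ⟨g, hg, h1, h2⟩ := h.2; exact ⟨g, hg, h2, h1⟩⟩⟩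
  loopless := ⟨fun _ h => h.1 rfl⟩

/-- The structure `⟨TR_k, ∼⟩`. -/
def AdjTR (ξ : LinearMap.BilinForm K V) (k : ℕ) : Type _ := TR ξ k

instance (ξ : LinearMap.BilinForm K V) (k : ℕ) : Language.graph.Structure (AdjTR ξ k) :=
  (adjGraph ξ k (TR ξ k)).structure

/-- The structure `⟨R_k, ∼⟩`. -/
def AdjReg (ξ : LinearMap.BilinForm K V) (k : ℕ) : Type _ := Reg ξ k

instance (ξ : LinearMap.BilinForm K V) (k : ℕ) : Language.graph.Structure (AdjReg ξ k) :=
  (adjGraph ξ k (Reg ξ k)).structure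

/-- The Grassmann space (space of pencils): its points are the elements of `TR_k`, its lines are
the nonempty pencils, incidence is membership. -/
def Grassmann (ξ : LinearMap.BilinForm K V) (k : ℕ) : Type _ := TR ξ k ⊕ pencils ξ k

instance (ξ : LinearMap.BilinForm K V) (k : ℕ) : incLang.Structure (Grassmann ξ k) where
  funMap f := nomatch f
  RelMap
    | .point => fun x => ∃ U : TR ξ k, x 0 = Sum.inl U
    | .line => fun x => ∃ g : pencils ξ k, x 0 = Sum.inr g
    | .inc => fun x => ∃ (U : TR ξ k) (g : pencils ξ k),
        x 0 = Sum.inl U ∧ x 1 = Sum.inr g ∧ U.1 ∈ g.1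

/-- The symplectic projective space: its points and lines are the subspaces of dimension
`1` and `2`, incidence is inclusion, together with the orthogonality given by `ξ`. -/
def SympProj (_ξ : LinearMap.BilinForm K V) : Type _ :=
  {X : Submodule K V // finrank K X = 1 ∨ finrank K X = 2}

instance (ξ : LinearMap.BilinForm K V) : metricLang.Structure (SympProj ξ) where
  funMap f := nomatch f
  RelMap
    | .point => fun x => finrank K (x 0).1 = 1
    | .line => fun x => finrank K (x 0).1 = 2
    | .inc => fun x => finrank K (x 0).1 = 1 ∧ finrank K (x 1).1 = 2 ∧ (x 0).1 ≤ (x 1).1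
    | .perp => fun x => Perp ξ (x 0).1 (x 1).1

/-- Inclusion of a projective point or line in an element of `TR_k`. -/
def inAdjTR (ξ : LinearMap.BilinForm K V) (k : ℕ) (X : SympProj ξ) (U : AdjTR ξ k) : Prop :=
  X.1 ≤ U.1

/-- Inclusion of a projective point or line in a regular subspace. -/
def inAdjReg (ξ : LinearMap.BilinForm K V) (k : ℕ) (X : SympProj ξ) (U : AdjReg ξ k) : Prop :=
  X.1 ≤ U.1

/-- Inclusion of a projective point or line in an element of `TR_k`, where the latter is a point
of the Grassmann space. -/
def inGrassmann (ξ : LinearMap.BilinForm K V) (k : ℕ) (X : SympProj ξ) (x : Grassmann ξ k) :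
    Prop :=
  ∃ U : TR ξ k, x = Sum.inl U ∧ X.1 ≤ U.1

end Geometry

end SympGrass

/-! For every subspace the sum of its dimension and the dimension of its radical is even
(`even_finrank_add_rad`). So elements of `TR` are regular in even dimension and have a radical point
in odd dimension. By `adjacent_iff`, adjacency of `U`, `W` is a condition on `U ⊓ W` and `U ⊔ W`.
Orthogonal complementation carries `TR k` to `TR (2 * m - k)`, preserves adjacency and exchanges
intersections with sums, so it suffices to treat `k < m`.

For `k < m` the idea is to recover `TR (k - 1)` from adjacency on `TR k` and to repeat this down to
`TR 1`, where adjacency is non-orthogonality of points. Weak adjacency is definable: for even `k` it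
is adjacency itself, and for odd `k` it is recognised by a configuration of common neighbours
(`weakT_iff_odd`). The elements equal or weakly adjacent to both members of an adjacent pair `U`,
`W` form the union of a star (all `X` above `U ⊓ W`) and a top (all `X` below `U ⊔ W`), two cliques
sharing a pencil. Since `2 * k < 2 * m`, stars are larger than tops and a bounded formula separates
them. For even `k` a top is an affine space generated by `k + 1` points (`smallSpan_top`); for odd
`k` every member of a top is adjacent to one of `k + 1` fixed members (`smallPerp_top`). Neither
holds for stars. Thus "`X` contains `U ⊓ W`" is definable (`above_iff`), and an element of `TR (k -
1)` can be represented by an adjacent pair with that intersection.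

Inclusion between consecutive dimensions then determines adjacency in the lower one. For even `j`
two distinct elements are adjacent iff they lie in a common element of `TR (j + 1)`. For odd `j`
this does not exclude an intersection with a two-dimensional radical, and the two situations differ
in whether not lying in a common element is a transitive relation above the intersection
(`adjT_iff_odd`).

After reaching the points, inclusion of points is rebuilt upwards by `point_le_iff`, and projective
points and lines are represented by pairs of points. All this takes place in a calculus (`Coding`,
`Def`, `DMap`) whose formulas are uniform over all symplectic spaces of the given dimension.
Characteristic other than two enters in the explicit vector configurations and in generating affine
spaces by lines. -/

namespace SympGrass

/-! ### Uniform definability in a family of structures -/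

section Definability

variable {I : Type*} {L : Language} {M : I → Type*} [∀ i, L.Structure (M i)]

/-- A family of relations on tuples defined by one formula in all structures of the family. -/
def TupleDef (L : Language) (M : I → Type*) [∀ i, L.Structure (M i)] {α : Type}
    (R : ∀ i, (α → M i) → Prop) : Prop :=
  ∃ φ : L.Formula α, ∀ i v, φ.Realize v ↔ R i v

namespace TupleDef

variable {α β : Type} {R S : ∀ i, (α → M i) → Prop}

theorem congr (h : TupleDef L M R) (e : ∀ i v, R i v ↔ S i v) : TupleDef L M S := by
  obtain ⟨φ, hφ⟩ := h
  exact ⟨φ, fun i v => (hφ i v).trans (e i v)⟩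

theorem not (h : TupleDef L M R) : TupleDef L M (fun i v => ¬ R i v) := by
  obtain ⟨φ, hφ⟩ := h
  exact ⟨φ.not, fun i v => by rw [Language.Formula.realize_not, hφ]⟩

theorem and (h : TupleDef L M R) (h' : TupleDef L M S) :
    TupleDef L M (fun i v => R i v ∧ S i v) := by
  obtain ⟨φ, hφ⟩ := h
  obtain ⟨ψ, hψ⟩ := h'
  exact ⟨φ ⊓ ψ, fun i v => by rw [Language.Formula.realize_inf, hφ, hψ]⟩

theorem all_fin [Finite β] {T : β → ∀ i, (α → M i) → Prop} (h : ∀ b, TupleDef L M (T b)) :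
    TupleDef L M (fun i v => ∀ b, T b i v) := by
  choose φ hφ using h
  exact ⟨Language.Formula.iInf φ, fun i v => by simp [hφ]⟩

theorem relabel (h : TupleDef L M R) (g : α → β) :
    TupleDef L M (fun i (v : β → M i) => R i (v ∘ g)) := by
  obtain ⟨φ, hφ⟩ := h
  exact ⟨φ.relabel g, fun i v => by rw [Language.Formula.realize_relabel, hφ]⟩

theorem ex [Finite β] {T : ∀ i, (α ⊕ β → M i) → Prop} (h : TupleDef L M T) :
    TupleDef L M (fun i v => ∃ w : β → M i, T i (Sum.elim v w)) := by
  obtain ⟨φ, hφ⟩ := h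
  exact ⟨φ.iExs β, fun i v => by simp [Language.Formula.realize_iExs, hφ]⟩

end TupleDef

/-- A uniform interpretation of a family of sets `X` in the family of structures `M`:
the elements of `X i` are represented by tuples of elements of `M i`, and the relation that two
tuples represent the same element is uniformly definable. -/
class Coding (L : Language) (M : I → Type*) [∀ i, L.Structure (M i)] (X : I → Type*) where
  Idx : Type
  finite_idx : Finite Idx
  rep : ∀ i, (Idx → M i) → X i → Prop
  rep_unique : ∀ {i t x y}, rep i t x → rep i t y → x = y
  rep_surj : ∀ {i} (x : X i), ∃ t, rep i t x
  eq_def : TupleDef L M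
    (fun i (v : Idx ⊕ Idx → M i) => ∃ x, rep i (v ∘ Sum.inl) x ∧ rep i (v ∘ Sum.inr) x)

attribute [instance] Coding.finite_idx

variable {Γ X Y Z : I → Type*}

/-- A family of predicates on an interpreted family of sets that is uniformly definable. -/
def Def (L : Language) (M : I → Type*) [∀ i, L.Structure (M i)] [c : Coding L M X]
    (P : ∀ i, X i → Prop) : Prop :=
  TupleDef L M (fun i (t : c.Idx → M i) => ∃ x, c.rep i t x ∧ P i x)

/-- A family of maps between interpreted families of sets with uniformly definable graph. -/
def DMap (L : Language) (M : I → Type*) [∀ i, L.Structure (M i)] [c : Coding L M X]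
    [d : Coding L M Y] (f : ∀ i, X i → Y i) : Prop :=
  TupleDef L M (fun i (t : c.Idx ⊕ d.Idx → M i) =>
    ∃ x, c.rep i (t ∘ Sum.inl) x ∧ d.rep i (t ∘ Sum.inr) (f i x))

/-- A tuple represents something exactly when it is equivalent to itself, so the domain formula is
the diagonal of `eq_def`. -/
theorem Coding.dom_def (c : Coding L M X) :
    TupleDef L M (fun i (t : c.Idx → M i) => ∃ x, c.rep i t x) := by
  refine (c.eq_def.relabel (Sum.elim id id)).congr fun i v => ?_
  exact exists_congr fun x => and_self_iff

instance [c : Coding L M X] [d : Coding L M Y] : Coding L M (fun i => X i × Y i) where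
  Idx := c.Idx ⊕ d.Idx
  finite_idx := inferInstance
  rep i t p := c.rep i (t ∘ Sum.inl) p.1 ∧ d.rep i (t ∘ Sum.inr) p.2
  rep_unique h h' := Prod.ext (c.rep_unique h.1 h'.1) (d.rep_unique h.2 h'.2)
  rep_surj p := by
    obtain ⟨s, hs⟩ := c.rep_surj p.1
    obtain ⟨t, ht⟩ := d.rep_surj p.2
    exact ⟨Sum.elim s t, hs, ht⟩
  eq_def := by
    refine ((c.eq_def.relabel (Sum.map Sum.inl Sum.inl)).and
      (d.eq_def.relabel (Sum.map Sum.inr Sum.inr))).congr fun i v => ⟨?_, ?_⟩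
    · rintro ⟨⟨x, h1, h2⟩, ⟨y, h3, h4⟩⟩
      exact ⟨(x, y), ⟨h1, h3⟩, ⟨h2, h4⟩⟩
    · rintro ⟨⟨x, y⟩, ⟨h1, h3⟩, ⟨h2, h4⟩⟩
      exact ⟨⟨x, h1, h2⟩, ⟨y, h3, h4⟩⟩

instance (r : ℕ) [c : Coding L M X] : Coding L M (fun i => Fin r → X i) where
  Idx := Fin r × c.Idx
  finite_idx := inferInstance
  rep i t f := ∀ j, c.rep i (fun a => t (j, a)) (f j)
  rep_unique h h' := funext fun j => c.rep_unique (h j) (h' j)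
  rep_surj f := by
    choose t ht using fun j => c.rep_surj (f j)
    exact ⟨fun p => t p.1 p.2, ht⟩
  eq_def := by
    refine (TupleDef.all_fin (β := Fin r) (fun j => c.eq_def.relabel
      (Sum.map (fun a => (j, a)) (fun a => (j, a))))).congr fun i v => ⟨fun h => ?_, ?_⟩
    · choose f h1 h2 using h
      exact ⟨f, h1, h2⟩
    · rintro ⟨f, h1, h2⟩ j
      exact ⟨f j, h1 j, h2 j⟩

/-- The structures themselves are interpreted by single elements. -/
@[reducible] def Coding.self : Coding L M M where
  Idx := Unit
  finite_idx := inferInstance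
  rep i t x := t () = x
  rep_unique h h' := h.symm.trans h'
  rep_surj x := ⟨fun _ => x, rfl⟩
  eq_def := ⟨Language.Term.equal (.var (.inl ())) (.var (.inr ())), fun i v => by
    simp [Language.Formula.realize_equal, eq_comm]⟩

/-! ### Closure of uniform definability under connectives, quantifiers and substitution -/

section Closure

variable [b : Coding L M Γ] [c : Coding L M X] [d : Coding L M Y]

theorem Def.congr {P Q : ∀ i, X i → Prop} (h : Def L M P) (e : ∀ i x, P i x ↔ Q i x) :
    Def L M Q := by
  have : P = Q := by funext i x; exact propext (e i x)
  exact this ▸ h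

/-- The bare negated formula would also hold on tuples that represent nothing, so the domain formula
is added; uniqueness of the represented element does the rest. -/
theorem Def.not {P : ∀ i, X i → Prop} (h : Def L M P) : Def L M (fun i x => ¬ P i x) := by
  refine (c.dom_def.and (TupleDef.not h)).congr fun i v => ⟨?_, ?_⟩
  · rintro ⟨⟨x, hx⟩, h⟩
    exact ⟨x, hx, fun hp => h ⟨x, hx, hp⟩⟩
  · rintro ⟨x, hx, h⟩
    refine ⟨⟨x, hx⟩, ?_⟩
    rintro ⟨y, hy, hp⟩
    exact h (c.rep_unique hy hx ▸ hp)

theorem Def.and {P Q : ∀ i, X i → Prop} (h : Def L M P) (h' : Def L M Q) :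
    Def L M (fun i x => P i x ∧ Q i x) := by
  refine (TupleDef.and h h').congr fun i v => ⟨?_, ?_⟩
  · rintro ⟨⟨x, hx, hp⟩, ⟨y, hy, hq⟩⟩
    exact ⟨x, hx, hp, c.rep_unique hy hx ▸ hq⟩
  · rintro ⟨x, hx, hp, hq⟩
    exact ⟨⟨x, hx, hp⟩, ⟨x, hx, hq⟩⟩

theorem Def.or {P Q : ∀ i, X i → Prop} (h : Def L M P) (h' : Def L M Q) :
    Def L M (fun i x => P i x ∨ Q i x) :=
  (h.not.and h'.not).not.congr fun i x => by tauto

theorem Def.imp {P Q : ∀ i, X i → Prop} (h : Def L M P) (h' : Def L M Q) :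
    Def L M (fun i x => P i x → Q i x) :=
  (h.and h'.not).not.congr fun i x => by tauto

theorem Def.iff {P Q : ∀ i, X i → Prop} (h : Def L M P) (h' : Def L M Q) :
    Def L M (fun i x => P i x ↔ Q i x) :=
  ((h.imp h').and (h'.imp h)).congr fun i x => by tauto

/-- Quantification over `Y` becomes quantification over a finite block of variables, because every
element has a representing tuple. -/
theorem Def.ex {P : ∀ i, X i → Y i → Prop}
    (h : Def L M (fun i (p : X i × Y i) => P i p.1 p.2)) :
    Def L M (fun i x => ∃ y, P i x y) := by
  refine (TupleDef.ex (α := c.Idx) (β := d.Idx) h).congr fun i v => ⟨?_, ?_⟩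
  · rintro ⟨w, ⟨x, y⟩, ⟨h1, h2⟩, h3⟩
    exact ⟨x, h1, y, h3⟩
  · rintro ⟨x, h1, y, h3⟩
    obtain ⟨w, hw⟩ := d.rep_surj y
    exact ⟨w, ⟨x, y⟩, ⟨h1, hw⟩, h3⟩

theorem Def.all {P : ∀ i, X i → Y i → Prop}
    (h : Def L M (fun i (p : X i × Y i) => P i p.1 p.2)) :
    Def L M (fun i x => ∀ y, P i x y) :=
  (Def.ex (P := fun i x y => ¬ P i x y) h.not).not.congr fun i x => by simp

theorem Def.all_fin {r : ℕ} {P : ∀ i, X i → Fin r → Prop}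
    (h : ∀ j, Def L M (fun i x => P i x j)) : Def L M (fun i x => ∀ j, P i x j) := by
  refine (c.dom_def.and (TupleDef.all_fin h)).congr fun i v => ⟨?_, ?_⟩
  · rintro ⟨⟨x, hx⟩, h⟩
    refine ⟨x, hx, fun j => ?_⟩
    obtain ⟨y, hy, hp⟩ := h j
    exact c.rep_unique hy hx ▸ hp
  · rintro ⟨x, hx, h⟩
    exact ⟨⟨x, hx⟩, fun j => ⟨x, hx, h j⟩⟩

theorem Def.ex_fin {r : ℕ} {P : ∀ i, X i → Fin r → Prop}
    (h : ∀ j, Def L M (fun i x => P i x j)) : Def L M (fun i x => ∃ j, P i x j) :=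
  (Def.all_fin (P := fun i x j => ¬ P i x j) fun j => (h j).not).not.congr fun i x => by simp

/-- Maps are given by graphs and not by terms: substitution quantifies over a tuple representing the
value. -/
theorem Def.comp {P : ∀ i, Y i → Prop} (h : Def L M P) {f : ∀ i, X i → Y i}
    (hf : DMap L M f) : Def L M (fun i x => P i (f i x)) := by
  refine (TupleDef.ex (α := c.Idx) (β := d.Idx) (hf.and (h.relabel Sum.inr))).congr
    fun i v => ⟨?_, ?_⟩
  · rintro ⟨w, ⟨x, h1, h2⟩, ⟨y, h3, h4⟩⟩
    obtain rfl := d.rep_unique h3 h2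
    exact ⟨x, h1, h4⟩
  · rintro ⟨x, h1, hp⟩
    obtain ⟨w, hw⟩ := d.rep_surj (f i x)
    exact ⟨w, ⟨x, h1, hw⟩, ⟨_, hw, hp⟩⟩

theorem DMap.id : DMap L M (fun i (x : X i) => x) := c.eq_def

theorem DMap.pair {f : ∀ i, Γ i → X i} {g : ∀ i, Γ i → Y i}
    (hf : DMap L M f) (hg : DMap L M g) : DMap L M (fun i x => (f i x, g i x)) := by
  refine ((hf.relabel (Sum.map _root_.id Sum.inl)).and
    (hg.relabel (Sum.map _root_.id Sum.inr))).congr fun i v => ⟨?_, ?_⟩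
  · rintro ⟨⟨x, h1, h2⟩, ⟨y, h3, h4⟩⟩
    exact ⟨x, h1, h2, b.rep_unique h3 h1 ▸ h4⟩
  · rintro ⟨x, h1, h2, h3⟩
    exact ⟨⟨x, h1, h2⟩, ⟨x, h1, h3⟩⟩

theorem DMap.comp {f : ∀ i, Γ i → X i} {g : ∀ i, X i → Y i}
    (hg : DMap L M g) (hf : DMap L M f) : DMap L M (fun i x => g i (f i x)) := by
  refine (TupleDef.ex (α := b.Idx ⊕ d.Idx) (β := c.Idx)
    ((hf.relabel (Sum.elim (fun a => .inl (.inl a)) .inr)).and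
    (hg.relabel (Sum.elim .inr (fun a => .inl (.inr a)))))).congr fun i v => ⟨?_, ?_⟩
  · rintro ⟨w, ⟨x, h1, h2⟩, ⟨y, h3, h4⟩⟩
    obtain rfl := c.rep_unique h3 h2
    exact ⟨x, h1, h4⟩
  · rintro ⟨x, h1, h2⟩
    obtain ⟨w, hw⟩ := c.rep_surj (f i x)
    exact ⟨w, ⟨x, h1, hw⟩, ⟨_, hw, h2⟩⟩

theorem DMap.fst_proj : DMap L M (fun i (p : X i × Y i) => p.1) := by
  refine ((c.eq_def.relabel (Sum.map Sum.inl _root_.id)).and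
    (d.dom_def.relabel (fun a => .inl (.inr a)))).congr fun i v => ⟨?_, ?_⟩
  · rintro ⟨⟨x, h1, h2⟩, ⟨y, h3⟩⟩
    exact ⟨(x, y), ⟨h1, h3⟩, h2⟩
  · rintro ⟨⟨x, y⟩, ⟨h1, h3⟩, h2⟩
    exact ⟨⟨x, h1, h2⟩, ⟨y, h3⟩⟩

theorem DMap.snd_proj : DMap L M (fun i (p : X i × Y i) => p.2) := by
  refine ((d.eq_def.relabel (Sum.map Sum.inr _root_.id)).and
    (c.dom_def.relabel (fun a => .inl (.inl a)))).congr fun i v => ⟨?_, ?_⟩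
  · rintro ⟨⟨x, h1, h2⟩, ⟨y, h3⟩⟩
    exact ⟨(y, x), ⟨h3, h1⟩, h2⟩
  · rintro ⟨⟨x, y⟩, ⟨h1, h3⟩, h2⟩
    exact ⟨⟨y, h3, h2⟩, ⟨x, h1⟩⟩

theorem DMap.eval_proj {r : ℕ} (j : Fin r) : DMap L M (fun i (p : Fin r → X i) => p j) := by
  refine ((Coding.dom_def (L := L) (M := M) (X := fun i => Fin r → X i) inferInstance).relabel
    Sum.inl |>.and (c.eq_def.relabel (Sum.map (fun a => (j, a)) _root_.id))).congr
    fun i v => ⟨?_, ?_⟩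
  · rintro ⟨⟨f, h1⟩, ⟨y, h2, h3⟩⟩
    obtain rfl := c.rep_unique h2 (h1 j)
    exact ⟨f, h1, h3⟩
  · rintro ⟨f, h1, h2⟩
    exact ⟨⟨f, h1⟩, ⟨f j, h1 j, h2⟩⟩

theorem DMap.fst {f : ∀ i, Γ i → X i × Y i} (hf : DMap L M f) :
    DMap L M (fun i x => (f i x).1) :=
  DMap.comp (g := fun i (p : X i × Y i) => p.1) DMap.fst_proj hf

theorem DMap.snd {f : ∀ i, Γ i → X i × Y i} (hf : DMap L M f) :
    DMap L M (fun i x => (f i x).2) :=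
  DMap.comp (g := fun i (p : X i × Y i) => p.2) DMap.snd_proj hf

theorem DMap.eval {r : ℕ} {f : ∀ i, Γ i → Fin r → X i} (hf : DMap L M f) (j : Fin r) :
    DMap L M (fun i x => f i x j) :=
  DMap.comp (g := fun i (p : Fin r → X i) => p j) (DMap.eval_proj j) hf

theorem Def.comp₂ {R : ∀ i, X i → Y i → Prop}
    (h : Def L M (fun i (p : X i × Y i) => R i p.1 p.2)) {f : ∀ i, Γ i → X i}
    {g : ∀ i, Γ i → Y i} (hf : DMap L M f) (hg : DMap L M g) :
    Def L M (fun i x => R i (f i x) (g i x)) :=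
  Def.comp (P := fun i (p : X i × Y i) => R i p.1 p.2) h (hf.pair hg)

theorem Def.comp₃ [Coding L M Z] {R : ∀ i, X i → Y i → Z i → Prop}
    (h : Def L M (fun i (p : (X i × Y i) × Z i) => R i p.1.1 p.1.2 p.2)) {f : ∀ i, Γ i → X i}
    {g : ∀ i, Γ i → Y i} {e : ∀ i, Γ i → Z i} (hf : DMap L M f) (hg : DMap L M g)
    (he : DMap L M e) :
    Def L M (fun i x => R i (f i x) (g i x) (e i x)) :=
  Def.comp (P := fun i (p : (X i × Y i) × Z i) => R i p.1.1 p.1.2 p.2) h ((hf.pair hg).pair he)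

theorem Def.eq {f g : ∀ i, Γ i → X i} (hf : DMap L M f) (hg : DMap L M g) :
    Def L M (fun i x => f i x = g i x) := by
  refine Def.comp₂ (R := fun i (x y : X i) => x = y) ?_ hf hg
  refine c.eq_def.congr fun i v => ⟨?_, ?_⟩
  · rintro ⟨x, h1, h2⟩
    exact ⟨(x, x), ⟨h1, h2⟩, rfl⟩
  · rintro ⟨⟨x, y⟩, ⟨h1, h2⟩, rfl : x = y⟩
    exact ⟨x, h1, h2⟩

end Closure

/-- The interpretation of `Y` by the elements of `X`, via a functional relation onto `Y` with
uniformly definable kernel. -/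
@[reducible] def Coding.ofRel [c : Coding L M X] (r : ∀ i, X i → Y i → Prop)
    (hu : ∀ i x y y', r i x y → r i x y' → y = y') (hs : ∀ i y, ∃ x, r i x y)
    (hk : Def L M (fun i (p : X i × X i) => ∃ y, r i p.1 y ∧ r i p.2 y)) : Coding L M Y where
  Idx := c.Idx
  finite_idx := inferInstance
  rep i t y := ∃ x, c.rep i t x ∧ r i x y
  rep_unique := by
    rintro i t y y' ⟨x, h1, h2⟩ ⟨x', h1', h2'⟩
    exact hu i x y y' h2 (c.rep_unique h1' h1 ▸ h2')
  rep_surj := by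
    intro i y
    obtain ⟨x, hx⟩ := hs i y
    obtain ⟨t, ht⟩ := c.rep_surj x
    exact ⟨t, x, ht, hx⟩
  eq_def := by
    refine TupleDef.congr hk fun i v => ⟨?_, ?_⟩
    · rintro ⟨⟨x, x'⟩, ⟨h1, h2⟩, y, h3, h4⟩
      exact ⟨y, ⟨x, h1, h3⟩, ⟨x', h2, h4⟩⟩
    · rintro ⟨y, ⟨x, h1, h3⟩, ⟨x', h2, h4⟩⟩
      exact ⟨(x, x'), ⟨h1, h2⟩, y, h3, h4⟩

/-- A tuple for `y` is a tuple for some `x'` with `r x' y`, so `r x y` says that `x` and `x'` share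
an image. Hence the kernel formula `hk` also defines the graph of `r`. -/
theorem Coding.exists_ofRel [c : Coding L M X] (r : ∀ i, X i → Y i → Prop)
    (hu : ∀ i x y y', r i x y → r i x y' → y = y') (hs : ∀ i y, ∃ x, r i x y)
    (hk : Def L M (fun i (p : X i × X i) => ∃ y, r i p.1 y ∧ r i p.2 y)) :
    ∃ _ : Coding L M Y, Def L M (fun i (p : X i × Y i) => r i p.1 p.2) := by
  refine ⟨Coding.ofRel r hu hs hk, TupleDef.congr hk fun i v => ⟨?_, ?_⟩⟩
  · rintro ⟨⟨x, x'⟩, ⟨h1, h2⟩, y, h3, h4⟩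
    exact ⟨(x, y), ⟨h1, ⟨x', h2, h4⟩⟩, h3⟩
  · rintro ⟨⟨x, y⟩, ⟨h1, ⟨x', h2, h4⟩⟩, h3⟩
    exact ⟨(x, x'), ⟨h1, h2⟩, y, h3, h4⟩

end Definability

/-! ### Symplectic linear algebra -/

section Linear

variable {K V : Type*} [Field K] [AddCommGroup V] [Module K V] [FiniteDimensional K V]
variable {ξ : LinearMap.BilinForm K V} {U W X Y H B G : Submodule K V} {k : ℕ}

theorem eq_of_le_of_finrank (h : U ≤ W) (hd : finrank K W ≤ finrank K U) : U = W :=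
  Submodule.eq_of_le_of_finrank_le h hd

theorem finrank_sup_add_inf (U W : Submodule K V) :
    finrank K ↥(U ⊔ W) + finrank K ↥(U ⊓ W) = finrank K U + finrank K W :=
  Submodule.finrank_sup_add_finrank_inf_eq U W

/-- A nondegenerate alternating form. -/
structure IsSymp (ξ : LinearMap.BilinForm K V) : Prop where
  alt : ξ.IsAlt
  nondeg : ξ.Nondegenerate

omit [FiniteDimensional K V] in
theorem mem_orthogonal_span {f x : V} : x ∈ ξ.orthogonal (K ∙ f) ↔ ξ f x = 0 := by
  rw [LinearMap.BilinForm.mem_orthogonal_iff]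
  refine ⟨fun h => h f (Submodule.mem_span_singleton_self f), fun h y hy => ?_⟩
  obtain ⟨a, rfl⟩ := Submodule.mem_span_singleton.1 hy
  simp [h]

omit [FiniteDimensional K V] in
theorem mem_orthogonal {x : V} : x ∈ ξ.orthogonal U ↔ ∀ u ∈ U, ξ u x = 0 :=
  LinearMap.BilinForm.mem_orthogonal_iff

omit [FiniteDimensional K V] in
theorem mem_rad {x : V} : x ∈ rad ξ U ↔ x ∈ U ∧ ∀ u ∈ U, ξ u x = 0 := by
  rw [rad, Submodule.mem_inf, mem_orthogonal]

namespace IsSymp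

variable (hξ : IsSymp ξ)
include hξ

omit [FiniteDimensional K V] in
theorem neg (x y : V) : ξ x y = - ξ y x := by
  exact (hξ.alt.neg_eq y x).symm

omit [FiniteDimensional K V] in
theorem self (x : V) : ξ x x = 0 := hξ.alt x

omit [FiniteDimensional K V] in
theorem comm {x y : V} : ξ x y = 0 ↔ ξ y x = 0 := by
  rw [hξ.neg x y, neg_eq_zero]

omit [FiniteDimensional K V] in
theorem perp_comm : Perp ξ U W ↔ Perp ξ W U :=
  ⟨fun h u hu w hw => hξ.comm.1 (h w hw u hu), fun h u hu w hw => hξ.comm.1 (h w hw u hu)⟩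

theorem finrank_orth (U : Submodule K V) :
    finrank K (ξ.orthogonal U) + finrank K U = finrank K V := by
  rw [LinearMap.BilinForm.finrank_orthogonal hξ.nondeg]
  have := Submodule.finrank_le U
  omega

theorem orth_orth (U : Submodule K V) : ξ.orthogonal (ξ.orthogonal U) = U :=
  LinearMap.BilinForm.orthogonal_orthogonal hξ.nondeg hξ.alt.isRefl U

theorem orth_le_orth : ξ.orthogonal U ≤ ξ.orthogonal W ↔ W ≤ U := by
  refine ⟨fun h => ?_, fun h => LinearMap.BilinForm.orthogonal_le h⟩
  have := LinearMap.BilinForm.orthogonal_le (B := ξ) h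
  rwa [hξ.orth_orth, hξ.orth_orth] at this

theorem orth_inj : ξ.orthogonal U = ξ.orthogonal W ↔ U = W :=
  ⟨fun h => by rw [← hξ.orth_orth U, h, hξ.orth_orth], fun h => h ▸ rfl⟩

omit [FiniteDimensional K V] hξ in
theorem orth_sup (U W : Submodule K V) :
    ξ.orthogonal (U ⊔ W) = ξ.orthogonal U ⊓ ξ.orthogonal W := by
  apply le_antisymm
  · exact le_inf (LinearMap.BilinForm.orthogonal_le le_sup_left)
      (LinearMap.BilinForm.orthogonal_le le_sup_right)
  · intro x hx
    rw [Submodule.mem_inf, mem_orthogonal, mem_orthogonal] at hx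
    rw [mem_orthogonal]
    intro u hu
    obtain ⟨a, ha, b, hb, rfl⟩ := Submodule.mem_sup.1 hu
    simp [hx.1 a ha, hx.2 b hb]

theorem orth_inf (U W : Submodule K V) :
    ξ.orthogonal (U ⊓ W) = ξ.orthogonal U ⊔ ξ.orthogonal W := by
  rw [← hξ.orth_inj, orth_sup, hξ.orth_orth, hξ.orth_orth, hξ.orth_orth]

theorem rad_orth (U : Submodule K V) : rad ξ (ξ.orthogonal U) = rad ξ U := by
  rw [rad, rad, hξ.orth_orth, inf_comm]

/-- A vector outside a subspace is separated from it by a vector orthogonal to the subspace. -/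
theorem exists_sep {a : V} (ha : a ∉ W) : ∃ f, (∀ w ∈ W, ξ w f = 0) ∧ ξ a f = 1 := by
  rw [← hξ.orth_orth W, mem_orthogonal] at ha
  push Not at ha
  obtain ⟨f, hf, hfa⟩ := ha
  have hfa' : ξ a f ≠ 0 := fun h => hfa (hξ.comm.1 h)
  refine ⟨(ξ a f)⁻¹ • f, fun w hw => ?_, ?_⟩
  · rw [map_smul, mem_orthogonal.1 hf w hw, smul_zero]
  · rw [map_smul, smul_eq_mul, inv_mul_cancel₀ hfa']

theorem finrank_inf_orth_span {f : V} (h : ∃ x ∈ U, ξ f x ≠ 0) :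
    finrank K ↥(U ⊓ ξ.orthogonal (K ∙ f)) + 1 = finrank K U := by
  obtain ⟨x, hx, hfx⟩ := h
  have hf : f ≠ 0 := by rintro rfl; simp at hfx
  have h1 := hξ.finrank_orth (K ∙ f)
  rw [finrank_span_singleton hf] at h1
  have h2 := finrank_sup_add_inf U (ξ.orthogonal (K ∙ f))
  have h3 : ξ.orthogonal (K ∙ f) < U ⊔ ξ.orthogonal (K ∙ f) := by
    refine lt_of_le_of_ne le_sup_right fun h => hfx ?_
    rw [← mem_orthogonal_span, h]
    exact Submodule.mem_sup_left hx
  have h4 := Submodule.finrank_lt_finrank_of_lt h3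
  have h5 := Submodule.finrank_le (U ⊔ ξ.orthogonal (K ∙ f))
  omega

theorem finrank_inf_orth_span_le (f : V) :
    finrank K U ≤ finrank K ↥(U ⊓ ξ.orthogonal (K ∙ f)) + 1 := by
  by_cases h : ∃ x ∈ U, ξ f x ≠ 0
  · exact (hξ.finrank_inf_orth_span h).ge
  · push Not at h
    have : U ⊓ ξ.orthogonal (K ∙ f) = U :=
      inf_eq_left.2 fun x hx => mem_orthogonal_span.2 (h x hx)
    rw [this]
    omega

/-- Splitting off a pair `u`, `w` with `ξ u w ≠ 0` lowers the dimension by two and keeps the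
radical; when no such pair exists, `U` is its own radical. -/
theorem even_finrank_add_rad (U : Submodule K V) :
    Even (finrank K U + finrank K (rad ξ U)) := by
  induction hd : finrank K U using Nat.strong_induction_on generalizing U with
  | _ d ih =>
  by_cases h : ∃ u ∈ U, ∃ w ∈ U, ξ u w ≠ 0
  · obtain ⟨u, hu, w, hw, huw⟩ := h
    set U₁ := U ⊓ ξ.orthogonal (K ∙ u) with hU₁
    set U₂ := U₁ ⊓ ξ.orthogonal (K ∙ w) with hU₂
    have h1 : finrank K U₁ + 1 = finrank K U := hξ.finrank_inf_orth_span ⟨w, hw, huw⟩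
    have hu1 : u ∈ U₁ := ⟨hu, mem_orthogonal_span.2 (hξ.self u)⟩
    have h2 : finrank K U₂ + 1 = finrank K U₁ :=
      hξ.finrank_inf_orth_span ⟨u, hu1, fun h => huw (hξ.comm.1 h)⟩
    have hr : rad ξ U₂ = rad ξ U := by
      ext x
      rw [mem_rad, mem_rad]
      constructor
      · rintro ⟨⟨⟨hx, hxu⟩, hxw⟩, hx2⟩
        replace hxu : ξ u x = 0 := mem_orthogonal_span.1 hxu
        replace hxw : ξ w x = 0 := mem_orthogonal_span.1 hxw
        refine ⟨hx, fun y hy => ?_⟩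
        -- This is the projection of `y` to `U₂` along `u` and `w`; the subtracted part is
        -- orthogonal to `x`.
        have := hx2 (y - (ξ y w / ξ u w) • u - (ξ u y / ξ u w) • w) ⟨⟨?_, ?_⟩, ?_⟩
        · simpa [hxu, hxw] using this
        · exact U.sub_mem (U.sub_mem hy (U.smul_mem _ hu)) (U.smul_mem _ hw)
        · refine mem_orthogonal_span.2 ?_
          simp only [map_sub, map_smul, hξ.self, smul_eq_mul]
          field_simp
          ring
        · refine mem_orthogonal_span.2 ?_
          simp only [map_sub, map_smul, hξ.self, smul_eq_mul]
          rw [hξ.neg w u, hξ.neg w y]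
          field_simp
          ring
      · rintro ⟨hx, hx2⟩
        exact ⟨⟨⟨hx, mem_orthogonal_span.2 (hx2 u hu)⟩, mem_orthogonal_span.2 (hx2 w hw)⟩,
          fun y hy => hx2 y hy.1.1⟩
    have h3 := ih (finrank K U₂) (by omega) U₂ rfl
    rw [hr] at h3
    rw [Nat.even_iff] at h3 ⊢
    omega
  · push Not at h
    have : rad ξ U = U := inf_eq_left.2 fun x hx => mem_orthogonal.2 fun u hu => h u hu x hx
    rw [this, hd]
    exact ⟨d, rfl⟩

/-- Passing to a hyperplane changes the dimension of the radical by at most one. -/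
theorem rad_hyperplane_le (h : H ≤ U) (hd : finrank K U = finrank K H + 1) :
    finrank K (rad ξ H) ≤ finrank K (rad ξ U) + 1 := by
  obtain ⟨u, hu, huH⟩ : ∃ u ∈ U, u ∉ H := by
    by_contra hc
    push Not at hc
    have := Submodule.finrank_mono (R := K) (s := U) (t := H) hc
    omega
  have hU : H ⊔ K ∙ u = U := by
    refine eq_of_le_of_finrank (sup_le h ((Submodule.span_singleton_le_iff_mem _ _).2 hu)) ?_
    have : H < H ⊔ K ∙ u := lt_of_le_of_ne le_sup_left fun hc => huH (hc ▸
      Submodule.mem_sup_right (Submodule.mem_span_singleton_self u))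
    have := Submodule.finrank_lt_finrank_of_lt this
    omega
  refine (hξ.finrank_inf_orth_span_le u).trans (Nat.add_le_add_right ?_ 1)
  refine Submodule.finrank_mono fun x hx => ?_
  obtain ⟨hx, hxu⟩ := hx
  replace hxu : ξ u x = 0 := mem_orthogonal_span.1 hxu
  obtain ⟨hx1, hx2⟩ := mem_rad.1 hx
  refine mem_rad.2 ⟨h hx1, fun y hy => ?_⟩
  rw [← hU] at hy
  obtain ⟨a, ha, b, hb, rfl⟩ := Submodule.mem_sup.1 hy
  obtain ⟨c, rfl⟩ := Submodule.mem_span_singleton.1 hb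
  simp [hx2 a ha, hxu]

omit hξ in
-- The part of `rad ξ U` inside `H` lies in `rad ξ H`, and a hyperplane cuts off at most one
-- dimension.
theorem rad_le_hyperplane (h : H ≤ U) (hd : finrank K U = finrank K H + 1) :
    finrank K (rad ξ U) ≤ finrank K (rad ξ H) + 1 := by
  have h1 := finrank_sup_add_inf (rad ξ U) H
  have h2 := Submodule.finrank_mono (R := K) (sup_le (a := rad ξ U) inf_le_left h)
  have h3 : rad ξ U ⊓ H ≤ rad ξ H := fun x hx =>
    mem_rad.2 ⟨hx.2, fun y hy => (mem_rad.1 hx.1).2 y (h hy)⟩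
  have h4 := Submodule.finrank_mono (R := K) h3
  omega

/-- By parity, a radical of dimension at most one inside an even-dimensional subspace is zero. -/
theorem mem_TR_even (hk : Even k) : U ∈ TR ξ k ↔ finrank K U = k ∧ rad ξ U = ⊥ := by
  refine and_congr_right fun h => ?_
  have := hξ.even_finrank_add_rad U
  rw [h] at this
  rw [← Submodule.finrank_eq_zero (R := K)]
  rw [Nat.even_iff] at this hk
  omega

theorem orth_mem_TR (hU : U ∈ TR ξ k) : ξ.orthogonal U ∈ TR ξ (finrank K V - k) := by
  refine ⟨?_, by rw [hξ.rad_orth]; exact hU.2⟩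
  have := hξ.finrank_orth U
  rw [hU.1] at this
  omega

theorem orth_mem_TR_iff (hk : k ≤ finrank K V) :
    ξ.orthogonal U ∈ TR ξ (finrank K V - k) ↔ U ∈ TR ξ k := by
  refine ⟨fun h => ?_, hξ.orth_mem_TR⟩
  have := hξ.orth_mem_TR h
  rwa [hξ.orth_orth, Nat.sub_sub_self hk] at this

end IsSymp

/-- Two subspaces that meet in a hyperplane of both. -/
theorem finrank_inf_iff_sup (hU : finrank K U = k) (hW : finrank K W = k) (hk : 1 ≤ k) :
    finrank K ↥(U ⊓ W) = k - 1 ↔ finrank K ↥(U ⊔ W) = k + 1 := by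
  have := finrank_sup_add_inf U W
  omega

theorem inf_eq_of_le (hU : finrank K U = k) (hW : finrank K W = k) (hk : 1 ≤ k)
    (hne : U ≠ W) (hHU : H ≤ U) (hHW : H ≤ W) (hH : finrank K H = k - 1) : U ⊓ W = H := by
  refine (eq_of_le_of_finrank (le_inf hHU hHW) ?_).symm
  by_contra hc
  have h1 : finrank K U ≤ finrank K ↥(U ⊓ W) := by omega
  have h2 := eq_of_le_of_finrank inf_le_left h1
  have h3 := eq_of_le_of_finrank (inf_le_right : U ⊓ W ≤ W) (by omega)
  exact hne (h2.symm.trans h3)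

theorem sup_eq_of_le (hU : finrank K U = k) (hW : finrank K W = k)
    (hne : U ≠ W) (hUB : U ≤ B) (hWB : W ≤ B) (hB : finrank K B = k + 1) : U ⊔ W = B := by
  refine eq_of_le_of_finrank (sup_le hUB hWB) ?_
  by_contra hc
  have h1 : finrank K ↥(U ⊔ W) ≤ finrank K U := by omega
  have h2 := eq_of_le_of_finrank le_sup_left h1
  have h3 := eq_of_le_of_finrank (le_sup_right : W ≤ U ⊔ W) (by omega)
  exact hne (h2.trans h3.symm)

/-- Two distinct members of a pencil determine it: its lower and upper bounds can only be their
intersection and their sum. -/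
theorem adjacent_iff (hk : 1 ≤ k) : Adjacent ξ k U W ↔ U ≠ W ∧ U ∈ TR ξ k ∧ W ∈ TR ξ k ∧
    U ⊓ W ∈ TR ξ (k - 1) ∧ U ⊔ W ∈ TR ξ (k + 1) := by
  constructor
  · rintro ⟨hne, g, ⟨H, hH, B, hB, hHB, rfl, -⟩, hU, hW⟩
    refine ⟨hne, hU.1, hW.1, ?_, ?_⟩
    · rwa [inf_eq_of_le hU.1.1 hW.1.1 hk hne hU.2.1 hW.2.1 hH.1]
    · rwa [sup_eq_of_le hU.1.1 hW.1.1 hne hU.2.2 hW.2.2 hB.1]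
  · rintro ⟨hne, hU, hW, hH, hB⟩
    refine ⟨hne, pencil ξ k (U ⊓ W) (U ⊔ W), ⟨_, hH, _, hB, inf_le_left.trans le_sup_left, rfl,
      U, hU, inf_le_left, le_sup_left⟩, ⟨hU, inf_le_left, le_sup_left⟩,
      ⟨hW, inf_le_right, le_sup_right⟩⟩

omit [FiniteDimensional K V] in
theorem Adjacent.symm (h : Adjacent ξ k U W) : Adjacent ξ k W U := by
  obtain ⟨hne, g, hg, h1, h2⟩ := h
  exact ⟨hne.symm, g, hg, h2, h1⟩

/-- Complementation exchanges the conditions on intersection and sum. This duality turns results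
about stars into results about tops, and `k > m` into `k < m`. -/
theorem IsSymp.adjacent_orth (hξ : IsSymp ξ) (hk : 1 ≤ k) (hkn : k + 1 ≤ finrank K V) :
    Adjacent ξ (finrank K V - k) (ξ.orthogonal U) (ξ.orthogonal W) ↔ Adjacent ξ k U W := by
  have e1 : finrank K V - k - 1 = finrank K V - (k + 1) := by omega
  have e2 : finrank K V - k + 1 = finrank K V - (k - 1) := by omega
  rw [adjacent_iff hk, adjacent_iff (by omega), e1, e2, ← IsSymp.orth_sup, ← hξ.orth_inf,
    hξ.orth_mem_TR_iff (by omega), hξ.orth_mem_TR_iff (by omega), hξ.orth_mem_TR_iff (by omega),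
    hξ.orth_mem_TR_iff (by omega), Ne, hξ.orth_inj]
  tauto

/-- Two subspaces that meet in a common hyperplane, with the intersection or the sum being
tangential or regular. -/
def WeakAdj (ξ : LinearMap.BilinForm K V) (k : ℕ) (U W : Submodule K V) : Prop :=
  U ∈ TR ξ k ∧ W ∈ TR ξ k ∧ finrank K ↥(U ⊓ W) = k - 1 ∧
    (U ⊓ W ∈ TR ξ (k - 1) ∨ U ⊔ W ∈ TR ξ (k + 1))

omit [FiniteDimensional K V] in
theorem WeakAdj.symm (h : WeakAdj ξ k U W) : WeakAdj ξ k W U := by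
  obtain ⟨h1, h2, h3, h4⟩ := h
  exact ⟨h2, h1, by rwa [inf_comm], by rwa [inf_comm, sup_comm]⟩

theorem Adjacent.weakAdj (hk : 1 ≤ k) (h : Adjacent ξ k U W) : WeakAdj ξ k U W := by
  obtain ⟨-, h1, h2, h3, -⟩ := (adjacent_iff hk).1 h
  exact ⟨h1, h2, h3.1, Or.inl h3⟩

/-- In even dimension, any two regular subspaces meeting in a common hyperplane are adjacent. -/
theorem IsSymp.adjacent_iff_even (hξ : IsSymp ξ) (hk : 1 ≤ k) (he : Even k) (hU : U ∈ TR ξ k)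
    (hW : W ∈ TR ξ k) : Adjacent ξ k U W ↔ finrank K ↥(U ⊓ W) = k - 1 := by
  rw [adjacent_iff hk]
  refine ⟨fun h => h.2.2.2.1.1, fun h => ?_⟩
  have h' := (finrank_inf_iff_sup hU.1 hW.1 hk).1 h
  have hr := (hξ.mem_TR_even he).1 hU
  have hr0 : finrank K (rad ξ U) = 0 := by rw [hr.2, finrank_bot]
  refine ⟨?_, hU, hW, ⟨h, ?_⟩, ⟨h', ?_⟩⟩
  · rintro rfl
    rw [inf_idem] at h
    have := hU.1
    omega
  · have := hξ.rad_hyperplane_le (inf_le_left : U ⊓ W ≤ U) (by rw [h, hU.1]; omega)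
    omega
  · have := IsSymp.rad_le_hyperplane (ξ := ξ) (le_sup_left : U ≤ U ⊔ W) (by rw [h', hU.1])
    omega

theorem IsSymp.adjacent_iff_weakAdj_even (hξ : IsSymp ξ) (hk : 1 ≤ k) (he : Even k) :
    Adjacent ξ k U W ↔ WeakAdj ξ k U W :=
  ⟨fun h => h.weakAdj hk, fun h => (hξ.adjacent_iff_even hk he h.1 h.2.1).2 h.2.2.1⟩

end Linear

/-! ### Stars of regular subspaces and weak adjacency -/

section Star

variable {K V : Type*} [Field K] [AddCommGroup V] [Module K V] [FiniteDimensional K V]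
variable {ξ : LinearMap.BilinForm K V} {H B G : Submodule K V} {k : ℕ}

theorem finrank_sup_span {p : V} (hp : p ∉ H) : finrank K ↥(H ⊔ K ∙ p) = finrank K H + 1 := by
  have h1 := finrank_sup_add_inf H (K ∙ p)
  have h2 : H < H ⊔ K ∙ p := lt_of_le_of_ne le_sup_left fun hc => hp (hc ▸
    Submodule.mem_sup_right (Submodule.mem_span_singleton_self p))
  have h3 := Submodule.finrank_lt_finrank_of_lt h2
  have h4 := finrank_span_singleton (K := K) (v := p) (fun h => hp (h ▸ H.zero_mem))
  omega

omit [FiniteDimensional K V] in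
theorem mem_sup_span {p x : V} : x ∈ H ⊔ K ∙ p ↔ ∃ h ∈ H, ∃ c : K, x = h + c • p := by
  rw [Submodule.mem_sup]
  constructor
  · rintro ⟨h, hh, y, hy, rfl⟩
    obtain ⟨c, rfl⟩ := Submodule.mem_span_singleton.1 hy
    exact ⟨h, hh, c, rfl⟩
  · rintro ⟨h, hh, c, rfl⟩
    exact ⟨h, hh, c • p, Submodule.mem_span_singleton.2 ⟨c, rfl⟩, rfl⟩

omit [FiniteDimensional K V] in
theorem mem_sup_span_self (H : Submodule K V) (p : V) : p ∈ H ⊔ K ∙ p :=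
  Submodule.mem_sup_right (Submodule.mem_span_singleton_self p)

theorem exists_mem_notMem_of_finrank_lt {U H : Submodule K V}
    (h : finrank K H < finrank K U) : ∃ u ∈ U, u ∉ H := by
  by_contra hc
  push Not at hc
  have := Submodule.finrank_mono (R := K) (s := U) (t := H) hc
  omega

theorem eq_sup_span {U : Submodule K V} (hHU : H ≤ U) (hd : finrank K U ≤ finrank K H + 1)
    {u : V} (hu : u ∈ U) (huH : u ∉ H) : U = H ⊔ K ∙ u := by
  refine (eq_of_le_of_finrank (sup_le hHU ((Submodule.span_singleton_le_iff_mem _ _).2 hu)) ?_).symm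
  rw [finrank_sup_span huH]
  exact hd

namespace IsSymp

variable (hξ : IsSymp ξ)
include hξ

omit hξ in
omit [FiniteDimensional K V] in
theorem eq_zero_of_rad (hH : rad ξ H = ⊥) {x : V} (hx : x ∈ H) (hx' : ∀ h ∈ H, ξ h x = 0) :
    x = 0 := by
  have : x ∈ rad ξ H := mem_rad.2 ⟨hx, hx'⟩
  rwa [hH, Submodule.mem_bot] at this

theorem exists_add_of_rad (hH : rad ξ H = ⊥) (x : V) :
    ∃ h ∈ H, ∃ p, (∀ h ∈ H, ξ h p = 0) ∧ x = h + p := by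
  have h1 := finrank_sup_add_inf H (ξ.orthogonal H)
  have h2 : finrank K ↥(H ⊓ ξ.orthogonal H) = 0 := by
    rw [← rad, hH, finrank_bot]
  have h3 := hξ.finrank_orth H
  have h4 : H ⊔ ξ.orthogonal H = ⊤ := Submodule.eq_top_of_finrank_eq (by omega)
  have hx : x ∈ H ⊔ ξ.orthogonal H := h4 ▸ Submodule.mem_top
  obtain ⟨h, hh, p, hp, rfl⟩ := Submodule.mem_sup.1 hx
  exact ⟨h, hh, p, mem_orthogonal.1 hp, rfl⟩

/-- A subspace containing a regular hyperplane `H` is spanned by `H` and its radical. -/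
theorem exists_eq_sup_span (hH : rad ξ H = ⊥) {U : Submodule K V} (hHU : H ≤ U)
    (hd : finrank K U = finrank K H + 1) :
    ∃ p, p ≠ 0 ∧ (∀ h ∈ H, ξ h p = 0) ∧ U = H ⊔ K ∙ p := by
  obtain ⟨u, hu, huH⟩ := exists_mem_notMem_of_finrank_lt (K := K) (U := U) (H := H) (by omega)
  obtain ⟨h, hh, p, hp, rfl⟩ := hξ.exists_add_of_rad hH u
  have hpU : p ∈ U := by simpa using U.sub_mem hu (hHU hh)
  have hpH : p ∉ H := fun hc => huH (H.add_mem hh hc)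
  exact ⟨p, fun h => hpH (h ▸ H.zero_mem), hp, eq_sup_span hHU hd.le hpU hpH⟩

theorem sup_span_mem_TR (hk : 1 ≤ k) (ho : Even (k - 1)) (hH : H ∈ TR ξ (k - 1)) {p : V}
    (hp : p ≠ 0) (hpH : ∀ h ∈ H, ξ h p = 0) : H ⊔ K ∙ p ∈ TR ξ k := by
  have hr := ((hξ.mem_TR_even ho).1 hH).2
  have hp' : p ∉ H := fun h => hp (eq_zero_of_rad hr h hpH)
  have h1 := finrank_sup_span hp'
  have h2 := rad_le_hyperplane (ξ := ξ) (le_sup_left : H ≤ H ⊔ K ∙ p) h1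
  rw [hr, finrank_bot] at h2
  refine ⟨?_, h2⟩
  rw [h1, hH.1]
  omega

/-- Adjacent subspaces of odd dimension do not have a common radical point. -/
theorem not_adjacent_of_orth (hk : 1 ≤ k) (ho : Even (k + 1)) {U X : Submodule K V} {p : V}
    (hp : p ≠ 0) (hpX : p ∈ X) (h1 : ∀ x ∈ X, ξ x p = 0) (h2 : ∀ x ∈ U, ξ x p = 0) :
    ¬ Adjacent ξ k X U := by
  intro h
  obtain ⟨-, -, -, -, hB⟩ := (adjacent_iff hk).1 h
  refine hp (eq_zero_of_rad ((hξ.mem_TR_even ho).1 hB).2 (Submodule.mem_sup_left hpX) ?_)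
  intro y hy
  obtain ⟨a, ha, b, hb, rfl⟩ := Submodule.mem_sup.1 hy
  simp [h1 a ha, h2 b hb]

/-- For regular `H` the star of `H` is the set of points of the symplectic space `H^⊥`. The sum is
regular exactly when `p`, `q` span a hyperbolic plane, so adjacency there is non-orthogonality. -/
theorem adjacent_sup_span_iff (hk : 1 ≤ k) (ho : Even (k - 1)) (hH : H ∈ TR ξ (k - 1)) {p q : V}
    (hp : p ≠ 0) (hq : q ≠ 0) (hpH : ∀ h ∈ H, ξ h p = 0) (hqH : ∀ h ∈ H, ξ h q = 0) :
    Adjacent ξ k (H ⊔ K ∙ p) (H ⊔ K ∙ q) ↔ ξ p q ≠ 0 := by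
  have ho' : Even (k + 1) := by
    have : k + 1 = k - 1 + 2 := by omega
    rw [this]
    exact ho.add even_two
  have hr := ((hξ.mem_TR_even ho).1 hH).2
  constructor
  · intro h hc
    refine hξ.not_adjacent_of_orth hk ho' hp (mem_sup_span_self H p) ?_ ?_ h
    · intro x hx
      obtain ⟨h, hh, c, rfl⟩ := mem_sup_span.1 hx
      simp [hpH h hh, hξ.self]
    · intro x hx
      obtain ⟨h, hh, c, rfl⟩ := mem_sup_span.1 hx
      simp [hpH h hh, hξ.comm.1 hc]
  · intro hpq
    have hqp : ξ q p ≠ 0 := fun h => hpq (hξ.comm.1 h)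
    have hp' : p ∉ H := fun h => hp (eq_zero_of_rad hr h hpH)
    have hqp' : q ∉ H ⊔ K ∙ p := by
      intro hx
      obtain ⟨h, hh, c, rfl⟩ := mem_sup_span.1 hx
      apply hqp
      simp [hpH h hh, hξ.self]
    have hU := hξ.sup_span_mem_TR hk ho hH hp hpH
    have hW := hξ.sup_span_mem_TR hk ho hH hq hqH
    have hne : H ⊔ K ∙ p ≠ H ⊔ K ∙ q := fun h => hqp' (h ▸ mem_sup_span_self H q)
    refine (adjacent_iff hk).2 ⟨hne, hU, hW, ?_, ?_⟩
    · rwa [inf_eq_of_le hU.1 hW.1 hk hne le_sup_left le_sup_left hH.1]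
    · have hs : H ⊔ K ∙ p ⊔ (H ⊔ K ∙ q) = H ⊔ K ∙ p ⊔ K ∙ q := by
        rw [← sup_assoc, sup_right_comm H (K ∙ p) H, sup_idem]
      rw [hs, hξ.mem_TR_even ho', finrank_sup_span hqp', hU.1]
      refine ⟨rfl, (Submodule.eq_bot_iff _).2 fun x hx => ?_⟩
      obtain ⟨hx, hx'⟩ := mem_rad.1 hx
      obtain ⟨y, hy, c, rfl⟩ := mem_sup_span.1 hx
      obtain ⟨h, hh, d, rfl⟩ := mem_sup_span.1 hy
      have e1 := hx' p (Submodule.mem_sup_left (mem_sup_span_self H p))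
      have e2 := hx' q (mem_sup_span_self _ q)
      simp only [map_add, map_smul, smul_eq_mul, hξ.self, mul_zero, add_zero,
        hξ.comm.1 (hpH h hh), hξ.comm.1 (hqH h hh), zero_add, mul_eq_zero, hpq, hqp,
        or_false] at e1 e2
      subst e1 e2
      simp only [zero_smul, add_zero] at hx' ⊢
      exact eq_zero_of_rad hr hh fun g hg =>
        hx' g (Submodule.mem_sup_left (Submodule.mem_sup_left hg))

end IsSymp

/-- Orthogonal complementation as a bijection between families of subspaces. -/
def orthEquiv (hξ : IsSymp ξ) (hk : k ≤ finrank K V) : TR ξ k ≃ TR ξ (finrank K V - k) where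
  toFun U := ⟨ξ.orthogonal U.1, hξ.orth_mem_TR U.2⟩
  invFun U := ⟨ξ.orthogonal U.1, by
    have := hξ.orth_mem_TR U.2
    rwa [Nat.sub_sub_self hk] at this⟩
  left_inv U := Subtype.ext (hξ.orth_orth U.1)
  right_inv U := Subtype.ext (hξ.orth_orth U.1)

/-- The common neighbours of two vertices contain four vertices of which all but one pair are
adjacent. -/
def Diamond {T : Type*} (A : T → T → Prop) (U Y : T) : Prop :=
  ∃ X X' Z Z', ((A X U ∧ A X Y) ∧ A X' U ∧ A X' Y) ∧ ((A Z U ∧ A Z Y) ∧ A Z' U ∧ A Z' Y) ∧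
    (A X X' ∧ (A X Z ∧ A X Z') ∧ A X' Z ∧ A X' Z') ∧ Z ≠ Z' ∧ ¬ A Z Z'

theorem Diamond.map {T S : Type*} {A : T → T → Prop} {A' : S → S → Prop} (e : T → S)
    (he : Function.Injective e) (h : ∀ x y, A' (e x) (e y) ↔ A x y) {U Y : T}
    (hd : Diamond A U Y) : Diamond A' (e U) (e Y) := by
  obtain ⟨X, X', Z, Z', hd⟩ := hd
  refine ⟨e X, e X', e Z, e Z', ?_⟩
  simpa only [h, he.ne_iff] using hd

/-- Adjacency as a relation on the elements of `TR`. -/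
def adjT (ξ : LinearMap.BilinForm K V) (k : ℕ) (U W : TR ξ k) : Prop := Adjacent ξ k U.1 W.1

/-- Weak adjacency as a relation on the elements of `TR`. -/
def weakT (ξ : LinearMap.BilinForm K V) (k : ℕ) (U W : TR ξ k) : Prop := WeakAdj ξ k U.1 W.1

namespace IsSymp

variable (hξ : IsSymp ξ)
include hξ

/-- In the non-adjacent case `U` and `Y` are orthogonal points `a`, `b` of `H^⊥`. With `f`
orthogonal to `H` and `ξ a f = ξ b f = 1`, every `f + α • a + β • b` is adjacent to both, and two
such points are adjacent iff their values of `α + β` differ. -/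
theorem diamond_of_star (h2 : (2 : K) ≠ 0) (hk : 1 ≤ k) (ho : Even (k - 1)) {U Y : TR ξ k}
    (hne : U ≠ Y) (hH : U.1 ⊓ Y.1 ∈ TR ξ (k - 1)) :
    adjT ξ k U Y ∨ Diamond (adjT ξ k) U Y := by
  obtain ⟨U, hU⟩ := U
  obtain ⟨Y, hY⟩ := Y
  replace hne : U ≠ Y := fun h => hne (Subtype.ext h)
  have hUH : U ⊓ Y ≤ U := inf_le_left
  have hYH : U ⊓ Y ≤ Y := inf_le_right
  change U ⊓ Y ∈ TR ξ (k - 1) at hH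
  generalize U ⊓ Y = H at *
  have hr := ((hξ.mem_TR_even ho).1 hH).2
  obtain ⟨a, ha, haH, rfl⟩ := hξ.exists_eq_sup_span hr hUH (by rw [hU.1, hH.1]; omega)
  obtain ⟨b, hb, hbH, rfl⟩ := hξ.exists_eq_sup_span hr hYH (by rw [hY.1, hH.1]; omega)
  by_cases hab : ξ a b = 0
  swap
  · exact Or.inl ((hξ.adjacent_sup_span_iff hk ho hH ha hb haH hbH).2 hab)
  right
  have hba := hξ.comm.1 hab
  -- Otherwise `b` would be a multiple of `a` and `Y = U`. Making `f` orthogonal to `a - b` forces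
  -- `ξ b f = ξ a f = 1`.
  have hsep : a ∉ H ⊔ K ∙ (a - b) := by
    intro h
    obtain ⟨h, hh, c, hc⟩ := mem_sup_span.1 h
    have h0 : h = 0 := by
      refine eq_zero_of_rad hr hh fun g hg => ?_
      rw [← sub_eq_iff_eq_add] at hc
      simp [← hc, haH g hg, hbH g hg]
    subst h0
    rw [zero_add] at hc
    rcases eq_or_ne c 0 with rfl | hc0
    · exact ha (by simpa using hc)
    · have hb' : b = (1 - c⁻¹) • a := by
        have : c⁻¹ • a = a - b := by
          conv_lhs => rw [hc]
          rw [smul_smul, inv_mul_cancel₀ hc0, one_smul]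
        rw [sub_smul, one_smul, this, sub_sub_cancel]
      have hle : H ⊔ K ∙ b ≤ H ⊔ K ∙ a := by
        refine sup_le le_sup_left ((Submodule.span_singleton_le_iff_mem _ _).2 ?_)
        rw [hb']
        exact Submodule.smul_mem _ _ (mem_sup_span_self H a)
      exact hne (eq_of_le_of_finrank hle (by rw [hU.1, hY.1])).symm
  obtain ⟨f, hf, haf⟩ := hξ.exists_sep hsep
  have hfH : ∀ h ∈ H, ξ h f = 0 := fun h hh => hf h (Submodule.mem_sup_left hh)
  have hbf : ξ b f = 1 := by
    have := hf (a - b) (mem_sup_span_self H _)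
    rw [map_sub, LinearMap.sub_apply, haf, sub_eq_zero] at this
    exact this.symm
  have hfa : ξ f a = -1 := by rw [hξ.neg, haf]
  have hfb : ξ f b = -1 := by rw [hξ.neg, hbf]
  let P : K → K → V := fun α β => f + α • a + β • b
  have haP : ∀ α β, ξ a (P α β) = 1 := fun α β => by simp [P, haf, hξ.self, hab]
  have hbP : ∀ α β, ξ b (P α β) = 1 := fun α β => by simp [P, hbf, hξ.self, hba]
  have hPP : ∀ α β α' β', ξ (P α β) (P α' β') = α + β - (α' + β') := fun α β α' β' => by
    simp only [P, map_add, map_smul, LinearMap.add_apply, LinearMap.smul_apply, hξ.self, hab, hba,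
      haf, hbf, hfa, hfb, smul_eq_mul]
    ring
  have hP0 : ∀ α β, P α β ≠ 0 := fun α β h => by
    have := haP α β
    rw [h, map_zero] at this
    exact zero_ne_one this
  have hPH : ∀ α β, ∀ h ∈ H, ξ h (P α β) = 0 := fun α β h hh => by
    simp [P, hfH h hh, haH h hh, hbH h hh]
  let Q : K → K → TR ξ k := fun α β =>
    ⟨H ⊔ K ∙ P α β, hξ.sup_span_mem_TR hk ho hH (hP0 α β) (hPH α β)⟩
  have hQa : ∀ α β, adjT ξ k (Q α β) ⟨_, hU⟩ := fun α β =>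
    (hξ.adjacent_sup_span_iff hk ho hH (hP0 α β) ha (hPH α β) haH).2
      (fun h => by have := hξ.comm.1 h; rw [haP] at this; exact one_ne_zero this)
  have hQb : ∀ α β, adjT ξ k (Q α β) ⟨_, hY⟩ := fun α β =>
    (hξ.adjacent_sup_span_iff hk ho hH (hP0 α β) hb (hPH α β) hbH).2
      (fun h => by have := hξ.comm.1 h; rw [hbP] at this; exact one_ne_zero this)
  have hQQ : ∀ α β α' β', adjT ξ k (Q α β) (Q α' β') ↔ α + β - (α' + β') ≠ 0 :=
    fun α β α' β' => by
      rw [← hPP]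
      exact hξ.adjacent_sup_span_iff hk ho hH (hP0 _ _) (hP0 _ _) (hPH _ _) (hPH _ _)
  -- The parameter sums are `1`, `-1`, `0`, `0`: only the last two coincide, and `1 ≠ -1` needs
  -- characteristic other than two.
  refine ⟨Q 1 0, Q (-1) 0, Q 0 0, Q 1 (-1), ⟨⟨hQa _ _, hQb _ _⟩, hQa _ _, hQb _ _⟩,
    ⟨⟨hQa _ _, hQb _ _⟩, hQa _ _, hQb _ _⟩, ?_, ?_, ?_⟩
  · simp only [hQQ]
    norm_num
    exact h2
  · intro h
    have h' : H ⊔ K ∙ P 0 0 = H ⊔ K ∙ P 1 (-1) := congrArg Subtype.val h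
    have h1 : P 1 (-1) ∈ H ⊔ K ∙ P 0 0 := h' ▸ mem_sup_span_self H _
    obtain ⟨g, hg, c, hc⟩ := mem_sup_span.1 h1
    have hc1 : c = 1 := by
      have := congrArg (ξ a) hc
      rw [haP, map_add, map_smul, haP, hξ.comm.1 (haH g hg)] at this
      simpa using this.symm
    subst hc1
    have hg' : a = g + (1 : K) • b := by
      have : P 1 (-1) = P 0 0 + a - b := by simp only [P]; module
      rw [this] at hc
      rw [one_smul] at hc ⊢
      calc a = (P 0 0 + a - b) + b - P 0 0 := by abel
        _ = g + b := by rw [hc]; abel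
    have hle : H ⊔ K ∙ a ≤ H ⊔ K ∙ b :=
      sup_le le_sup_left ((Submodule.span_singleton_le_iff_mem _ _).2
        (mem_sup_span.2 ⟨g, hg, 1, hg'⟩))
    exact hne (eq_of_le_of_finrank hle (by rw [hU.1, hY.1]))
  · rw [hQQ]
    norm_num

end IsSymp

/-- A subspace meeting two members of a pencil in hyperplanes contains the kernel or is contained
in the carrier of the pencil. -/
theorem inf_le_or_le_sup {U W X : Submodule K V} (hX : finrank K X = k)
    (hH : finrank K ↥(U ⊓ W) ≤ k - 1) (h1 : k ≤ finrank K ↥(X ⊓ U) + 1)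
    (h2 : k ≤ finrank K ↥(X ⊓ W) + 1) : U ⊓ W ≤ X ∨ X ≤ U ⊔ W := by
  by_cases hle : U ⊓ W ≤ X
  · exact Or.inl hle
  right
  have h3 := finrank_sup_add_inf (X ⊓ U) (X ⊓ W)
  have h4 : X ⊓ U ⊓ (X ⊓ W) < U ⊓ W := by
    refine lt_of_le_of_ne (inf_le_inf inf_le_right inf_le_right) fun h => hle ?_
    rw [← h]
    exact inf_le_left.trans inf_le_left
  have h5 := Submodule.finrank_lt_finrank_of_lt h4
  have h6 := eq_of_le_of_finrank (sup_le inf_le_left inf_le_left : X ⊓ U ⊔ X ⊓ W ≤ X) (by omega)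
  rw [← h6]
  exact sup_le_sup inf_le_right inf_le_right

theorem Adjacent.finrank_inf {U W : Submodule K V} (hk : 1 ≤ k) (h : Adjacent ξ k U W) :
    finrank K ↥(U ⊓ W) = k - 1 := ((adjacent_iff hk).1 h).2.2.2.1.1

theorem Adjacent.inf_eq_of_le {U W : Submodule K V} (hk : 1 ≤ k) (h : Adjacent ξ k U W)
    (hU : H ≤ U) (hW : H ≤ W) (hd : finrank K H = k - 1) : U ⊓ W = H :=
  SympGrass.inf_eq_of_le ((adjacent_iff hk).1 h).2.1.1 ((adjacent_iff hk).1 h).2.2.1.1 hk h.1 hU hW hd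

/-- If `U ∩ Y` has codimension two in `U` and `Y`, and two common neighbours of `U` and `Y` meet
`U` in the same hyperplane, then all common neighbours of the four subspaces are pairwise
adjacent. -/
theorem adjacent_of_row {U Y X X' Z Z' : Submodule K V} (hk : 2 ≤ k) (hU : finrank K U = k)
    (hY : finrank K Y = k) (hG : finrank K ↥(U ⊓ Y) = k - 2)
    (hXU : Adjacent ξ k X U) (hXY : Adjacent ξ k X Y) (hX'Y : Adjacent ξ k X' Y)
    (hZU : Adjacent ξ k Z U) (hZY : Adjacent ξ k Z Y) (hZ'U : Adjacent ξ k Z' U)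
    (hZ'Y : Adjacent ξ k Z' Y) (hXX' : Adjacent ξ k X X') (hXZ : Adjacent ξ k X Z)
    (hXZ' : Adjacent ξ k X Z') (hX'Z : Adjacent ξ k X' Z) (hX'Z' : Adjacent ξ k X' Z')
    (hne : Z ≠ Z') (hrow : X ⊓ U ≤ X') : Adjacent ξ k Z Z' := by
  have hk1 : 1 ≤ k := by omega
  obtain ⟨-, hXT, hX'T, hP, hQ⟩ := (adjacent_iff hk1).1 hXX'
  have hPd := hXU.finrank_inf hk1
  set P := X ⊓ U with hPdef
  have hXX'P : X ⊓ X' = P := hXX'.inf_eq_of_le hk1 inf_le_left hrow hPd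
  rw [hXX'P] at hP
  have hPX : P ≤ X := inf_le_left
  -- The hyperplanes `P` and `X ⊓ Y` of `X` meet in dimension at least `k - 2`, and `P ⊓ Y` lies in
  -- `U ⊓ Y`, which has dimension `k - 2`.
  have hPY : finrank K ↥(P ⊓ Y) = k - 2 := by
    have e1 := finrank_sup_add_inf P (X ⊓ Y)
    have e2 := hXY.finrank_inf hk1
    have e3 := Submodule.finrank_mono (R := K) (sup_le hPX inf_le_left : P ⊔ X ⊓ Y ≤ X)
    have e4 := Submodule.finrank_mono (R := K) (inf_le_inf_left P inf_le_right : P ⊓ (X ⊓ Y) ≤ P ⊓ Y)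
    have e5 := Submodule.finrank_mono (R := K) (inf_le_inf_right Y inf_le_right : P ⊓ Y ≤ U ⊓ Y)
    have e6 := hXT.1
    omega
  have hPYs := finrank_sup_add_inf P Y
  -- By dimension such a `Z` is the sum of `P` and `Z ⊓ Y`.
  have hle : ∀ Z, Adjacent ξ k Z Y → P ≤ Z → Z ≤ P ⊔ Y := by
    intro Z hZ hPZ
    have h1 := hZ.finrank_inf hk1
    have h2 := finrank_sup_add_inf P (Z ⊓ Y)
    have h3 : finrank K ↥(P ⊓ (Z ⊓ Y)) ≤ k - 2 :=
      (Submodule.finrank_mono (inf_le_inf_left _ inf_le_right)).trans hPY.le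
    have h4 := ((adjacent_iff hk1).1 hZ).2.1.1
    have h5 := eq_of_le_of_finrank (sup_le hPZ inf_le_left : P ⊔ Z ⊓ Y ≤ Z) (by omega)
    rw [← h5]
    exact sup_le_sup_left inf_le_right _
  have hQle : X ⊔ X' ≤ P ⊔ Y := sup_le (hle X hXY hPX) (hle X' hX'Y hrow)
  have hQU : (X ⊔ X') ⊓ U = P := by
    have h1 := finrank_sup_add_inf (P ⊔ Y) U
    have h2 := finrank_sup_add_inf U Y
    have h3 : U ⊔ Y ≤ P ⊔ Y ⊔ U := sup_le le_sup_right (le_sup_right.trans le_sup_left)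
    have h4 := Submodule.finrank_mono (R := K) h3
    have h5 := Submodule.finrank_mono (R := K) (inf_le_inf_right U hQle)
    exact (eq_of_le_of_finrank (le_inf (hPX.trans le_sup_left) inf_le_right)
      (by omega)).symm
  -- `Z` contains `X ⊓ X' = P` or lies in `X ⊔ X'`. In the second case `Z ⊓ U` is inside `(X ⊔ X') ⊓
  -- U = P` and equals it by dimension. So `Z` belongs to the pencil between `P` and `X ⊔ X'`.
  have key : ∀ Z, Adjacent ξ k Z U → Adjacent ξ k Z Y → Adjacent ξ k X Z → Adjacent ξ k X' Z →
      P ≤ Z ∧ Z ≤ X ⊔ X' := by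
    intro Z hZU hZY hXZ hX'Z
    have hPZ : P ≤ Z := by
      have h0 : finrank K ↥(X ⊓ X') ≤ k - 1 := by rw [hXX'P, hPd]
      have hZX := hXZ.symm.finrank_inf hk1
      have hZX' := hX'Z.symm.finrank_inf hk1
      rcases inf_le_or_le_sup (U := X) (W := X') (((adjacent_iff hk1).1 hZU).2.1.1) h0
        (by omega) (by omega) with h | h
      · rwa [hXX'P] at h
      · have h1 : Z ⊓ U ≤ P := hQU ▸ inf_le_inf_right U h
        have h2 := hZU.finrank_inf hk1
        have h3 := eq_of_le_of_finrank h1 (by omega)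
        rw [← h3]
        exact inf_le_left
    refine ⟨hPZ, ?_⟩
    have h1 : X ⊔ X' = P ⊔ Y := by
      refine eq_of_le_of_finrank hQle ?_
      have e6 := hQ.1
      omega
    rw [h1]
    exact hle Z hZY hPZ
  obtain ⟨hZ1, hZ2⟩ := key Z hZU hZY hXZ hX'Z
  obtain ⟨hZ'1, hZ'2⟩ := key Z' hZ'U hZ'Y hXZ' hX'Z'
  have hZT := ((adjacent_iff hk1).1 hZU).2.1
  have hZ'T := ((adjacent_iff hk1).1 hZ'U).2.1
  refine (adjacent_iff hk1).2 ⟨hne, hZT, hZ'T, ?_, ?_⟩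
  · rwa [SympGrass.inf_eq_of_le hZT.1 hZ'T.1 hk1 hne hZ1 hZ'1 hPd]
  · rwa [sup_eq_of_le hZT.1 hZ'T.1 hne hZ2 hZ'2 hQ.1]

/-- A common neighbour `X` forces `U ⊓ Y` to have dimension at least `k - 2`. In dimension `k - 1`
either `X ⊓ U = U ⊓ Y` or `X ⊔ U = U ⊔ Y`, which puts this subspace in `TR`. Dimension `k - 2` is
impossible by `adjacent_of_row`. -/
theorem weakT_of_diamond (hk : 1 ≤ k) {U Y : TR ξ k} (hne : U ≠ Y)
    (h : Diamond (adjT ξ k) U Y) : weakT ξ k U Y := by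
  obtain ⟨⟨X, hX⟩, ⟨X', hX'⟩, ⟨Z, hZ⟩, ⟨Z', hZ'⟩, ⟨⟨hXU, hXY⟩, hX'U, hX'Y⟩,
    ⟨⟨hZU, hZY⟩, hZ'U, hZ'Y⟩, ⟨hXX', ⟨hXZ, hXZ'⟩, hX'Z, hX'Z'⟩, hZne, hZZ'⟩ := h
  obtain ⟨U, hU⟩ := U
  obtain ⟨Y, hY⟩ := Y
  simp only [adjT, weakT, ne_eq, Subtype.mk.injEq] at *
  have h1 := hXU.finrank_inf hk
  have h2 := hXY.finrank_inf hk
  have e1 := finrank_sup_add_inf (X ⊓ U) (X ⊓ Y)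
  have e2 := Submodule.finrank_mono (R := K)
    (sup_le inf_le_left inf_le_left : X ⊓ U ⊔ X ⊓ Y ≤ X)
  have e3 : X ⊓ U ⊓ (X ⊓ Y) ≤ U ⊓ Y := inf_le_inf inf_le_right inf_le_right
  have e4 := Submodule.finrank_mono (R := K) e3
  have e5 := hX.1
  have e6 : finrank K ↥(U ⊓ Y) < k := by
    by_contra hc
    push Not at hc
    have h3 := eq_of_le_of_finrank (inf_le_left : U ⊓ Y ≤ U) (by rw [hU.1]; exact hc)
    have h4 := eq_of_le_of_finrank (inf_le_right : U ⊓ Y ≤ Y) (by rw [hY.1]; exact hc)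
    exact hne (h3.symm.trans h4)
  obtain hd | ⟨hk2, hd⟩ : finrank K ↥(U ⊓ Y) = k - 1 ∨
      (2 ≤ k ∧ finrank K ↥(U ⊓ Y) = k - 2) := by omega
  · refine ⟨hU, hY, hd, ?_⟩
    have hU1 := hU.1
    have hY1 := hY.1
    rcases inf_le_or_le_sup hX.1 hd.le (by omega) (by omega) with h | h
    · left
      rw [← hXU.inf_eq_of_le hk h inf_le_left hd]
      exact ((adjacent_iff hk).1 hXU).2.2.2.1
    · right
      rw [← sup_eq_of_le hX.1 hU.1 hXU.1 h le_sup_left ((finrank_inf_iff_sup hU.1 hY.1 hk).1 hd)]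
      exact ((adjacent_iff hk).1 hXU).2.2.2.2
  · exfalso
    have hk2' : 2 ≤ k := hk2
    -- If both fail, then `X'` lies in `X ⊔ U` and in `X ⊔ Y`, which meet only in `X`.
    have hrow : X ⊓ U ≤ X' ∨ X ⊓ Y ≤ X' := by
      by_contra hc
      push Not at hc
      have hX'X := hXX'.symm.finrank_inf hk
      have h3 := hX'U.finrank_inf hk
      have h4 := hX'Y.finrank_inf hk
      have h5 := (inf_le_or_le_sup hX'.1 h1.le (by omega) (by omega)).resolve_left hc.1
      have h6 := (inf_le_or_le_sup hX'.1 h2.le (by omega) (by omega)).resolve_left hc.2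
      have f1 := finrank_sup_add_inf (X ⊔ U) (X ⊔ Y)
      have f2 := finrank_sup_add_inf U Y
      have f3 := Submodule.finrank_mono (R := K)
        (sup_le_sup le_sup_right le_sup_right : U ⊔ Y ≤ X ⊔ U ⊔ (X ⊔ Y))
      have f4 := (finrank_inf_iff_sup hX.1 hU.1 hk).1 h1
      have f5 := (finrank_inf_iff_sup hX.1 hY.1 hk).1 h2
      have f6 := hU.1
      have f7 := hY.1
      have f8 := eq_of_le_of_finrank (le_inf le_sup_left le_sup_left :
        X ≤ (X ⊔ U) ⊓ (X ⊔ Y)) (by omega)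
      have f9 : X' ≤ X := by
        rw [f8]
        exact le_inf h5 h6
      exact hXX'.1 (eq_of_le_of_finrank f9 (by rw [hX.1, hX'.1])).symm
    rcases hrow with h | h
    · exact hZZ' (adjacent_of_row hk2 hU.1 hY.1 hd hXU hXY hX'Y hZU hZY hZ'U hZ'Y hXX' hXZ
        hXZ' hX'Z hX'Z' hZne h)
    · exact hZZ' (adjacent_of_row hk2 hY.1 hU.1 (by rwa [inf_comm]) hXY hXU hX'U hZY hZU
        hZ'Y hZ'U hXX' hXZ hXZ' hX'Z hX'Z' hZne h)

/-- In odd dimension, weak adjacency is expressed in terms of adjacency. -/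
theorem IsSymp.weakT_iff_odd (hξ : IsSymp ξ) (h2 : (2 : K) ≠ 0) (hk : 1 ≤ k)
    (hkn : k + 1 ≤ finrank K V) (ho : Odd k) (hn : Even (finrank K V)) (U Y : TR ξ k) :
    weakT ξ k U Y ↔ adjT ξ k U Y ∨ (U ≠ Y ∧ Diamond (adjT ξ k) U Y) := by
  have ho1 : Even (k - 1) := by rw [Nat.odd_iff] at ho; rw [Nat.even_iff]; omega
  constructor
  · intro h
    have hne : U ≠ Y := by
      rintro rfl
      have h1 := h.2.2.1
      have h2 := U.2.1
      rw [inf_idem] at h1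
      omega
    rcases h.2.2.2 with hH | hB
    · exact (hξ.diamond_of_star h2 hk ho1 hne hH).imp_right fun h => ⟨hne, h⟩
    -- When the sum is regular, the complements of `U` and `Y` meet in its regular complement; the
    -- diamond is found there and carried back.
    · have ho2 : Even (finrank K V - k - 1) := by
        rw [Nat.odd_iff] at ho; rw [Nat.even_iff] at hn ⊢; omega
      have e1 : finrank K V - k - 1 = finrank K V - (k + 1) := by omega
      let e := orthEquiv hξ (k := k) (by omega)
      have he : ∀ X Y : TR ξ k, adjT ξ (finrank K V - k) (e X) (e Y) ↔ adjT ξ k X Y :=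
        fun X Y => hξ.adjacent_orth hk hkn
      have h3 : (e U).1 ⊓ (e Y).1 ∈ TR ξ (finrank K V - k - 1) := by
        rw [e1]
        change ξ.orthogonal U.1 ⊓ ξ.orthogonal Y.1 ∈ _
        rw [← orth_sup]
        exact hξ.orth_mem_TR hB
      rcases hξ.diamond_of_star h2 (by omega) ho2 (e.injective.ne hne) h3 with h | h
      · exact Or.inl ((he U Y).1 h)
      · refine Or.inr ⟨hne, ?_⟩
        have := h.map e.symm e.symm.injective (A' := adjT ξ k) (fun x y => by rw [← he]; simp)
        simpa using this
  · rintro (h | ⟨hne, h⟩)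
    · exact Adjacent.weakAdj hk h
    · exact weakT_of_diamond hk hne h

end Star

/-! ### Cliques of weak adjacency -/

section Cliques

/-- Equality or the relation `O`. -/
def EqOr {T : Type*} (O : T → T → Prop) (X Y : T) : Prop := X = Y ∨ O X Y

/-- `X` is equal or related to both `U` and `W`. -/
def Nbr {T : Type*} (O : T → T → Prop) (U W X : T) : Prop := EqOr O X U ∧ EqOr O X W

/-- The line through `U` and `W`. -/
def OnLine {T : Type*} (O : T → T → Prop) (U W X : T) : Prop :=
  Nbr O U W X ∧ ∀ Y, Nbr O U W Y → EqOr O X Y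

/-- `U`, `W`, `X` span a maximal clique. -/
def OffLine {T : Type*} (O : T → T → Prop) (U W X : T) : Prop :=
  Nbr O U W X ∧ ∃ Y, Nbr O U W Y ∧ ¬ EqOr O X Y

/-- The maximal clique spanned by `U`, `W`, `X`. -/
def InClique {T : Type*} (O : T → T → Prop) (U W X Y : T) : Prop := Nbr O U W Y ∧ EqOr O Y X

/-- Joining the points of a set by lines. -/
def Joined {T : Type*} (A O : T → T → Prop) (S : T → Prop) (Z : T) : Prop :=
  S Z ∨ ∃ X Y, (S X ∧ S Y) ∧ A X Y ∧ OnLine O X Y Z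

/-- The set obtained from a tuple of points by joining points by lines `N` times. -/
def Generated {T : Type*} (A O : T → T → Prop) {r : ℕ} (u : Fin r → T) : ℕ → T → Prop
  | 0 => fun Z => ∃ i, Z = u i
  | N + 1 => Joined A O (Generated A O u N)

/-- The clique `C` is generated by `r` points in `r` steps. -/
def SmallSpan {T : Type*} (A O : T → T → Prop) (r : ℕ) (C : T → Prop) : Prop :=
  ∃ u : Fin r → T, (∀ i, C (u i)) ∧ ∀ X, C X → Generated A O u r X

/-- The clique `C` contains `r` points such that each point of it is related to one of them. -/
def SmallPerp {T : Type*} (A : T → T → Prop) (r : ℕ) (C : T → Prop) : Prop :=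
  ∃ u : Fin r → T, (∀ i, C (u i)) ∧ ∀ X, C X → ∃ i, A X (u i)

theorem SmallPerp.map {T S : Type*} {A : T → T → Prop} {A' : S → S → Prop} (e : T ≃ S)
    (h : ∀ x y, A' (e x) (e y) ↔ A x y) {r : ℕ} {C : T → Prop} (hd : SmallPerp A r C) :
    SmallPerp A' r (fun s => C (e.symm s)) := by
  obtain ⟨u, hu, hu'⟩ := hd
  refine ⟨fun i => e (u i), fun i => by simpa using hu i, fun X hX => ?_⟩
  obtain ⟨i, hi⟩ := hu' _ hX
  exact ⟨i, by rw [← h] at hi; simpa using hi⟩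

variable {K V : Type*} [Field K] [AddCommGroup V] [Module K V] [FiniteDimensional K V]
variable {ξ : LinearMap.BilinForm K V} {H B G : Submodule K V} {k : ℕ}

omit [FiniteDimensional K V] in
theorem le_finrank_of_eqOr (X Y : TR ξ k) : EqOr (weakT ξ k) X Y →
    k ≤ finrank K ↥(X.1 ⊓ Y.1) + 1 := by
  rintro (rfl | h)
  · rw [inf_idem, X.2.1]
    omega
  · have := h.2.2.1
    omega

theorem eqOr_weakT_of_le (hk : 1 ≤ k) (hH : H ∈ TR ξ (k - 1)) {X Y : TR ξ k} (hX : H ≤ X.1)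
    (hY : H ≤ Y.1) : EqOr (weakT ξ k) X Y := by
  by_cases hne : X = Y
  · exact Or.inl hne
  · have h := inf_eq_of_le X.2.1 Y.2.1 hk (fun h => hne (Subtype.ext h)) hX hY hH.1
    exact Or.inr ⟨X.2, Y.2, by rw [h, hH.1], Or.inl (h.symm ▸ hH)⟩

theorem eqOr_weakT_of_ge (hk : 1 ≤ k) (hB : B ∈ TR ξ (k + 1)) {X Y : TR ξ k} (hX : X.1 ≤ B)
    (hY : Y.1 ≤ B) : EqOr (weakT ξ k) X Y := by
  by_cases hne : X = Y
  · exact Or.inl hne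
  · have h := sup_eq_of_le X.2.1 Y.2.1 (fun h => hne (Subtype.ext h)) hX hY hB.1
    refine Or.inr ⟨X.2, Y.2, ?_, Or.inr (h.symm ▸ hB)⟩
    rw [finrank_inf_iff_sup X.2.1 Y.2.1 hk, h, hB.1]

/-- Members of a star and of a top outside of the common line are not related. -/
theorem not_eqOr_weakT (hk : 1 ≤ k) (hHd : finrank K H = k - 1) {X Y : TR ξ k}
    (hHB : H ≤ B) (hX : H ≤ X.1) (hXB : ¬ X.1 ≤ B) (hY : Y.1 ≤ B) (hHY : ¬ H ≤ Y.1) :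
    ¬ EqOr (weakT ξ k) X Y := by
  intro h
  have h1 := le_finrank_of_eqOr X Y h
  have h2 : X.1 ⊓ B < X.1 := lt_of_le_of_ne inf_le_left fun h => hXB (h ▸ inf_le_right)
  have h3 := Submodule.finrank_lt_finrank_of_lt h2
  have h4 := X.2.1
  have h5 := eq_of_le_of_finrank (le_inf hX hHB) (by omega)
  have h6 : X.1 ⊓ Y.1 ≤ H := by
    rw [h5]
    exact inf_le_inf_left _ hY
  have h7 := eq_of_le_of_finrank h6 (by omega)
  exact hHY (h7 ▸ inf_le_right)

namespace IsSymp

variable (hξ : IsSymp ξ)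
include hξ

/-- Adjoin a vector outside `A`. For regular `H`, subtracting its `H`-component makes it orthogonal
to `H`. If `H` has a radical vector `r`, the new vector must pair nontrivially with `r`, so that the
radical disappears. -/
theorem exists_above (hk : 1 ≤ k) (hH : H ∈ TR ξ (k - 1)) {A : Submodule K V} (hHA : H ≤ A)
    (hA : finrank K A < finrank K V) : ∃ X : TR ξ k, H ≤ X.1 ∧ ¬ X.1 ≤ A := by
  obtain ⟨x, hx⟩ : ∃ x, x ∉ A := by
    by_contra hc
    push Not at hc
    rw [Submodule.eq_top_iff'.2 hc, finrank_top] at hA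
    exact lt_irrefl _ hA
  rcases Nat.even_or_odd (k - 1) with he | ho
  · obtain ⟨h, hh, p, hp, rfl⟩ := hξ.exists_add_of_rad ((hξ.mem_TR_even he).1 hH).2 x
    have hpA : p ∉ A := fun h' => hx (A.add_mem (hHA hh) h')
    refine ⟨⟨H ⊔ K ∙ p, hξ.sup_span_mem_TR hk he hH (fun h => hpA (h ▸ A.zero_mem)) hp⟩,
      le_sup_left, fun h => hpA (h (mem_sup_span_self H p))⟩
  · have he : Even k := by rw [Nat.odd_iff] at ho; rw [Nat.even_iff]; omega
    have hr : finrank K (rad ξ H) = 1 := by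
      have h1 := hξ.even_finrank_add_rad H
      have h2 := hH.2
      have h3 := hH.1
      rw [Nat.even_iff] at h1
      rw [Nat.odd_iff] at ho
      omega
    obtain ⟨⟨r, hr1⟩, hr0, hr2⟩ := finrank_eq_one_iff'.1 hr
    replace hr0 : r ≠ 0 := fun h => hr0 (Subtype.ext h)
    obtain ⟨hrH, hrH'⟩ := mem_rad.1 hr1
    -- Neither the proper subspace `A` nor `r^⊥` covers `V`, and their union does not either: one of
    -- `x`, `z`, `x + z` avoids both.
    obtain ⟨y, hy, hyA⟩ : ∃ y, ξ r y ≠ 0 ∧ y ∉ A := by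
      by_cases hrx : ξ r x = 0
      · obtain ⟨z, -, hz⟩ := hξ.exists_sep (W := ⊥) (a := r) (by simpa using hr0)
        by_cases hzA : z ∈ A
        · refine ⟨x + z, by simp [hrx, hz], fun h => hx ?_⟩
          simpa using A.sub_mem h hzA
        · exact ⟨z, by simp [hz], hzA⟩
      · exact ⟨x, hrx, hx⟩
    have hyH : y ∉ H := fun h => hyA (hHA h)
    refine ⟨⟨H ⊔ K ∙ y, (hξ.mem_TR_even he).2 ⟨?_, ?_⟩⟩, le_sup_left,
      fun h => hyA (h (mem_sup_span_self H y))⟩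
    · rw [finrank_sup_span hyH, hH.1]
      omega
    · refine (Submodule.eq_bot_iff _).2 fun v hv => ?_
      obtain ⟨hv, hv'⟩ := mem_rad.1 hv
      obtain ⟨h, hh, c, rfl⟩ := mem_sup_span.1 hv
      have h1 := hv' r (Submodule.mem_sup_left hrH)
      rw [map_add, map_smul, hξ.comm.1 (hrH' h hh), zero_add, smul_eq_mul, mul_eq_zero,
        or_iff_left hy] at h1
      subst h1
      simp only [zero_smul, add_zero] at hv' ⊢
      obtain ⟨d, hd⟩ := hr2 ⟨h, mem_rad.2 ⟨hh, fun g hg => hv' g (Submodule.mem_sup_left hg)⟩⟩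
      have hd' : d • r = h := congrArg Subtype.val hd
      subst hd'
      have h2 := hv' y (mem_sup_span_self H y)
      rw [map_smul, smul_eq_mul, mul_eq_zero, hξ.comm, or_iff_left hy] at h2
      rw [h2, zero_smul]

theorem exists_below (hkn : k + 1 ≤ finrank K V) (hB : B ∈ TR ξ (k + 1))
    {A : Submodule K V} (hAB : A ≤ B) (hA : A ≠ ⊥) : ∃ X : TR ξ k, X.1 ≤ B ∧ ¬ A ≤ X.1 := by
  have hB' : ξ.orthogonal B ∈ TR ξ (finrank K V - k - 1) := hξ.orth_mem_TR hB
  have hA' : 0 < finrank K A := Nat.pos_of_ne_zero fun h => hA (Submodule.finrank_eq_zero.1 h)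
  have h1 := hξ.finrank_orth A
  obtain ⟨X, hX, hX'⟩ := hξ.exists_above (by omega) hB' (hξ.orth_le_orth.2 hAB) (by omega)
  let e := orthEquiv hξ (k := k) (by omega)
  obtain ⟨Y, rfl⟩ := e.surjective X
  exact ⟨Y, hξ.orth_le_orth.1 hX, fun h => hX' (hξ.orth_le_orth.2 h)⟩

section

variable {U W X Y : TR ξ k} (hk : 2 ≤ k) (hkn : k + 2 ≤ finrank K V)
  (hUW : adjT ξ k U W)
include hk hkn hUW

omit hξ hkn in
-- By dimension, a subspace meeting `U` and `W` in at least hyperplanes is in the star or in the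
-- top; conversely the star and the top are cliques of weak adjacency.
theorem nbr_iff : Nbr (weakT ξ k) U W X ↔ U.1 ⊓ W.1 ≤ X.1 ∨ X.1 ≤ U.1 ⊔ W.1 := by
  have hk1 : 1 ≤ k := by omega
  obtain ⟨-, -, -, hH, hB⟩ := (adjacent_iff hk1).1 hUW
  constructor
  · rintro ⟨h1, h2⟩
    exact inf_le_or_le_sup X.2.1 hH.1.le (le_finrank_of_eqOr _ _ h1) (le_finrank_of_eqOr _ _ h2)
  · rintro (h | h)
    · exact ⟨eqOr_weakT_of_le hk1 hH h inf_le_left, eqOr_weakT_of_le hk1 hH h inf_le_right⟩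
    · exact ⟨eqOr_weakT_of_ge hk1 hB h le_sup_left, eqOr_weakT_of_ge hk1 hB h le_sup_right⟩

omit hξ hkn in
theorem inClique_of_star (hX : U.1 ⊓ W.1 ≤ X.1) (hXB : ¬ X.1 ≤ U.1 ⊔ W.1) :
    InClique (weakT ξ k) U W X Y ↔ U.1 ⊓ W.1 ≤ Y.1 := by
  have hk1 : 1 ≤ k := by omega
  obtain ⟨-, -, -, hH, hB⟩ := (adjacent_iff hk1).1 hUW
  rw [InClique, nbr_iff hk hUW]
  constructor
  · rintro ⟨h | h, hYX⟩
    · exact h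
    · by_contra hY
      have hXY : EqOr (weakT ξ k) X Y := hYX.imp Eq.symm WeakAdj.symm
      exact not_eqOr_weakT hk1 hH.1 (inf_le_left.trans le_sup_left) hX hXB h hY hXY
  · exact fun h => ⟨Or.inl h, eqOr_weakT_of_le hk1 hH h hX⟩

omit hξ hkn in
theorem inClique_of_top (hX : ¬ U.1 ⊓ W.1 ≤ X.1) (hXB : X.1 ≤ U.1 ⊔ W.1) :
    InClique (weakT ξ k) U W X Y ↔ Y.1 ≤ U.1 ⊔ W.1 := by
  have hk1 : 1 ≤ k := by omega
  obtain ⟨-, -, -, hH, hB⟩ := (adjacent_iff hk1).1 hUW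
  rw [InClique, nbr_iff hk hUW]
  constructor
  · rintro ⟨h | h, hYX⟩
    · by_contra hY
      exact not_eqOr_weakT hk1 hH.1 (inf_le_left.trans le_sup_left) h hY hXB hX hYX
    · exact h
  · exact fun h => ⟨Or.inr h, eqOr_weakT_of_ge hk1 hB h hXB⟩

theorem exists_star : ∃ X : TR ξ k, U.1 ⊓ W.1 ≤ X.1 ∧ ¬ X.1 ≤ U.1 ⊔ W.1 := by
  have hk1 : 1 ≤ k := by omega
  obtain ⟨-, -, -, hH, hB⟩ := (adjacent_iff hk1).1 hUW
  exact hξ.exists_above hk1 hH (inf_le_left.trans le_sup_left) (by rw [hB.1]; omega)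

theorem exists_top : ∃ X : TR ξ k, X.1 ≤ U.1 ⊔ W.1 ∧ ¬ U.1 ⊓ W.1 ≤ X.1 := by
  have hk1 : 1 ≤ k := by omega
  obtain ⟨-, -, -, hH, hB⟩ := (adjacent_iff hk1).1 hUW
  refine hξ.exists_below (by omega) hB (inf_le_left.trans le_sup_left) fun h => ?_
  have := hH.1
  rw [h, finrank_bot] at this
  omega

/-- Members of the star off the pencil are unrelated to members of the top off the pencil, and both
kinds exist. So exactly the pencil is related to all common neighbours. -/
theorem onLine_iff : OnLine (weakT ξ k) U W X ↔ U.1 ⊓ W.1 ≤ X.1 ∧ X.1 ≤ U.1 ⊔ W.1 := by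
  have hk1 : 1 ≤ k := by omega
  obtain ⟨-, -, -, hH, hB⟩ := (adjacent_iff hk1).1 hUW
  have hle : U.1 ⊓ W.1 ≤ U.1 ⊔ W.1 := inf_le_left.trans le_sup_left
  simp only [OnLine, nbr_iff hk hUW]
  constructor
  · rintro ⟨h | h, hall⟩
    · refine ⟨h, ?_⟩
      by_contra hX
      obtain ⟨Y, hY, hY'⟩ := hξ.exists_top hk hkn hUW
      exact not_eqOr_weakT hk1 hH.1 hle h hX hY hY' (hall Y (Or.inr hY))
    · refine ⟨?_, h⟩
      by_contra hX
      obtain ⟨Y, hY, hY'⟩ := hξ.exists_star hk hkn hUW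
      exact not_eqOr_weakT hk1 hH.1 hle hY hY' h hX
        ((hall Y (Or.inl hY)).imp Eq.symm WeakAdj.symm)
  · rintro ⟨h1, h2⟩
    exact ⟨Or.inl h1, fun Y hY => hY.elim (eqOr_weakT_of_le hk1 hH h1)
      (eqOr_weakT_of_ge hk1 hB h2)⟩

theorem offLine_iff : OffLine (weakT ξ k) U W X ↔
    (U.1 ⊓ W.1 ≤ X.1 ∧ ¬ X.1 ≤ U.1 ⊔ W.1) ∨ (¬ U.1 ⊓ W.1 ≤ X.1 ∧ X.1 ≤ U.1 ⊔ W.1) := by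
  have h1 : OffLine (weakT ξ k) U W X ↔ Nbr (weakT ξ k) U W X ∧ ¬ OnLine (weakT ξ k) U W X := by
    unfold OffLine OnLine
    push Not
    tauto
  rw [h1, hξ.onLine_iff hk hkn hUW, nbr_iff hk hUW]
  tauto

end

end IsSymp

/-- `X` contains the intersection of the adjacent elements `U`, `W`, expressed in terms of
cliques; `Small` is a property that distinguishes tops from stars. -/
def Above {T : Type*} (O : T → T → Prop) (Small : (T → Prop) → Prop) (U W X : T) : Prop :=
  ∃ Y, (OffLine O U W Y ∧ ¬ Small (InClique O U W Y)) ∧ InClique O U W Y X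

/-- An off-line neighbour `Y` selects the star or the top as its clique, and `Small` rejects the
top; membership in the remaining clique means containing `U ⊓ W`. -/
theorem IsSymp.above_iff (hξ : IsSymp ξ) (hk : 2 ≤ k) (hkn : k + 2 ≤ finrank K V)
    {Small : (TR ξ k → Prop) → Prop}
    (hS : ∀ H ∈ TR ξ (k - 1), ¬ Small (fun X => H ≤ X.1))
    (hT : ∀ B ∈ TR ξ (k + 1), Small (fun X => X.1 ≤ B)) {U W X : TR ξ k} (hUW : adjT ξ k U W) :
    Above (weakT ξ k) Small U W X ↔ U.1 ⊓ W.1 ≤ X.1 := by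
  have hk1 : 1 ≤ k := by omega
  obtain ⟨-, -, -, hH, hB⟩ := (adjacent_iff hk1).1 hUW
  have e1 : ∀ Y : TR ξ k, U.1 ⊓ W.1 ≤ Y.1 → ¬ Y.1 ≤ U.1 ⊔ W.1 →
      InClique (weakT ξ k) U W Y = fun X => U.1 ⊓ W.1 ≤ X.1 := fun Y h1 h2 => by
    funext Z
    exact propext (inClique_of_star hk hUW h1 h2)
  have e2 : ∀ Y : TR ξ k, ¬ U.1 ⊓ W.1 ≤ Y.1 → Y.1 ≤ U.1 ⊔ W.1 →
      InClique (weakT ξ k) U W Y = fun X => X.1 ≤ U.1 ⊔ W.1 := fun Y h1 h2 => by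
    funext Z
    exact propext (inClique_of_top hk hUW h1 h2)
  constructor
  · rintro ⟨Y, ⟨hY, hY'⟩, hX⟩
    rcases (hξ.offLine_iff hk hkn hUW).1 hY with ⟨h1, h2⟩ | ⟨h1, h2⟩
    · exact (inClique_of_star hk hUW h1 h2).1 hX
    · rw [e2 Y h1 h2] at hY'
      exact absurd (hT _ hB) hY'
  · intro hX
    obtain ⟨Y, h1, h2⟩ := hξ.exists_star hk hkn hUW
    refine ⟨Y, ⟨(hξ.offLine_iff hk hkn hUW).2 (Or.inl ⟨h1, h2⟩), ?_⟩,
      (inClique_of_star hk hUW h1 h2).2 hX⟩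
    rw [e1 Y h1 h2]
    exact hS _ hH

end Cliques

/-! ### Distinguishing stars from tops -/

section Dimension

variable {K V : Type*} [Field K] [AddCommGroup V] [Module K V] [FiniteDimensional K V]
variable {ξ : LinearMap.BilinForm K V} {H B G : Submodule K V} {k : ℕ}

/-- Each member of the star contributes at most one dimension beyond `H`. -/
theorem exists_sum_of_star (hk : 1 ≤ k) (hH : finrank K H = k - 1) {r : ℕ} (u : Fin r → TR ξ k)
    (hu : ∀ i, H ≤ (u i).1) :
    ∃ A : Submodule K V, H ≤ A ∧ (∀ i, (u i).1 ≤ A) ∧ finrank K A ≤ k - 1 + r := by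
  have key : ∀ s : Finset (Fin r), finrank K ↥(H ⊔ s.sup fun i => (u i).1) ≤ k - 1 + s.card := by
    intro s
    induction s using Finset.induction_on with
    | empty => rw [Finset.sup_empty, sup_bot_eq, hH, Finset.card_empty, add_zero]
    | insert i s hi ih =>
      rw [Finset.sup_insert, Finset.card_insert_of_notMem hi]
      have e : H ⊔ ((u i).1 ⊔ s.sup fun i => (u i).1) = (u i).1 ⊔ (H ⊔ s.sup fun i => (u i).1) := by
        rw [sup_left_comm]
      rw [e]
      have h1 := finrank_sup_add_inf (u i).1 (H ⊔ s.sup fun i => (u i).1)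
      have h2 := Submodule.finrank_mono (R := K) (le_inf (hu i) le_sup_left :
        H ≤ (u i).1 ⊓ (H ⊔ s.sup fun i => (u i).1))
      have h3 := (u i).2.1
      omega
  refine ⟨H ⊔ Finset.univ.sup fun i => (u i).1, le_sup_left, fun i => ?_, ?_⟩
  · exact (Finset.le_sup (f := fun i => (u i).1) (Finset.mem_univ i)).trans le_sup_right
  · simpa using key Finset.univ

theorem exists_spanning_family {A R : Submodule K V} (hAR : A ≤ R) {r : ℕ}
    (hd : finrank K R ≤ finrank K A + r) :
    ∃ e : Fin r → V, (∀ i, e i ∈ R) ∧ ∀ x ∈ R, ∃ c : Fin r → K, ∃ a ∈ A, x = a + ∑ i, c i • e i := by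
  induction r generalizing R with
  | zero =>
    obtain rfl := eq_of_le_of_finrank hAR (by omega)
    exact ⟨Fin.elim0, fun i => i.elim0, fun x hx => ⟨Fin.elim0, x, hx, by simp⟩⟩
  | succ r ih =>
    by_cases h : finrank K R ≤ finrank K A
    · obtain rfl := eq_of_le_of_finrank hAR h
      exact ⟨0, fun i => A.zero_mem, fun x hx => ⟨0, x, hx, by simp⟩⟩
    · obtain ⟨y, hy, hyA⟩ := exists_mem_notMem_of_finrank_lt (not_le.1 h)
      -- A functional vanishing on `A` but not at `y` splits off the coordinate along `y` and leaves
      -- a smaller space above `A`.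
      obtain ⟨f, hf⟩ := Submodule.exists_le_ker_of_notMem hyA
      have hlt : R ⊓ LinearMap.ker f < R := by
        refine lt_of_le_of_ne inf_le_left fun h => hf.1 ?_
        have : y ∈ R ⊓ LinearMap.ker f := h.symm ▸ hy
        exact this.2
      have h1 := Submodule.finrank_lt_finrank_of_lt hlt
      obtain ⟨e, he, he'⟩ := ih (R := R ⊓ LinearMap.ker f) (le_inf hAR hf.2) (by omega)
      refine ⟨Fin.cons y e, Fin.cases hy fun i => (he i).1, fun x hx => ?_⟩
      have hx' : x - (f x / f y) • y ∈ R ⊓ LinearMap.ker f := by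
        refine ⟨R.sub_mem hx (R.smul_mem _ hy), ?_⟩
        have := hf.1
        simp [this]
      obtain ⟨c, a, ha, hc⟩ := he' _ hx'
      refine ⟨Fin.cons (f x / f y) c, a, ha, ?_⟩
      rw [Fin.sum_univ_succ]
      simp only [Fin.cons_zero, Fin.cons_succ]
      rw [sub_eq_iff_eq_add] at hc
      refine hc.trans ?_
      abel

namespace IsSymp

variable (hξ : IsSymp ξ)
include hξ

/-- `k + 1` members of the star span, with `H`, dimension at most `2 * k < finrank K V`. A nonzero
vector orthogonal to that span yields a member of the star adjacent to none of them. -/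
theorem not_smallPerp_star (hk : 1 ≤ k) (ho : Odd k) (hkn : 2 * k < finrank K V)
    (hH : H ∈ TR ξ (k - 1)) : ¬ SmallPerp (adjT ξ k) (k + 1) (fun X => H ≤ X.1) := by
  rintro ⟨u, hu, hu'⟩
  have he : Even (k - 1) := by rw [Nat.odd_iff] at ho; rw [Nat.even_iff]; omega
  obtain ⟨A, hHA, huA, hA⟩ := exists_sum_of_star hk hH.1 u hu
  have h1 := hξ.finrank_orth A
  obtain ⟨q, hq, hq0⟩ := exists_mem_notMem_of_finrank_lt (K := K) (U := ξ.orthogonal A) (H := ⊥)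
    (by rw [finrank_bot]; omega)
  replace hq0 : q ≠ 0 := by simpa using hq0
  rw [mem_orthogonal] at hq
  have hqH : ∀ h ∈ H, ξ h q = 0 := fun h hh => hq h (hHA hh)
  obtain ⟨i, hi⟩ := hu' ⟨H ⊔ K ∙ q, hξ.sup_span_mem_TR hk he hH hq0 hqH⟩ le_sup_left
  refine hξ.not_adjacent_of_orth hk ho.add_one hq0 (mem_sup_span_self H q) ?_ ?_ hi
  · intro x hx
    obtain ⟨h, hh, c, rfl⟩ := mem_sup_span.1 hx
    simp [hqH h hh, hξ.self]
  · exact fun x hx => hq x (huA i hx)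

/-- Take the members given by a basis of the regular space `H^⊥`: no nonzero vector there is
orthogonal to the whole basis. -/
theorem smallPerp_star (hk : 1 ≤ k) (ho : Odd k) (hH : H ∈ TR ξ (k - 1)) {r : ℕ}
    (hr : finrank K V - k + 1 = r) (hkn : k ≤ finrank K V) :
    SmallPerp (adjT ξ k) r (fun X => H ≤ X.1) := by
  have he : Even (k - 1) := by rw [Nat.odd_iff] at ho; rw [Nat.even_iff]; omega
  have hrad := ((hξ.mem_TR_even he).1 hH).2
  have h1 := hξ.finrank_orth H
  have h2 := hH.1
  let b := Module.finBasisOfFinrankEq K (ξ.orthogonal H) (n := r) (by omega)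
  have hb0 : ∀ i, (b i : V) ≠ 0 := fun i h => b.ne_zero i (Subtype.ext h)
  have hbH : ∀ i, ∀ h ∈ H, ξ h (b i : V) = 0 := fun i => mem_orthogonal.1 (b i).2
  refine ⟨fun i => ⟨H ⊔ K ∙ (b i : V), hξ.sup_span_mem_TR hk he hH (hb0 i) (hbH i)⟩,
    fun i => le_sup_left, ?_⟩
  rintro ⟨X, hX⟩ hHX
  obtain ⟨p, hp, hpH, rfl⟩ := hξ.exists_eq_sup_span hrad hHX (by rw [hX.1, hH.1]; omega)
  by_contra hc
  push Not at hc
  have h3 : ∀ i, ξ (b i : V) p = 0 := fun i => by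
    have := hc i
    rw [adjT, hξ.adjacent_sup_span_iff hk he hH hp (hb0 i) hpH (hbH i), not_not] at this
    exact hξ.comm.1 this
  have h4 : p ∈ ξ.orthogonal H := mem_orthogonal.2 hpH
  have h5 : rad ξ (ξ.orthogonal H) = ⊥ := by rw [hξ.rad_orth, hrad]
  refine hp (eq_zero_of_rad h5 h4 fun y hy => ?_)
  have h6 := b.sum_repr ⟨y, hy⟩
  have h7 : y = ∑ i, b.repr ⟨y, hy⟩ i • (b i : V) := by
    have := (congrArg Subtype.val h6).symm
    rwa [Submodule.coe_sum] at this
  rw [h7]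
  simp [h3]

/-- This is `smallPerp_star` for the complement of `B`, whose own complement has dimension `k + 1`.
-/
theorem smallPerp_top (hk : 1 ≤ k) (hkn : k + 1 ≤ finrank K V) (ho : Odd k)
    (hn : Even (finrank K V)) (hB : B ∈ TR ξ (k + 1)) :
    SmallPerp (adjT ξ k) (k + 1) (fun X => X.1 ≤ B) := by
  have hB' : ξ.orthogonal B ∈ TR ξ (finrank K V - k - 1) := hξ.orth_mem_TR hB
  have ho' : Odd (finrank K V - k) := by
    rw [Nat.even_iff] at hn; rw [Nat.odd_iff] at ho ⊢; omega
  have h1 := hξ.smallPerp_star (by omega) ho' hB' (r := k + 1) (by omega) (by omega)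
  let e := orthEquiv hξ (k := k) (by omega)
  have he : ∀ X Y : TR ξ k, adjT ξ (finrank K V - k) (e X) (e Y) ↔ adjT ξ k X Y :=
    fun X Y => hξ.adjacent_orth hk hkn
  have h2 := h1.map e.symm (A' := adjT ξ k) (fun x y => by rw [← he]; simp)
  have h3 : (fun X : TR ξ k => ξ.orthogonal B ≤ (e.symm.symm X).1) = fun X => X.1 ≤ B := by
    funext X
    exact propext hξ.orth_le_orth
  rwa [h3] at h2

/-- Lines stay below the sum of their generators, so `k + 1` members generate only subspaces of a
space of dimension at most `2 * k`, which is proper. -/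
theorem not_smallSpan_star (hk : 2 ≤ k) (hkn : 2 * k < finrank K V)
    (hH : H ∈ TR ξ (k - 1)) :
    ¬ SmallSpan (adjT ξ k) (weakT ξ k) (k + 1) (fun X => H ≤ X.1) := by
  rintro ⟨u, hu, hu'⟩
  obtain ⟨A, hHA, huA, hA⟩ := exists_sum_of_star (by omega) hH.1 u hu
  have key : ∀ N X, Generated (adjT ξ k) (weakT ξ k) u N X → X.1 ≤ A := by
    intro N
    induction N with
    | zero =>
      rintro X ⟨i, rfl⟩
      exact huA i
    | succ N ih =>
      rintro X (h | ⟨Y, Z, ⟨hY, hZ⟩, hYZ, hX⟩)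
      · exact ih X h
      · exact ((hξ.onLine_iff hk (by omega) hYZ).1 hX).2.trans (sup_le (ih Y hY) (ih Z hZ))
  obtain ⟨X, hX, hX'⟩ := hξ.exists_above (by omega) hH hHA (by omega)
  exact hX' (key _ X (hu' X hX))

/-- The members of the top are the hyperplanes of `B` missing its radical point `r`. They are `B ⊓
z^⊥` with `ξ r z = 1`, where `z` counts modulo `B^⊥`: an affine space of dimension `k`, generated by
an origin and `k` further points. -/
theorem smallSpan_top (h2 : (2 : K) ≠ 0) (hk : 2 ≤ k) (hkn : k + 2 ≤ finrank K V)
    (he : Even k) (hB : B ∈ TR ξ (k + 1)) :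
    SmallSpan (adjT ξ k) (weakT ξ k) (k + 1) (fun X => X.1 ≤ B) := by
  have hk1 : 1 ≤ k := by omega
  have hr : finrank K (rad ξ B) = 1 := by
    have h1 := hξ.even_finrank_add_rad B
    have h2 := hB.2
    have h3 := hB.1
    rw [Nat.even_iff] at h1 he
    omega
  obtain ⟨⟨r, hr1⟩, hr0, hr2⟩ := finrank_eq_one_iff'.1 hr
  replace hr0 : r ≠ 0 := fun h => hr0 (Subtype.ext h)
  obtain ⟨hrB, hrB'⟩ := mem_rad.1 hr1
  have hD : ∀ z, ξ r z = 1 → B ⊓ ξ.orthogonal (K ∙ z) ∈ TR ξ k := by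
    intro z hz
    have hzr : ξ z r = -1 := by rw [hξ.neg, hz]
    have h1 := hξ.finrank_inf_orth_span (U := B) (f := z) ⟨r, hrB, by simp [hzr]⟩
    have h2 := hB.1
    refine (hξ.mem_TR_even he).2 ⟨by omega, (Submodule.eq_bot_iff _).2 fun x hx => ?_⟩
    obtain ⟨⟨hxB, hxz⟩, hx'⟩ := mem_rad.1 hx
    replace hxz : ξ z x = 0 := mem_orthogonal_span.1 hxz
    have hxr : x ∈ rad ξ B := by
      refine mem_rad.2 ⟨hxB, fun y hy => ?_⟩
      have := hx' (y + ξ z y • r) ⟨B.add_mem hy (B.smul_mem _ hrB),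
        mem_orthogonal_span.2 (by simp [hzr])⟩
      simpa [hξ.comm.1 (hrB' x hxB)] using this
    obtain ⟨d, hd⟩ := hr2 ⟨x, hxr⟩
    have hd' : d • r = x := congrArg Subtype.val hd
    subst hd'
    have h0 : d = 0 := by simpa [hzr] using hxz
    rw [h0, zero_smul]
  let D : {z : V // ξ r z = 1} → TR ξ k := fun z => ⟨B ⊓ ξ.orthogonal (K ∙ z.1), hD z.1 z.2⟩
  have hDB : ∀ z, (D z).1 ≤ B := fun z => inf_le_left
  -- Affine combinations of the parameters `z` lie on the line of the corresponding subspaces.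
  have hline : ∀ (S : TR ξ k → Prop) (w y z : {z : V // ξ r z = 1}) (t : K),
      z.1 = t • w.1 + (1 - t) • y.1 → S (D w) → S (D y) →
      Joined (adjT ξ k) (weakT ξ k) S (D z) := by
    intro S w y z t hz hw hy
    have hle : (D w).1 ⊓ (D y).1 ≤ (D z).1 := by
      rintro x ⟨hx1, hx2⟩
      have e1 : ξ w.1 x = 0 := mem_orthogonal_span.1 hx1.2
      have e2 : ξ y.1 x = 0 := mem_orthogonal_span.1 hx2.2
      exact ⟨hx1.1, mem_orthogonal_span.2 (by simp [hz, e1, e2])⟩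
    by_cases hne : D w = D y
    · left
      have : (D w).1 = (D z).1 := eq_of_le_of_finrank (by simpa [hne] using hle)
        (by rw [(D z).2.1, (D w).2.1])
      rwa [← Subtype.ext this]
    · right
      have hs := sup_eq_of_le (D w).2.1 (D y).2.1 (fun h => hne (Subtype.ext h)) (hDB w) (hDB y)
        hB.1
      have hadj : adjT ξ k (D w) (D y) := by
        refine (hξ.adjacent_iff_even hk1 he (D w).2 (D y).2).2 ?_
        rw [finrank_inf_iff_sup (D w).2.1 (D y).2.1 hk1, hs, hB.1]
      exact ⟨D w, D y, ⟨hw, hy⟩, hadj, (hξ.onLine_iff hk hkn hadj).2 ⟨hle, hs ▸ hDB z⟩⟩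
  have hsurj : ∀ X : TR ξ k, X.1 ≤ B → ∃ z, D z = X := by
    intro X hX
    have hrX : r ∉ X.1 := fun h => hr0 (eq_zero_of_rad ((hξ.mem_TR_even he).1 X.2).2 h
      fun y hy => hrB' y (hX hy))
    obtain ⟨f, hf, hf1⟩ := hξ.exists_sep hrX
    refine ⟨⟨f, hf1⟩, Subtype.ext (eq_of_le_of_finrank ?_ ?_).symm⟩
    · exact le_inf hX fun x hx => mem_orthogonal_span.2 (hξ.comm.1 (hf x hx))
    · rw [(D _).2.1, X.2.1]
  obtain ⟨z₀, -, hz₀⟩ := hξ.exists_sep (W := ⊥) (a := r) (by simpa using hr0)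
  have hR : ξ.orthogonal B ≤ ξ.orthogonal (K ∙ r) := hξ.orth_le_orth.2
    ((Submodule.span_singleton_le_iff_mem _ _).2 hrB)
  have f1 := hξ.finrank_orth B
  have f2 := hξ.finrank_orth (K ∙ r)
  rw [finrank_span_singleton hr0] at f2
  have f3 := hB.1
  obtain ⟨e, he', hspan⟩ := exists_spanning_family (r := k) hR (by omega)
  replace he' : ∀ i, ξ r (e i) = 0 := fun i => mem_orthogonal_span.1 (he' i)
  have hsum : ∀ (s : Finset (Fin k)) (c : Fin k → K), ξ r (z₀ + ∑ i ∈ s, c i • e i) = 1 := by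
    intro s c
    simp [hz₀, he']
  let u : Fin (k + 1) → TR ξ k :=
    Fin.cons (D ⟨z₀, hz₀⟩) fun i => D ⟨z₀ + e i, by simp [hz₀, he']⟩
  -- Induction on the number of coordinates used, at the cost of one joining step for each; the
  -- initial `+ 1` pays for scaling a single coordinate.
  have key : ∀ (s : Finset (Fin k)) (N : ℕ), s.card + 1 ≤ N → ∀ c : Fin k → K,
      Generated (adjT ξ k) (weakT ξ k) u N (D ⟨z₀ + ∑ i ∈ s, c i • e i, hsum s c⟩) := by
    have hmono : ∀ N X, Generated (adjT ξ k) (weakT ξ k) u N X →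
        Generated (adjT ξ k) (weakT ξ k) u (N + 1) X := fun N X h => Or.inl h
    have h0 : ∀ N, Generated (adjT ξ k) (weakT ξ k) u N (D ⟨z₀, hz₀⟩) := by
      intro N
      induction N with
      | zero => exact ⟨0, rfl⟩
      | succ N ih => exact hmono _ _ ih
    have h1 : ∀ N i, Generated (adjT ξ k) (weakT ξ k) u N
        (D ⟨z₀ + e i, by simp [hz₀, he']⟩) := by
      intro N i
      induction N with
      | zero => exact ⟨i.succ, rfl⟩
      | succ N ih => exact hmono _ _ ih
    intro s
    induction s using Finset.induction_on with
    | empty =>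
      intro N _ c
      simpa using h0 N
    | insert i s hi ih =>
      intro N hN c
      rw [Finset.card_insert_of_notMem hi] at hN
      obtain ⟨N, rfl⟩ : ∃ N', N = N' + 1 := ⟨N - 1, by omega⟩
      obtain ⟨N, rfl⟩ : ∃ N', N = N' + 1 := ⟨N - 1, by omega⟩
      -- The new point is `2 • w - y`, where `w` has the halved new coordinate and `y` the negated
      -- old ones; halving needs characteristic other than two.
      have hw : Generated (adjT ξ k) (weakT ξ k) u (N + 1)
          (D ⟨z₀ + (c i / 2) • e i, by simp [hz₀, he']⟩) :=
        hline _ ⟨z₀ + e i, by simp [hz₀, he']⟩ ⟨z₀, hz₀⟩ _ (c i / 2)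
          (by simp only; module) (h1 N i) (h0 N)
      have hy := ih (N + 1) (by omega) (fun j => - c j)
      refine hline _ _ _ _ 2 ?_ hw hy
      simp only [Finset.sum_insert hi, neg_smul, Finset.sum_neg_distrib]
      have : (2 : K) • (z₀ + (c i / 2) • e i) = (2 : K) • z₀ + c i • e i := by
        rw [smul_add, smul_smul, mul_div_cancel₀ _ h2]
      rw [this]
      module
  refine ⟨u, fun i => ?_, fun X hX => ?_⟩
  · refine Fin.cases ?_ (fun i => ?_) i
    · exact hDB _
    · exact hDB _
  · obtain ⟨z, rfl⟩ := hsurj X hX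
    obtain ⟨c, a, ha, hc⟩ := hspan (z.1 - z₀) (mem_orthogonal_span.2 (by simp [z.2, hz₀]))
    have h3 := key Finset.univ (k + 1) (by simp) c
    have h4 : D ⟨z₀ + ∑ i, c i • e i, hsum _ c⟩ = D z := by
      have hz : z.1 = z₀ + ∑ i, c i • e i + a := by
        rw [sub_eq_iff_eq_add] at hc
        rw [hc]
        abel
      refine Subtype.ext (eq_of_le_of_finrank ?_ (by rw [(D z).2.1, (D _).2.1]))
      rintro x ⟨hx1, hx2⟩
      have e1 := mem_orthogonal_span.1 hx2
      refine ⟨hx1, mem_orthogonal_span.2 ?_⟩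
      simp only at e1
      rw [hz, map_add, LinearMap.add_apply, e1, zero_add]
      exact hξ.comm.1 (mem_orthogonal.1 ha x hx1)
    rwa [h4] at h3

end IsSymp

end Dimension

/-! ### Descending by one dimension -/

section Descent

variable {K V : Type*} [Field K] [AddCommGroup V] [Module K V] [FiniteDimensional K V]
variable {ξ : LinearMap.BilinForm K V} {H B G : Submodule K V} {j k : ℕ}

/-- Two subspaces are contained in a common element of `TR (j + 1)`. -/
def Joint (ξ : LinearMap.BilinForm K V) (j : ℕ) (H₁ H₂ : TR ξ j) : Prop :=
  ∃ U : TR ξ (j + 1), H₁.1 ≤ U.1 ∧ H₂.1 ≤ U.1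

theorem Joint.sup_mem {H₁ H₂ : TR ξ j} (h : Joint ξ j H₁ H₂) (hne : H₁ ≠ H₂) :
    H₁.1 ⊔ H₂.1 ∈ TR ξ (j + 1) := by
  obtain ⟨U, h1, h2⟩ := h
  rw [sup_eq_of_le H₁.2.1 H₂.2.1 (fun h => hne (Subtype.ext h)) h1 h2 U.2.1]
  exact U.2

theorem Joint.le_finrank_inf {H₁ H₂ : TR ξ j} (h : Joint ξ j H₁ H₂) :
    j ≤ finrank K ↥(H₁.1 ⊓ H₂.1) + 1 := by
  obtain ⟨U, h1, h2⟩ := h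
  have e1 := finrank_sup_add_inf H₁.1 H₂.1
  have e2 := Submodule.finrank_mono (R := K) (sup_le h1 h2)
  have e3 := H₁.2.1
  have e4 := H₂.2.1
  have e5 := U.2.1
  omega

theorem IsSymp.adjT_iff_joint_even (hξ : IsSymp ξ) (hj : 1 ≤ j) (he : Even j) (H₁ H₂ : TR ξ j) :
    adjT ξ j H₁ H₂ ↔ H₁ ≠ H₂ ∧ Joint ξ j H₁ H₂ := by
  constructor
  · intro h
    obtain ⟨h1, -, -, -, h2⟩ := (adjacent_iff hj).1 h
    exact ⟨fun h => h1 (congrArg _ h), ⟨_, h2⟩, le_sup_left, le_sup_right⟩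
  · rintro ⟨hne, h⟩
    refine (hξ.adjacent_iff_even hj he H₁.2 H₂.2).2 ?_
    rw [finrank_inf_iff_sup H₁.2.1 H₂.2.1 hj, (h.sup_mem hne).1]

/-- The witnesses of orthogonality not being transitive in the quotient by `H₁ ∩ H₂`. -/
def NonTransitive (ξ : LinearMap.BilinForm K V) (j : ℕ) (H₁ H₂ : TR ξ j) (U : TR ξ (j + 1)) :
    Prop :=
  ∃ J₁ J₂ J₃ : TR ξ j,
    ((¬ J₁.1 ≤ U.1 ∧ Joint ξ j J₁ H₁ ∧ Joint ξ j J₁ H₂) ∧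
      (¬ J₂.1 ≤ U.1 ∧ Joint ξ j J₂ H₁ ∧ Joint ξ j J₂ H₂) ∧
      (¬ J₃.1 ≤ U.1 ∧ Joint ξ j J₃ H₁ ∧ Joint ξ j J₃ H₂)) ∧
    (¬ Joint ξ j J₁ J₂ ∧ ¬ Joint ξ j J₂ J₃) ∧ J₁ ≠ J₃ ∧ Joint ξ j J₁ J₃

namespace IsSymp

variable (hξ : IsSymp ξ)
include hξ

/-- The elements above the regular intersection `G` are points of `G^⊥`, and distinct ones are joint
iff they are not orthogonal. Outside the plane of `a`, `b` there is room for `p₁ ⟂ p₂ ⟂ p₃` with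
`p₁`, `p₃` not orthogonal. -/
theorem nonTransitive_of_adjT (h2 : (2 : K) ≠ 0) (hj : 1 ≤ j) (ho : Odd j)
    (hjn : j + 2 ≤ finrank K V) {H₁ H₂ : TR ξ j} (h : adjT ξ j H₁ H₂) :
    H₁ ≠ H₂ ∧ ∃ U : TR ξ (j + 1), (H₁.1 ≤ U.1 ∧ H₂.1 ≤ U.1) ∧ NonTransitive ξ j H₁ H₂ U := by
  have he : Even (j - 1) := by rw [Nat.odd_iff] at ho; rw [Nat.even_iff]; omega
  obtain ⟨H₁, hH₁⟩ := H₁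
  obtain ⟨H₂, hH₂⟩ := H₂
  have hadj : Adjacent ξ j H₁ H₂ := h
  obtain ⟨hne, -, -, hG, hU⟩ := (adjacent_iff hj).1 hadj
  refine ⟨fun h => hne (congrArg Subtype.val h), ⟨_, hU⟩, ⟨le_sup_left, le_sup_right⟩, ?_⟩
  have hG1 : H₁ ⊓ H₂ ≤ H₁ := inf_le_left
  have hG2 : H₁ ⊓ H₂ ≤ H₂ := inf_le_right
  generalize H₁ ⊓ H₂ = G at hG hG1 hG2
  have hr := ((hξ.mem_TR_even he).1 hG).2
  have hrU := ((hξ.mem_TR_even ho.add_one).1 hU).2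
  obtain ⟨a, ha, haG, rfl⟩ := hξ.exists_eq_sup_span hr hG1 (by rw [hH₁.1, hG.1]; omega)
  obtain ⟨b, hb, hbG, rfl⟩ := hξ.exists_eq_sup_span hr hG2 (by rw [hH₂.1, hG.1]; omega)
  have hc := (hξ.adjacent_sup_span_iff hj he hG ha hb haG hbG).1 hadj
  have hUd := hU.1
  have hUd' := hξ.finrank_orth (G ⊔ K ∙ a ⊔ (G ⊔ K ∙ b))
  have haU : a ∈ G ⊔ K ∙ a ⊔ (G ⊔ K ∙ b) := Submodule.mem_sup_left (mem_sup_span_self G a)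
  have hbU : b ∈ G ⊔ K ∙ a ⊔ (G ⊔ K ∙ b) := Submodule.mem_sup_right (mem_sup_span_self G b)
  have hGU : G ≤ G ⊔ K ∙ a ⊔ (G ⊔ K ∙ b) := le_sup_left.trans le_sup_left
  generalize G ⊔ K ∙ a ⊔ (G ⊔ K ∙ b) = U at *
  obtain ⟨e, heU, he0⟩ := exists_mem_notMem_of_finrank_lt (K := K) (U := ξ.orthogonal U) (H := ⊥)
    (by rw [finrank_bot]; omega)
  replace he0 : e ≠ 0 := by simpa using he0
  rw [mem_orthogonal] at heU
  have heU' : e ∉ U := fun h => he0 (eq_zero_of_rad hrU h heU)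
  obtain ⟨f, hfU, hef⟩ := hξ.exists_sep heU'
  have hfU' : f ∉ U := fun h => by
    rw [eq_zero_of_rad hrU h hfU, map_zero] at hef
    exact zero_ne_one hef
  have hae := heU a haU
  have hbe := heU b hbU
  have haf := hfU a haU
  have hbf := hfU b hbU
  have hba : ξ b a = - ξ a b := hξ.neg _ _
  set c := ξ a b with hcdef
  -- Each `pᵢ` pairs with `a` and `b` to `± c`. The coefficient `2` in `p₂` and the factor `c` in
  -- `p₃` give `ξ p₂ p₃ = 0` while `ξ p₁ p₃ = -c`.
  set p₁ := a + b + e with hp₁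
  set p₂ := a + b + (2 : K) • e with hp₂
  set p₃ := a - b + c • f with hp₃
  have hpG : (∀ g ∈ G, ξ g p₁ = 0) ∧ (∀ g ∈ G, ξ g p₂ = 0) ∧ ∀ g ∈ G, ξ g p₃ = 0 := by
    refine ⟨fun g hg => ?_, fun g hg => ?_, fun g hg => ?_⟩ <;>
    simp [hp₁, hp₂, hp₃, haG g hg, hbG g hg, heU g (hGU hg), hfU g (hGU hg)]
  obtain ⟨hp₁G, hp₂G, hp₃G⟩ := hpG
  have e1a : ξ p₁ a = -c := by simp [hp₁, hξ.self, hba, hξ.comm.1 hae]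
  have e1b : ξ p₁ b = c := by simp [hp₁, hξ.self, hξ.comm.1 hbe, hcdef]
  have e2a : ξ p₂ a = -c := by simp [hp₂, hξ.self, hba, hξ.comm.1 hae]
  have e2b : ξ p₂ b = c := by simp [hp₂, hξ.self, hξ.comm.1 hbe, hcdef]
  have e3a : ξ p₃ a = c := by simp [hp₃, hξ.self, hba, hξ.comm.1 haf]
  have e3b : ξ p₃ b = c := by simp [hp₃, hξ.self, hξ.comm.1 hbf, hcdef]
  have e12 : ξ p₁ p₂ = 0 := by
    rw [hp₂, map_add, map_add, e1a, e1b, map_smul]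
    simp [hp₁, hae, hbe, hξ.self]
  have e13 : ξ p₁ p₃ = -c := by
    rw [hp₃, map_add, map_sub, e1a, e1b, map_smul]
    simp [hp₁, haf, hbf, hef]
  have e23 : ξ p₂ p₃ = 0 := by
    rw [hp₃, map_add, map_sub, e2a, e2b, map_smul]
    simp only [hp₂, map_add, map_smul, LinearMap.add_apply, LinearMap.smul_apply, haf, hbf, hef,
      smul_eq_mul]
    ring
  have hc' : -c ≠ 0 := neg_ne_zero.2 hc
  have hp₁0 : p₁ ≠ 0 := fun h => by rw [h, map_zero, LinearMap.zero_apply] at e1b; exact hc e1b.symm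
  have hp₂0 : p₂ ≠ 0 := fun h => by rw [h, map_zero, LinearMap.zero_apply] at e2b; exact hc e2b.symm
  have hp₃0 : p₃ ≠ 0 := fun h => by rw [h, map_zero, LinearMap.zero_apply] at e3b; exact hc e3b.symm
  have hjoint : ∀ {p q : V} (hp : G ⊔ K ∙ p ∈ TR ξ j) (hq : G ⊔ K ∙ q ∈ TR ξ j), p ≠ 0 → q ≠ 0 →
      (∀ g ∈ G, ξ g p = 0) → (∀ g ∈ G, ξ g q = 0) → ξ p q ≠ 0 →
      Joint ξ j ⟨_, hp⟩ ⟨_, hq⟩ := by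
    intro p q hp hq hp0 hq0 hpG hqG hpq
    have := (hξ.adjacent_sup_span_iff hj he hG hp0 hq0 hpG hqG).2 hpq
    exact ⟨⟨_, ((adjacent_iff hj).1 this).2.2.2.2⟩, le_sup_left, le_sup_right⟩
  -- The vector `x` distinguishes `p` from `q`. This is needed because orthogonality says nothing
  -- about jointness when the two points coincide.
  have hnjoint : ∀ {p q x : V} (hp : G ⊔ K ∙ p ∈ TR ξ j) (hq : G ⊔ K ∙ q ∈ TR ξ j), p ≠ 0 →
      (∀ g ∈ G, ξ g p = 0) → (∀ g ∈ G, ξ g x = 0) → ξ p q = 0 →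
      ξ x p = 0 → ξ x q ≠ 0 → ¬ Joint ξ j ⟨_, hp⟩ ⟨_, hq⟩ := by
    intro p q x hp hq hp0 hpG hxG hpq hxp hxq hJ
    have hne : (⟨_, hp⟩ : TR ξ j) ≠ ⟨_, hq⟩ := by
      intro h
      have h' : G ⊔ K ∙ p = G ⊔ K ∙ q := congrArg Subtype.val h
      have h1 : q ∈ G ⊔ K ∙ p := h' ▸ mem_sup_span_self G q
      obtain ⟨g, hg, t, rfl⟩ := mem_sup_span.1 h1
      apply hxq
      simp [hξ.comm.1 (hxG g hg), hxp]
    have h1 := hJ.sup_mem hne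
    refine hp0 (eq_zero_of_rad ((hξ.mem_TR_even ho.add_one).1 h1).2
      (Submodule.mem_sup_left (mem_sup_span_self G p)) fun y hy => ?_)
    obtain ⟨y₁, hy₁, y₂, hy₂, rfl⟩ := Submodule.mem_sup.1 hy
    obtain ⟨g, hg, t, rfl⟩ := mem_sup_span.1 hy₁
    obtain ⟨g', hg', t', rfl⟩ := mem_sup_span.1 hy₂
    simp [hpG g hg, hpG g' hg', hξ.self, hξ.comm.1 hpq]
  have hT₁ := hξ.sup_span_mem_TR hj he hG hp₁0 hp₁G
  have hT₂ := hξ.sup_span_mem_TR hj he hG hp₂0 hp₂G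
  have hT₃ := hξ.sup_span_mem_TR hj he hG hp₃0 hp₃G
  refine ⟨⟨_, hT₁⟩, ⟨_, hT₂⟩, ⟨_, hT₃⟩, ⟨⟨?_, ?_, ?_⟩, ⟨?_, ?_, ?_⟩, ⟨?_, ?_, ?_⟩⟩,
    ⟨?_, ?_⟩, ?_, ?_⟩
  · intro h
    have h1 : p₁ ∈ U := h (mem_sup_span_self G p₁)
    refine heU' ?_
    have : e = p₁ - (a + b) := by rw [hp₁]; abel
    rw [this]
    exact U.sub_mem h1 (U.add_mem haU hbU)
  · exact hjoint hT₁ _ hp₁0 ha hp₁G haG (by rwa [e1a])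
  · exact hjoint hT₁ _ hp₁0 hb hp₁G hbG (by rwa [e1b])
  · intro h
    have h1 : p₂ ∈ U := h (mem_sup_span_self G p₂)
    refine heU' ?_
    have : (2 : K) • e = p₂ - (a + b) := by rw [hp₂]; abel
    rw [← Submodule.smul_mem_iff U h2, this]
    exact U.sub_mem h1 (U.add_mem haU hbU)
  · exact hjoint hT₂ _ hp₂0 ha hp₂G haG (by rwa [e2a])
  · exact hjoint hT₂ _ hp₂0 hb hp₂G hbG (by rwa [e2b])
  · intro h
    have h1 : p₃ ∈ U := h (mem_sup_span_self G p₃)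
    refine hfU' ?_
    have : c • f = p₃ - (a - b) := by rw [hp₃]; abel
    rw [← Submodule.smul_mem_iff U hc, this]
    exact U.sub_mem h1 (U.sub_mem haU hbU)
  · exact hjoint hT₃ _ hp₃0 ha hp₃G haG (by rwa [e3a])
  · exact hjoint hT₃ _ hp₃0 hb hp₃G hbG (by rwa [e3b])
  · intro h
    refine hnjoint (x := p₃) hT₂ hT₁ hp₂0 hp₂G hp₃G (hξ.comm.1 e12) (hξ.comm.1 e23)
      (fun h => ?_) ?_
    · have := hξ.comm.1 h
      rw [e13] at this
      exact hc' this
    · obtain ⟨W, h1, h2⟩ := h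
      exact ⟨W, h2, h1⟩
  · exact hnjoint (x := p₁) hT₂ hT₃ hp₂0 hp₂G hp₁G e23 e12 (by rwa [e13])
  · intro h
    have h' : G ⊔ K ∙ p₁ = G ⊔ K ∙ p₃ := congrArg Subtype.val h
    have h1 : p₃ ∈ G ⊔ K ∙ p₁ := h' ▸ mem_sup_span_self G p₃
    obtain ⟨g, hg, t, ht⟩ := mem_sup_span.1 h1
    apply hc'
    rw [← e13, ht]
    simp [hξ.comm.1 (hp₁G g hg), hξ.self]
  · exact hjoint hT₁ hT₃ hp₁0 hp₃0 hp₁G hp₃G (by rwa [e13])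

/-- If `H₁`, `H₂` are not adjacent, the radical `R` of their intersection `G` has dimension two, and
each `J` above `G` has one radical point in `R`. Non-joint `J`, `J'` share this point, so `J₁` and
`J₃` share it too; but then it lies in the radical of the regular space `J₁ ⊔ J₃`. -/
theorem adjT_of_nonTransitive (hj : 1 ≤ j) (ho : Odd j) {H₁ H₂ : TR ξ j} (hne : H₁ ≠ H₂)
    {U : TR ξ (j + 1)} (h₁ : H₁.1 ≤ U.1) (h₂ : H₂.1 ≤ U.1) (h : NonTransitive ξ j H₁ H₂ U) :
    adjT ξ j H₁ H₂ := by
  have hne' : H₁.1 ≠ H₂.1 := fun h => hne (Subtype.ext h)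
  have hU := sup_eq_of_le H₁.2.1 H₂.2.1 hne' h₁ h₂ U.2.1
  have hGd : finrank K ↥(H₁.1 ⊓ H₂.1) = j - 1 := by
    rw [finrank_inf_iff_sup H₁.2.1 H₂.2.1 hj, hU, U.2.1]
  by_contra hadj
  have hR : 2 ≤ finrank K (rad ξ (H₁.1 ⊓ H₂.1)) := by
    by_contra hc
    exact hadj ((adjacent_iff hj).2 ⟨hne', H₁.2, H₂.2, ⟨hGd, by omega⟩, hU ▸ U.2⟩)
  have habove : ∀ J : TR ξ j, ¬ J.1 ≤ U.1 → Joint ξ j J H₁ → Joint ξ j J H₂ →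
      H₁.1 ⊓ H₂.1 ≤ J.1 := by
    intro J hJU hJ1 hJ2
    refine (inf_le_or_le_sup J.2.1 hGd.le hJ1.le_finrank_inf hJ2.le_finrank_inf).resolve_right ?_
    rwa [hU]
  obtain ⟨J₁, J₂, J₃, ⟨⟨a1, a2, a3⟩, ⟨b1, b2, b3⟩, ⟨c1, c2, c3⟩⟩, ⟨h12, h23⟩, hne13, h13⟩ := h
  have hG₁ := habove J₁ a1 a2 a3
  have hG₂ := habove J₂ b1 b2 b3
  have hG₃ := habove J₃ c1 c2 c3
  generalize H₁.1 ⊓ H₂.1 = G at *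
  set R := rad ξ G with hRdef
  have hRG : R ≤ G := inf_le_left
  have hRG' : ∀ r ∈ R, ∀ g ∈ G, ξ g r = 0 := fun r hr => (mem_rad.1 hr).2
  -- One extra vector cuts `R` by at most one dimension, and what remains is in the radical of `J`,
  -- hence has dimension at most one. This also bounds `R`.
  have hl : ∀ J : TR ξ j, G ≤ J.1 →
      finrank K ↥(R ⊓ ξ.orthogonal J.1) = 1 ∧ finrank K R = 2 := by
    intro J hGJ
    obtain ⟨x, hx, hxG⟩ := exists_mem_notMem_of_finrank_lt (K := K) (U := J.1) (H := G)
      (by rw [J.2.1, hGd]; omega)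
    have hJ := eq_sup_span hGJ (by rw [J.2.1, hGd]; omega) hx hxG
    have h1 := hξ.finrank_inf_orth_span_le (U := R) x
    have h2 : R ⊓ ξ.orthogonal (K ∙ x) ≤ R ⊓ ξ.orthogonal J.1 := by
      rintro y ⟨hy1, hy2⟩
      refine ⟨hy1, mem_orthogonal.2 fun z hz => ?_⟩
      rw [hJ] at hz
      obtain ⟨g, hg, t, rfl⟩ := mem_sup_span.1 hz
      simp [hRG' y hy1 g hg, mem_orthogonal_span.1 hy2]
    have h3 := Submodule.finrank_mono (R := K) h2
    have h4 : R ⊓ ξ.orthogonal J.1 ≤ rad ξ J.1 := inf_le_inf_right _ (hRG.trans hGJ)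
    have h5 := Submodule.finrank_mono (R := K) h4
    have h6 := J.2.2
    omega
  have hin : ∀ J : TR ξ j, G ≤ J.1 → ∀ x ∈ J.1, (∀ r ∈ R, ξ x r = 0) → x ∈ G := by
    intro J hGJ x hx hxR
    by_contra hxG
    have hJ := eq_sup_span hGJ (by rw [J.2.1, hGd]; omega) hx hxG
    have h1 : R ≤ R ⊓ ξ.orthogonal J.1 := by
      refine le_inf le_rfl fun r hr => mem_orthogonal.2 fun y hy => ?_
      rw [hJ] at hy
      obtain ⟨g, hg, t, rfl⟩ := mem_sup_span.1 hy
      simp [hRG' r hr g hg, hxR r hr]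
    have h2 := Submodule.finrank_mono (R := K) h1
    obtain ⟨h3, h4⟩ := hl J hGJ
    omega
  -- If the two points of `R` differ, they span `R`. A radical vector of `J ⊔ J'` is orthogonal to
  -- `R`, so it lies in `G`, then in `R`, and finally in both points. So the sum is regular and `J`,
  -- `J'` are joint.
  have heq : ∀ J J' : TR ξ j, G ≤ J.1 → G ≤ J'.1 → ¬ Joint ξ j J J' →
      R ⊓ ξ.orthogonal J.1 = R ⊓ ξ.orthogonal J'.1 := by
    intro J J' hJ hJ' hJJ'
    by_contra hc
    obtain ⟨l1, l2⟩ := hl J hJ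
    obtain ⟨l1', -⟩ := hl J' hJ'
    have hJne : J.1 ≠ J'.1 := fun h => hc (by rw [h])
    have hdisj : R ⊓ ξ.orthogonal J.1 ⊓ (R ⊓ ξ.orthogonal J'.1) = ⊥ := by
      by_contra hb
      have h1 : 0 < finrank K ↥(R ⊓ ξ.orthogonal J.1 ⊓ (R ⊓ ξ.orthogonal J'.1)) :=
        Nat.pos_of_ne_zero fun h => hb (Submodule.finrank_eq_zero.1 h)
      have h2 := eq_of_le_of_finrank (inf_le_left :
        R ⊓ ξ.orthogonal J.1 ⊓ (R ⊓ ξ.orthogonal J'.1) ≤ _) (by omega)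
      have h3 := eq_of_le_of_finrank (inf_le_right :
        R ⊓ ξ.orthogonal J.1 ⊓ (R ⊓ ξ.orthogonal J'.1) ≤ _) (by omega)
      exact hc (h2.symm.trans h3)
    have hsup : R ⊓ ξ.orthogonal J.1 ⊔ R ⊓ ξ.orthogonal J'.1 = R := by
      refine eq_of_le_of_finrank (sup_le inf_le_left inf_le_left) ?_
      have := finrank_sup_add_inf (R ⊓ ξ.orthogonal J.1) (R ⊓ ξ.orthogonal J'.1)
      rw [hdisj, finrank_bot] at this
      omega
    refine hJJ' ⟨⟨J.1 ⊔ J'.1, (hξ.mem_TR_even ho.add_one).2 ⟨?_, ?_⟩⟩, le_sup_left, le_sup_right⟩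
    · rw [← finrank_inf_iff_sup J.2.1 J'.2.1 hj, inf_eq_of_le J.2.1 J'.2.1 hj hJne hJ hJ' hGd, hGd]
    · refine (Submodule.eq_bot_iff _).2 fun v hv => ?_
      obtain ⟨hv, hv'⟩ := mem_rad.1 hv
      have hvR : ∀ r ∈ R, ξ v r = 0 := fun r hr =>
        hξ.comm.1 (hv' r (Submodule.mem_sup_left (hJ (hRG hr))))
      obtain ⟨y, hy, y', hy', rfl⟩ := Submodule.mem_sup.1 hv
      have hyG : y ∈ G := by
        refine hin J hJ y hy fun r hr => ?_
        rw [← hsup] at hr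
        obtain ⟨r₁, hr₁, r₂, hr₂, rfl⟩ := Submodule.mem_sup.1 hr
        have e1 := mem_orthogonal.1 hr₁.2 y hy
        have e2 := mem_orthogonal.1 hr₂.2 y' hy'
        have e3 := hvR r₂ hr₂.1
        rw [map_add, LinearMap.add_apply, e2, add_zero] at e3
        rw [map_add, e1, e3, add_zero]
      have hy'G : y' ∈ G := by
        refine hin J' hJ' y' hy' fun r hr => ?_
        have e3 := hvR r hr
        rwa [map_add, LinearMap.add_apply, hRG' r hr y hyG, zero_add] at e3
      have hmem : y + y' ∈ R ⊓ ξ.orthogonal J.1 ⊓ (R ⊓ ξ.orthogonal J'.1) := by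
        have h1 : y + y' ∈ R := mem_rad.2 ⟨G.add_mem hyG hy'G, fun g hg =>
          hv' g (Submodule.mem_sup_left (hJ hg))⟩
        exact ⟨⟨h1, mem_orthogonal.2 fun z hz => hv' z (Submodule.mem_sup_left hz)⟩,
          ⟨h1, mem_orthogonal.2 fun z hz => hv' z (Submodule.mem_sup_right hz)⟩⟩
      rwa [hdisj, Submodule.mem_bot] at hmem
  have h13' : R ⊓ ξ.orthogonal J₁.1 = R ⊓ ξ.orthogonal J₃.1 :=
    (heq J₁ J₂ hG₁ hG₂ h12).trans (heq J₂ J₃ hG₂ hG₃ h23)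
  have hreg := ((hξ.mem_TR_even ho.add_one).1 (h13.sup_mem hne13)).2
  have hbot : R ⊓ ξ.orthogonal J₁.1 = ⊥ := by
    refine (Submodule.eq_bot_iff _).2 fun x hx => ?_
    have hx3 : x ∈ R ⊓ ξ.orthogonal J₃.1 := h13' ▸ hx
    refine eq_zero_of_rad hreg (Submodule.mem_sup_left (hG₁ (hRG hx.1))) fun y hy => ?_
    obtain ⟨y₁, hy₁, y₂, hy₂, rfl⟩ := Submodule.mem_sup.1 hy
    simp [mem_orthogonal.1 hx.2 y₁ hy₁, mem_orthogonal.1 hx3.2 y₂ hy₂]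
  have := (hl J₁ hG₁).1
  rw [hbot, finrank_bot] at this
  omega

theorem adjT_iff_odd (h2 : (2 : K) ≠ 0) (hj : 1 ≤ j) (ho : Odd j)
    (hjn : j + 2 ≤ finrank K V) (H₁ H₂ : TR ξ j) : adjT ξ j H₁ H₂ ↔
    H₁ ≠ H₂ ∧ ∃ U : TR ξ (j + 1), (H₁.1 ≤ U.1 ∧ H₂.1 ≤ U.1) ∧ NonTransitive ξ j H₁ H₂ U :=
  ⟨hξ.nonTransitive_of_adjT h2 hj ho hjn,
    fun ⟨h1, _, ⟨h3, h4⟩, h5⟩ => hξ.adjT_of_nonTransitive hj ho h1 h3 h4 h5⟩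

/-! ### Points -/

omit hξ [FiniteDimensional K V] in
theorem span_mem_TR {v : V} (hv : v ≠ 0) : K ∙ v ∈ TR ξ 1 := by
  refine ⟨finrank_span_singleton hv, ?_⟩
  rw [← finrank_span_singleton (K := K) hv]
  exact Submodule.finrank_mono inf_le_left

omit hξ in
theorem exists_span (p : TR ξ 1) : ∃ v, v ≠ 0 ∧ p.1 = K ∙ v := by
  obtain ⟨⟨v, hv⟩, hv0, hv'⟩ := finrank_eq_one_iff'.1 p.2.1
  refine ⟨v, fun h => hv0 (Subtype.ext h), le_antisymm (fun x hx => ?_)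
    ((Submodule.span_singleton_le_iff_mem _ _).2 hv)⟩
  obtain ⟨c, hc⟩ := hv' ⟨x, hx⟩
  exact Submodule.mem_span_singleton.2 ⟨c, congrArg Subtype.val hc⟩

/-- Since every subspace is its own double complement, inclusion is expressible by orthogonality to
points alone. -/
theorem le_iff_perp (p : Submodule K V) (A : Submodule K V) :
    (∀ s : TR ξ 1, Perp ξ s.1 A → Perp ξ s.1 p) ↔ p ≤ A := by
  constructor
  · intro h x hx
    by_contra hxA
    obtain ⟨f, hf, hf1⟩ := hξ.exists_sep hxA
    have hf0 : f ≠ 0 := fun h => by rw [h, map_zero] at hf1; exact zero_ne_one hf1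
    have h1 := h ⟨K ∙ f, span_mem_TR hf0⟩ (fun u hu w hw => by
      obtain ⟨c, rfl⟩ := Submodule.mem_span_singleton.1 hu
      simp [hξ.comm.1 (hf w hw)]) f (Submodule.mem_span_singleton_self f) x hx
    rw [hξ.comm, hf1] at h1
    exact one_ne_zero h1
  · exact fun h s hs u hu w hw => hs u hu w (h hw)

omit hξ [FiniteDimensional K V] in
theorem perp_sup {s A A' : Submodule K V} : Perp ξ s (A ⊔ A') ↔ Perp ξ s A ∧ Perp ξ s A' := by
  constructor
  · exact fun h => ⟨fun u hu w hw => h u hu w (Submodule.mem_sup_left hw),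
      fun u hu w hw => h u hu w (Submodule.mem_sup_right hw)⟩
  · rintro ⟨h1, h2⟩ u hu w hw
    obtain ⟨a, ha, b, hb, rfl⟩ := Submodule.mem_sup.1 hw
    rw [map_add, h1 u hu a ha, h2 u hu b hb, add_zero]

/-- Points form the star of the zero subspace, which is regular. -/
theorem adjT_one_iff (p q : TR ξ 1) : adjT ξ 1 p q ↔ ¬ Perp ξ p.1 q.1 := by
  obtain ⟨v, hv, hpv⟩ := exists_span p
  obtain ⟨w, hw, hqw⟩ := exists_span q
  have h0 : (⊥ : Submodule K V) ∈ TR ξ (1 - 1) := by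
    refine ⟨finrank_bot K V, ?_⟩
    rw [rad, bot_inf_eq, finrank_bot]
    omega
  have h1 := hξ.adjacent_sup_span_iff le_rfl (by simp) h0 hv hw (by simp) (by simp)
  rw [bot_sup_eq, bot_sup_eq] at h1
  rw [adjT, hpv, hqw, h1, not_iff_not]
  constructor
  · intro h x hx y hy
    obtain ⟨c, rfl⟩ := Submodule.mem_span_singleton.1 hx
    obtain ⟨d, rfl⟩ := Submodule.mem_span_singleton.1 hy
    simp [h]
  · exact fun h => h v (Submodule.mem_span_singleton_self v) w (Submodule.mem_span_singleton_self w)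

/-- Vectors outside the radical lie in a member of `TR` of dimension one less. -/
theorem exists_hyperplane (U : TR ξ (j + 1)) {v : V} (hv : v ∈ U.1)
    (hvr : Odd (j + 1) → v ∉ rad ξ U.1) : ∃ H : TR ξ j, v ∈ H.1 ∧ H.1 ≤ U.1 := by
  have hUd := U.2.1
  rcases Nat.even_or_odd (j + 1) with he | ho
  · have hr := ((hξ.mem_TR_even he).1 U.2).2
    -- Every hyperplane of a regular space is in `TR`, so only `v ∈ f^⊥` and `f ∉ U^⊥` matter; for
    -- `v ≠ 0` the choice `f = v` works.
    obtain ⟨f, hf, hf'⟩ : ∃ f, ξ f v = 0 ∧ ∃ x ∈ U.1, ξ f x ≠ 0 := by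
      by_cases hv0 : v = 0
      · obtain ⟨x, hx, hx0⟩ := exists_mem_notMem_of_finrank_lt (K := K) (U := U.1) (H := ⊥)
          (by rw [finrank_bot]; omega)
        obtain ⟨f, -, hf⟩ := hξ.exists_sep hx0
        exact ⟨f, by simp [hv0], x, hx, fun h => by rw [hξ.comm, hf] at h; exact one_ne_zero h⟩
      · refine ⟨v, hξ.self v, ?_⟩
        by_contra hc
        push Not at hc
        exact hv0 (eq_zero_of_rad hr hv fun u hu => hξ.comm.1 (hc u hu))
    have h1 := hξ.finrank_inf_orth_span hf'
    have h2 := hξ.rad_hyperplane_le (inf_le_left : U.1 ⊓ ξ.orthogonal (K ∙ f) ≤ U.1) h1.symm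
    rw [hr, finrank_bot] at h2
    exact ⟨⟨_, by omega, h2⟩, ⟨hv, mem_orthogonal_span.2 hf⟩, inf_le_left⟩
  · have hr : finrank K (rad ξ U.1) = 1 := by
      have h1 := hξ.even_finrank_add_rad U.1
      have h2 := U.2.2
      rw [Nat.even_iff] at h1
      rw [Nat.odd_iff] at ho
      omega
    have hvr' := hvr ho
    obtain ⟨⟨r, hr1⟩, hr0, hr2⟩ := finrank_eq_one_iff'.1 hr
    replace hr0 : r ≠ 0 := fun h => hr0 (Subtype.ext h)
    obtain ⟨hrU, hrU'⟩ := mem_rad.1 hr1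
    -- Hence some `f` is orthogonal to `v` but not to `r`. The hyperplane it cuts from `U` misses
    -- the radical and so is regular.
    have hrv : r ∉ K ∙ v := by
      intro h
      obtain ⟨c, rfl⟩ := Submodule.mem_span_singleton.1 h
      have hc : c ≠ 0 := fun h => hr0 (by rw [h, zero_smul])
      exact hvr' ((Submodule.smul_mem_iff _ hc).1 hr1)
    obtain ⟨f, hf, hrf⟩ := hξ.exists_sep hrv
    have hfr : ξ f r = -1 := by rw [hξ.neg, hrf]
    have h1 := hξ.finrank_inf_orth_span (U := U.1) (f := f) ⟨r, hrU, by simp [hfr]⟩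
    have hfv : ξ f v = 0 := hξ.comm.1 (hf v (Submodule.mem_span_singleton_self v))
    refine ⟨⟨U.1 ⊓ ξ.orthogonal (K ∙ f), by omega, ?_⟩, ⟨hv, mem_orthogonal_span.2 hfv⟩,
      inf_le_left⟩
    have hbot : rad ξ (U.1 ⊓ ξ.orthogonal (K ∙ f)) = ⊥ := by
      refine (Submodule.eq_bot_iff _).2 fun x hx => ?_
      obtain ⟨⟨hxU, hxf⟩, hx'⟩ := mem_rad.1 hx
      replace hxf : ξ f x = 0 := mem_orthogonal_span.1 hxf
      have hxr : x ∈ rad ξ U.1 := by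
        refine mem_rad.2 ⟨hxU, fun y hy => ?_⟩
        have := hx' (y + ξ f y • r) ⟨U.1.add_mem hy (U.1.smul_mem _ hrU),
          mem_orthogonal_span.2 (by simp [hfr])⟩
        simpa [hξ.comm.1 (hrU' x hxU)] using this
      obtain ⟨d, hd⟩ := hr2 ⟨x, hxr⟩
      have hd' : d • r = x := congrArg Subtype.val hd
      subst hd'
      have h0 : d = 0 := by simpa [hfr] using hxf
      rw [h0, zero_smul]
    rw [hbot, finrank_bot]
    omega

/-- The radical point of an odd-dimensional `U` lies in no regular hyperplane, so hyperplanes alone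
do not reach all points of `U`. It does lie on the line through `w` and `w + v` for any `w` in `U`
outside the radical, and the clause on `s` says that `p` is in the span of `q` and `q'`. -/
theorem point_le_iff (hj : 1 ≤ j) (p : TR ξ 1) (U : TR ξ (j + 1)) :
    p.1 ≤ U.1 ↔ ∃ q q' : TR ξ 1, ((∃ H : TR ξ j, q.1 ≤ H.1 ∧ H.1 ≤ U.1) ∧
      (∃ H : TR ξ j, q'.1 ≤ H.1 ∧ H.1 ≤ U.1)) ∧
      ∀ s : TR ξ 1, Perp ξ s.1 q.1 → Perp ξ s.1 q'.1 → Perp ξ s.1 p.1 := by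
  constructor
  · intro hp
    obtain ⟨v, hv0, hpv⟩ := exists_span p
    have hv : v ∈ U.1 := hp (hpv ▸ Submodule.mem_span_singleton_self v)
    by_cases hvr : v ∈ rad ξ U.1
    · obtain ⟨hv1, hv2⟩ := mem_rad.1 hvr
      have hUd := U.2.1
      obtain ⟨w, hw, hwr⟩ := exists_mem_notMem_of_finrank_lt (K := K) (U := U.1)
        (H := rad ξ U.1) (by have := U.2.2; omega)
      have hwr' : w + v ∉ rad ξ U.1 := fun h => hwr (by simpa using Submodule.sub_mem _ h hvr)
      obtain ⟨H, hH, hHU⟩ := hξ.exists_hyperplane U hw fun _ => hwr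
      obtain ⟨H', hH', hHU'⟩ := hξ.exists_hyperplane U (U.1.add_mem hw hv) fun _ => hwr'
      refine ⟨⟨K ∙ w, span_mem_TR fun h => hwr (h ▸ Submodule.zero_mem _)⟩,
        ⟨K ∙ (w + v), span_mem_TR fun h => hwr' (h ▸ Submodule.zero_mem _)⟩,
        ⟨⟨H, (Submodule.span_singleton_le_iff_mem _ _).2 hH, hHU⟩,
          ⟨H', (Submodule.span_singleton_le_iff_mem _ _).2 hH', hHU'⟩⟩, fun s h1 h2 x hx y hy => ?_⟩
      rw [hpv] at hy
      obtain ⟨c, rfl⟩ := Submodule.mem_span_singleton.1 hy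
      have e1 := h1 x hx w (Submodule.mem_span_singleton_self w)
      have e2 := h2 x hx (w + v) (Submodule.mem_span_singleton_self _)
      rw [map_add, e1, zero_add] at e2
      rw [map_smul, e2, smul_zero]
    · obtain ⟨H, hH, hHU⟩ := hξ.exists_hyperplane U hv fun _ => hvr
      have hpH : p.1 ≤ H.1 := by
        rw [hpv]
        exact (Submodule.span_singleton_le_iff_mem _ _).2 hH
      exact ⟨p, p, ⟨⟨H, hpH, hHU⟩, ⟨H, hpH, hHU⟩⟩, fun s h _ => h⟩
  · rintro ⟨q, q', ⟨⟨H, hq, hH⟩, ⟨H', hq', hH'⟩⟩, h⟩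
    refine ((hξ.le_iff_perp p.1 (q.1 ⊔ q'.1)).1 fun s hs => ?_).trans
      (sup_le (hq.trans hH) (hq'.trans hH'))
    exact h s (perp_sup.1 hs).1 (perp_sup.1 hs).2

end IsSymp

end Descent

/-! ### Definability of the clique relations -/

section CliqueDef

variable {I : Type*} {L : Language} {M : I → Type*} [∀ i, L.Structure (M i)]
variable {Γ T : I → Type*} [Coding L M Γ] [Coding L M T]
variable {A O : ∀ i, T i → T i → Prop}

theorem Diamond.def (hA : Def L M (fun i (p : T i × T i) => A i p.1 p.2)) :
    Def L M (fun i (p : T i × T i) => Diamond (A i) p.1 p.2) := by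
  unfold Diamond
  -- The definition is decomposed syntactically by the closure lemmas until only projections to the
  -- variables remain.
  repeat' first
    | exact DMap.id | apply DMap.fst | apply DMap.snd | apply Def.and | apply Def.not
    | apply Def.ex | apply Def.eq | apply Def.comp₂ hA

theorem EqOr.def (hO : Def L M (fun i (p : T i × T i) => O i p.1 p.2)) :
    Def L M (fun i (p : T i × T i) => EqOr (O i) p.1 p.2) := by
  unfold EqOr
  exact (Def.eq DMap.id.fst DMap.id.snd).or hO

theorem Nbr.def (hO : Def L M (fun i (p : T i × T i) => O i p.1 p.2)) :
    Def L M (fun i (p : (T i × T i) × T i) => Nbr (O i) p.1.1 p.1.2 p.2) := by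
  unfold Nbr
  repeat' first
    | exact DMap.id | apply DMap.fst | apply DMap.snd | apply Def.and
    | apply Def.comp₂ (EqOr.def hO)

theorem OnLine.def (hO : Def L M (fun i (p : T i × T i) => O i p.1 p.2)) :
    Def L M (fun i (p : (T i × T i) × T i) => OnLine (O i) p.1.1 p.1.2 p.2) := by
  unfold OnLine
  repeat' first
    | exact DMap.id | apply DMap.fst | apply DMap.snd | apply Def.comp₂ (EqOr.def hO)
    | apply Def.comp₃ (Nbr.def hO) | apply Def.and | apply Def.imp | apply Def.all

theorem OffLine.def (hO : Def L M (fun i (p : T i × T i) => O i p.1 p.2)) :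
    Def L M (fun i (p : (T i × T i) × T i) => OffLine (O i) p.1.1 p.1.2 p.2) := by
  unfold OffLine
  repeat' first
    | exact DMap.id | apply DMap.fst | apply DMap.snd | apply Def.comp₂ (EqOr.def hO)
    | apply Def.comp₃ (Nbr.def hO) | apply Def.and | apply Def.not | apply Def.ex

theorem InClique.def (hO : Def L M (fun i (p : T i × T i) => O i p.1 p.2)) :
    Def L M (fun i (p : ((T i × T i) × T i) × T i) =>
      InClique (O i) p.1.1.1 p.1.1.2 p.1.2 p.2) := by
  unfold InClique
  repeat' first
    | exact DMap.id | apply DMap.fst | apply DMap.snd | apply Def.comp₂ (EqOr.def hO)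
    | apply Def.comp₃ (Nbr.def hO) | apply Def.and

theorem Joined.def (hA : Def L M (fun i (p : T i × T i) => A i p.1 p.2))
    (hO : Def L M (fun i (p : T i × T i) => O i p.1 p.2)) {S : ∀ i, Γ i → T i → Prop}
    (hS : Def L M (fun i (p : Γ i × T i) => S i p.1 p.2)) :
    Def L M (fun i (p : Γ i × T i) => Joined (A i) (O i) (S i p.1) p.2) := by
  unfold Joined
  refine hS.or (Def.ex (Def.ex (Def.and (Def.and ?_ ?_) (Def.and ?_ ?_))))
  · exact Def.comp₂ hS DMap.id.fst.fst.fst DMap.id.fst.snd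
  · exact Def.comp₂ hS DMap.id.fst.fst.fst DMap.id.snd
  · exact Def.comp₂ hA DMap.id.fst.snd DMap.id.snd
  · exact Def.comp₃ (OnLine.def hO) DMap.id.fst.snd DMap.id.snd DMap.id.fst.fst.snd

/-- The number of joining steps is fixed outside the formula, so the recursion unrolls to a
first-order formula. -/
theorem Generated.def (hA : Def L M (fun i (p : T i × T i) => A i p.1 p.2))
    (hO : Def L M (fun i (p : T i × T i) => O i p.1 p.2)) (r N : ℕ) :
    Def L M (fun i (p : (Fin r → T i) × T i) => Generated (A i) (O i) p.1 N p.2) := by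
  induction N with
  | zero =>
    exact Def.ex_fin fun j => Def.eq DMap.id.snd (DMap.id.fst.eval j)
  | succ N ih => exact Joined.def (S := fun i (u : Fin r → T i) x => Generated (A i) (O i) u N x) hA hO ih

theorem SmallSpan.def (hA : Def L M (fun i (p : T i × T i) => A i p.1 p.2))
    (hO : Def L M (fun i (p : T i × T i) => O i p.1 p.2)) (r : ℕ) {C : ∀ i, Γ i → T i → Prop}
    (hC : Def L M (fun i (p : Γ i × T i) => C i p.1 p.2)) :
    Def L M (fun i (x : Γ i) => SmallSpan (A i) (O i) r (C i x)) := by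
  unfold SmallSpan
  refine Def.ex (Def.and (Def.all_fin fun j => ?_) (Def.all (Def.imp ?_ ?_)))
  · exact Def.comp₂ hC DMap.id.fst (DMap.id.snd.eval j)
  · exact Def.comp₂ hC DMap.id.fst.fst DMap.id.snd
  · exact Def.comp₂ (R := fun i (u : Fin r → T i) x => Generated (A i) (O i) u r x)
      (Generated.def hA hO r r) DMap.id.fst.snd DMap.id.snd

theorem SmallPerp.def (hA : Def L M (fun i (p : T i × T i) => A i p.1 p.2))
    (r : ℕ) {C : ∀ i, Γ i → T i → Prop}
    (hC : Def L M (fun i (p : Γ i × T i) => C i p.1 p.2)) :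
    Def L M (fun i (x : Γ i) => SmallPerp (A i) r (C i x)) := by
  unfold SmallPerp
  refine Def.ex (Def.and (Def.all_fin fun j => ?_) (Def.all (Def.imp ?_
    (Def.ex_fin fun j => ?_))))
  · exact Def.comp₂ hC DMap.id.fst (DMap.id.snd.eval j)
  · exact Def.comp₂ hC DMap.id.fst.fst DMap.id.snd
  · exact Def.comp₂ hA DMap.id.snd (DMap.id.fst.snd.eval j)

theorem Above.def (hO : Def L M (fun i (p : T i × T i) => O i p.1 p.2))
    {Small : ∀ i, (T i → Prop) → Prop}
    (hS : Def L M (fun i (p : (T i × T i) × T i) => Small i (InClique (O i) p.1.1 p.1.2 p.2))) :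
    Def L M (fun i (p : (T i × T i) × T i) => Above (O i) (Small i) p.1.1 p.1.2 p.2) := by
  unfold Above
  refine Def.ex (Def.and (Def.and ?_ (Def.not ?_)) ?_)
  · exact Def.comp₃ (OffLine.def hO) DMap.id.fst.fst.fst DMap.id.fst.fst.snd DMap.id.snd
  · exact Def.comp₃ (R := fun i U W X => Small i (InClique (O i) U W X)) hS
      DMap.id.fst.fst.fst DMap.id.fst.fst.snd DMap.id.snd
  · exact Def.comp (P := fun i (p : ((T i × T i) × T i) × T i) =>
      InClique (O i) p.1.1.1 p.1.1.2 p.1.2 p.2) (InClique.def hO)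
      ((DMap.id.fst.fst.pair DMap.id.snd).pair DMap.id.fst.snd)

end CliqueDef

/-! ### Representing subspaces by adjacent pairs and by pairs of points -/

section GeometryLemmas

variable {K V : Type*} [Field K] [AddCommGroup V] [Module K V] [FiniteDimensional K V]
variable {ξ : LinearMap.BilinForm K V} {H : Submodule K V} {k : ℕ}

/-- For even `k` any two distinct members of the star of `H` will do; for odd `k` they must come
from non-orthogonal vectors of `H^⊥`. -/
theorem IsSymp.exists_adjT_inf_eq (hξ : IsSymp ξ) (hk : 1 ≤ k) (hkn : k < finrank K V)
    (hH : H ∈ TR ξ (k - 1)) : ∃ U W : TR ξ k, adjT ξ k U W ∧ H = U.1 ⊓ W.1 := by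
  obtain ⟨U, hU, -⟩ := hξ.exists_above hk hH le_rfl (by rw [hH.1]; omega)
  rcases Nat.even_or_odd k with he | ho
  · obtain ⟨W, hW, hW'⟩ := hξ.exists_above hk hH hU (by rw [U.2.1]; omega)
    have hne : U.1 ≠ W.1 := fun h => hW' h.ge
    have h := inf_eq_of_le U.2.1 W.2.1 hk hne hU hW hH.1
    exact ⟨U, W, (hξ.adjacent_iff_even hk he U.2 W.2).2 (by rw [h, hH.1]), h.symm⟩
  · have he : Even (k - 1) := by rw [Nat.odd_iff] at ho; rw [Nat.even_iff]; omega
    have hr := ((hξ.mem_TR_even he).1 hH).2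
    obtain ⟨p, hp, hpH, -⟩ := hξ.exists_eq_sup_span hr hU (by rw [U.2.1, hH.1]; omega)
    obtain ⟨q, hqH, hpq⟩ := hξ.exists_sep fun h => hp (eq_zero_of_rad hr h hpH)
    have hq : q ≠ 0 := fun h => by rw [h, map_zero] at hpq; exact zero_ne_one hpq
    have hadj := (hξ.adjacent_sup_span_iff hk he hH hp hq hpH hqH).2 (by simp [hpq])
    exact ⟨⟨_, hξ.sup_span_mem_TR hk he hH hp hpH⟩, ⟨_, hξ.sup_span_mem_TR hk he hH hq hqH⟩, hadj,
      (hadj.inf_eq_of_le hk le_sup_left le_sup_left hH.1).symm⟩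

theorem finrank_sup_point_eq_one (p q : TR ξ 1) : finrank K ↥(p.1 ⊔ q.1) = 1 ↔ p = q := by
  constructor
  · intro h
    have h1 := eq_of_le_of_finrank (le_sup_left : p.1 ≤ p.1 ⊔ q.1) (by rw [h, p.2.1])
    have h2 := eq_of_le_of_finrank (le_sup_right : q.1 ≤ p.1 ⊔ q.1) (by rw [h, q.2.1])
    exact Subtype.ext (h1.trans h2.symm)
  · rintro rfl
    rw [sup_idem, p.2.1]

theorem finrank_sup_point (p q : TR ξ 1) :
    finrank K ↥(p.1 ⊔ q.1) = 1 ∨ finrank K ↥(p.1 ⊔ q.1) = 2 := by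
  have h1 := finrank_sup_add_inf p.1 q.1
  have h2 := Submodule.finrank_mono (R := K) (le_sup_left : p.1 ≤ p.1 ⊔ q.1)
  have h3 := p.2.1
  have h4 := q.2.1
  omega

theorem exists_eq_sup_points {X : Submodule K V} (hX : finrank K X = 1 ∨ finrank K X = 2) :
    ∃ p q : TR ξ 1, X = p.1 ⊔ q.1 := by
  have hX1 : 1 ≤ finrank K X := by omega
  obtain ⟨a, ha, ha0⟩ := exists_mem_notMem_of_finrank_lt (K := K) (U := X) (H := ⊥)
    (by rw [finrank_bot]; omega)
  replace ha0 : a ≠ 0 := by simpa using ha0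
  have haX : K ∙ a ≤ X := (Submodule.span_singleton_le_iff_mem _ _).2 ha
  have had := finrank_span_singleton (K := K) ha0
  rcases hX with h | h
  · refine ⟨⟨_, IsSymp.span_mem_TR ha0⟩, ⟨_, IsSymp.span_mem_TR ha0⟩, ?_⟩
    rw [sup_idem]
    exact (eq_of_le_of_finrank haX (by omega)).symm
  · obtain ⟨b, hb, hb0⟩ := exists_mem_notMem_of_finrank_lt (K := K) (U := X) (H := K ∙ a)
      (by omega)
    exact ⟨⟨_, IsSymp.span_mem_TR ha0⟩,
      ⟨K ∙ b, IsSymp.span_mem_TR fun h => hb0 (h ▸ Submodule.zero_mem _)⟩,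
      eq_sup_span haX (by omega) hb hb0⟩

theorem IsSymp.le_iff_perp_points (hξ : IsSymp ξ) {p U W : Submodule K V}
    (hW : W = ξ.orthogonal U) :
    p ≤ U ↔ ∀ q : TR ξ 1, q.1 ≤ W → Perp ξ p q.1 := by
  constructor
  · intro h q hq x hx y hy
    exact mem_orthogonal.1 (hW ▸ hq hy) x (h hx)
  · intro h
    rw [← hξ.orth_orth U, ← hW]
    refine fun x hx => mem_orthogonal.2 fun w hw => ?_
    by_cases hw0 : w = 0
    · simp [hw0]
    · exact hξ.comm.1 (h ⟨_, span_mem_TR hw0⟩ ((Submodule.span_singleton_le_iff_mem _ _).2 hw) x hx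
        w (Submodule.mem_span_singleton_self w))

end GeometryLemmas

/-! ### The interpretation -/

set_option linter.checkUnivs false in
/-- Symplectic spaces of dimension `2 * m` in characteristic other than two. -/
structure Ctx (m : ℕ) where
  K : Type u
  [field : Field K]
  V : Type v
  [addCommGroup : AddCommGroup V]
  [module : Module K V]
  [finite : FiniteDimensional K V]
  ξ : LinearMap.BilinForm K V
  two_ne : (2 : K) ≠ 0
  dim : finrank K V = 2 * m
  symp : IsSymp ξ

attribute [instance] Ctx.field Ctx.addCommGroup Ctx.module Ctx.finite

/-- The family of the sets `TR`. -/
def TRs (m k : ℕ) (c : Ctx.{u, v} m) : Type v := TR c.ξ k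

/-- The family of the symplectic projective spaces. -/
def SPs (m : ℕ) (c : Ctx.{u, v} m) : Type v := SympProj c.ξ

section Relations

variable {m j k l : ℕ}

/-- Adjacency. -/
def AdjR (c : Ctx.{u, v} m) (U W : TRs m k c) : Prop := adjT c.ξ k U W

/-- Inclusion. -/
def LeR (c : Ctx.{u, v} m) (H : TRs m j c) (U : TRs m k c) : Prop := H.1 ≤ U.1

/-- Orthogonality of points. -/
def PerpR (c : Ctx.{u, v} m) (p q : TRs m 1 c) : Prop := Perp c.ξ p.1 q.1

/-- Orthogonal complementation. -/
def OrthR (c : Ctx.{u, v} m) (U : TRs m k c) (W : TRs m l c) : Prop :=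
  W.1 = c.ξ.orthogonal U.1

/-- `U` and `W` are adjacent and `X` contains their intersection. -/
def CapLe (c : Ctx.{u, v} m) (U W X : TRs m k c) : Prop := AdjR c U W ∧ U.1 ⊓ W.1 ≤ X.1

/-- `H` is the intersection of an adjacent pair. -/
def CapEq (c : Ctx.{u, v} m) (p : TRs m k c × TRs m k c) (H : TRs m j c) : Prop :=
  AdjR c p.1 p.2 ∧ H.1 = p.1.1 ⊓ p.2.1

end Relations

/-! ### Interpreting lower dimensions, points and complements from adjacency -/

section Interpretation

variable {m : ℕ} {L : Language} {M : Ctx.{u, v} m → Type*} [∀ c, L.Structure (M c)]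

/-- The definability of adjacency. -/
def AdjDef (L : Language) (M : Ctx.{u, v} m → Type*) [∀ c, L.Structure (M c)] (k : ℕ)
    [Coding L M (TRs m k)] : Prop :=
  Def L M (fun c (p : TRs m k c × TRs m k c) => AdjR c p.1 p.2)

theorem weakT_def {k : ℕ} (hk : 1 ≤ k) (hkm : k < m) [Coding L M (TRs m k)] (hA : AdjDef L M k) :
    Def L M (fun c (p : TRs m k c × TRs m k c) => weakT c.ξ k p.1 p.2) := by
  rcases Nat.even_or_odd k with he | ho
  · exact hA.congr fun c p => c.symp.adjacent_iff_weakAdj_even hk he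
  · refine (hA.or (((Def.eq DMap.id.fst DMap.id.snd).not).and (Diamond.def hA))).congr
      fun c p => ?_
    have := c.dim
    exact (c.symp.weakT_iff_odd c.two_ne hk (by omega) ho (this ▸ even_two_mul m) p.1 p.2).symm

/-- The parity of `k` decides which smallness test separates tops from stars; both work with `k + 1`
elements because `2 * k < 2 * m`. -/
theorem capLe_def {k : ℕ} (hk : 2 ≤ k) (hkm : k < m) [Coding L M (TRs m k)]
    (hA : AdjDef L M k) :
    Def L M (fun c (p : (TRs m k c × TRs m k c) × TRs m k c) => CapLe c p.1.1 p.1.2 p.2) := by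
  have hO := weakT_def (by omega) hkm hA
  have hA' : Def L M (fun c (p : (TRs m k c × TRs m k c) × TRs m k c) =>
      AdjR c p.1.1 p.1.2) := Def.comp₂ hA DMap.id.fst.fst DMap.id.fst.snd
  rcases Nat.even_or_odd k with he | ho
  · have hS := SmallSpan.def (Γ := fun c => (TRs m k c × TRs m k c) × TRs m k c)
      (C := fun c (p : (TRs m k c × TRs m k c) × TRs m k c) =>
        InClique (weakT c.ξ k) p.1.1 p.1.2 p.2) hA hO (k + 1) (InClique.def hO)
    refine (hA'.and (Above.def (Small := fun c => SmallSpan (AdjR c) (weakT c.ξ k) (k + 1))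
      hO hS)).congr fun c p => and_congr_right fun hUW => ?_
    have := c.dim
    exact c.symp.above_iff hk (by omega)
      (fun H hH => c.symp.not_smallSpan_star hk (by omega) hH)
      (fun B hB => c.symp.smallSpan_top c.two_ne hk (by omega) he hB) hUW
  · have hS := SmallPerp.def (Γ := fun c => (TRs m k c × TRs m k c) × TRs m k c)
      (C := fun c (p : (TRs m k c × TRs m k c) × TRs m k c) =>
        InClique (weakT c.ξ k) p.1.1 p.1.2 p.2) hA (k + 1) (InClique.def hO)
    refine (hA'.and (Above.def (Small := fun c => SmallPerp (AdjR c) (k + 1)) hO hS)).congr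
      fun c p => and_congr_right fun hUW => ?_
    have := c.dim
    exact c.symp.above_iff hk (by omega)
      (fun H hH => c.symp.not_smallPerp_star (by omega) ho (by omega) hH)
      (fun B hB => c.symp.smallPerp_top (by omega) (by omega) ho (this ▸ even_two_mul m) hB) hUW

theorem exists_capEq {j : ℕ} (hjm : j + 1 < m) (c : Ctx.{u, v} m) (H : TRs m j c) :
    ∃ p : TRs m (j + 1) c × TRs m (j + 1) c, CapEq c p H := by
  have := c.dim
  obtain ⟨U, W, h⟩ := c.symp.exists_adjT_inf_eq (k := j + 1) (by omega) (by omega) H.2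
  exact ⟨(U, W), h⟩

theorem adjDef_of_leR {j : ℕ} (hj : 1 ≤ j) (hjm : j + 1 < m) [Coding L M (TRs m (j + 1))]
    [Coding L M (TRs m j)]
    (hinc : Def L M (fun c (p : TRs m j c × TRs m (j + 1) c) => LeR c p.1 p.2)) :
    AdjDef L M j := by
  have hJ : Def L M (fun c (p : TRs m j c × TRs m j c) => Joint c.ξ j p.1 p.2) := by
    refine Def.ex (X := fun c => TRs m j c × TRs m j c) (Y := TRs m (j + 1))
      (P := fun c (p : TRs m j c × TRs m j c) U => LeR c p.1 U ∧ LeR c p.2 U)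
      (Def.and ?_ ?_)
    · exact Def.comp₂ hinc DMap.id.fst.fst DMap.id.snd
    · exact Def.comp₂ hinc DMap.id.fst.snd DMap.id.snd
  rcases Nat.even_or_odd j with he | ho
  · exact ((Def.eq DMap.id.fst DMap.id.snd).not.and hJ).congr fun c p =>
      (c.symp.adjT_iff_joint_even hj he p.1 p.2).symm
  · refine Def.congr (Def.and (Def.not (Def.eq DMap.id.fst DMap.id.snd))
      (Def.ex (Y := TRs m (j + 1)) (P := fun c (p : TRs m j c × TRs m j c) U =>
        (LeR c p.1 U ∧ LeR c p.2 U) ∧ ∃ J₁ J₂ J₃ : TRs m j c,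
          ((¬ LeR c J₁ U ∧ Joint c.ξ j J₁ p.1 ∧ Joint c.ξ j J₁ p.2) ∧
          (¬ LeR c J₂ U ∧ Joint c.ξ j J₂ p.1 ∧ Joint c.ξ j J₂ p.2) ∧
          (¬ LeR c J₃ U ∧ Joint c.ξ j J₃ p.1 ∧ Joint c.ξ j J₃ p.2)) ∧
          (¬ Joint c.ξ j J₁ J₂ ∧ ¬ Joint c.ξ j J₂ J₃) ∧ J₁ ≠ J₃ ∧ Joint c.ξ j J₁ J₃)
      (Def.and (Def.and ?_ ?_) ?_))) fun c p => ?_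
    · exact Def.comp₂ hinc DMap.id.fst.fst DMap.id.snd
    · exact Def.comp₂ hinc DMap.id.fst.snd DMap.id.snd
    · repeat' first
        | exact DMap.id | apply DMap.fst | apply DMap.snd | apply Def.comp₂ hJ
        | apply Def.comp₂ hinc | apply Def.and | apply Def.not | apply Def.ex | apply Def.eq
    · have := c.dim
      exact (c.symp.adjT_iff_odd c.two_ne hj ho (by omega) p.1 p.2).symm

/-- Descending from `TR (j + 1)` to `TR j`. -/
theorem exists_coding_pred {j : ℕ} (hj : 1 ≤ j) (hjm : j + 1 < m) [Coding L M (TRs m (j + 1))]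
    (hA : AdjDef L M (j + 1)) : ∃ _ : Coding L M (TRs m j), AdjDef L M j ∧
      Def L M (fun c (p : TRs m j c × TRs m (j + 1) c) => LeR c p.1 p.2) := by
  have hR := capLe_def (by omega) hjm hA
  have hj1 : 1 ≤ j + 1 := by omega
  obtain ⟨cod, hr⟩ := Coding.exists_ofRel (L := L) (M := M)
    (X := fun c => TRs m (j + 1) c × TRs m (j + 1) c) (Y := TRs m j) CapEq
    (fun c p H H' h h' => Subtype.ext (h.2.trans h'.2.symm)) (exists_capEq hjm)
    (by
      -- Two adjacent pairs represent the same subspace iff the same `X` contain their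
      -- intersections. Testing with the members of one pair gives one inclusion, and the dimensions
      -- agree.
      refine Def.congr (Def.and (Def.and (Def.comp₂ hA DMap.id.fst.fst DMap.id.fst.snd)
        (Def.comp₂ hA DMap.id.snd.fst DMap.id.snd.snd))
        (Def.all (Y := TRs m (j + 1)) (P := fun c (p : (TRs m (j + 1) c × TRs m (j + 1) c) ×
          (TRs m (j + 1) c × TRs m (j + 1) c)) X => CapLe c p.1.1 p.1.2 X ↔ CapLe c p.2.1 p.2.2 X)
          (Def.iff (Def.comp₃ hR DMap.id.fst.fst.fst DMap.id.fst.fst.snd DMap.id.snd)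
            (Def.comp₃ hR DMap.id.fst.snd.fst DMap.id.fst.snd.snd DMap.id.snd))))
        fun c p => ⟨?_, ?_⟩
      · rintro ⟨⟨h1, h2⟩, h3⟩
        have hT := ((adjacent_iff hj1).1 h1).2.2.2.1
        have hT' := ((adjacent_iff hj1).1 h2).2.2.2.1
        refine ⟨⟨_, hT⟩, ⟨h1, rfl⟩, h2, ?_⟩
        have e1 := ((h3 p.2.1).2 ⟨h2, inf_le_left⟩).2
        have e2 := ((h3 p.2.2).2 ⟨h2, inf_le_right⟩).2
        exact eq_of_le_of_finrank (le_inf e1 e2) (by rw [hT.1, hT'.1])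
      · rintro ⟨H, ⟨h1, h2⟩, h3, h4⟩
        refine ⟨⟨h1, h3⟩, fun X => ?_⟩
        rw [CapLe, CapLe, ← h2, ← h4]
        exact ⟨fun h => ⟨h3, h.2⟩, fun h => ⟨h1, h.2⟩⟩)
  have hinc : Def L M (fun c (p : TRs m j c × TRs m (j + 1) c) => LeR c p.1 p.2) := by
    refine Def.congr (Def.ex (P := fun c (p : TRs m j c × TRs m (j + 1) c)
      (q : TRs m (j + 1) c × TRs m (j + 1) c) => CapEq c q p.1 ∧ CapLe c q.1 q.2 p.2)
      (Def.and ?_ ?_)) fun c p => ⟨?_, ?_⟩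
    · exact Def.comp₂ hr DMap.id.snd DMap.id.fst.fst
    · exact Def.comp₃ hR DMap.id.snd.fst DMap.id.snd.snd DMap.id.fst.snd
    · rintro ⟨q, ⟨-, h1⟩, -, h2⟩
      exact h1.trans_le h2
    · intro h
      obtain ⟨q, hq⟩ := exists_capEq hjm c p.1
      exact ⟨q, hq, hq.1, hq.2.symm.trans_le h⟩
  exact ⟨cod, adjDef_of_leR hj hjm hinc, hinc⟩

/-- The points are interpreted, with orthogonality and inclusion in elements of `TR k`. -/
def PointsDef (L : Language) (M : Ctx.{u, v} m → Type*) [∀ c, L.Structure (M c)] (k : ℕ)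
    [Coding L M (TRs m k)] : Prop :=
  ∃ _ : Coding L M (TRs m 1),
    Def L M (fun c (p : TRs m 1 c × TRs m 1 c) => PerpR c p.1 p.2) ∧
    Def L M (fun c (p : TRs m 1 c × TRs m k c) => LeR c p.1 p.2)

/-- The recursion descends to dimension one, and on the way back inclusion of points in `TR (j + 1)`
is obtained from inclusion in `TR j`. -/
theorem pointsDef_of_lt {k : ℕ} (hk : 1 ≤ k) (hkm : k < m) (cod : Coding L M (TRs m k))
    (hA : AdjDef L M k) : PointsDef L M k := by
  induction k, hk using Nat.le_induction with
  | base =>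
    refine ⟨cod, hA.not.congr fun c p => ?_,
      (Def.eq DMap.id.fst DMap.id.snd).congr fun c p => ?_⟩
    · exact (not_congr (c.symp.adjT_one_iff p.1 p.2)).trans not_not
    · refine ⟨fun h => h ▸ le_refl p.1.1, fun h => Subtype.ext (eq_of_le_of_finrank h ?_)⟩
      rw [p.1.2.1, p.2.2.1]
  | succ j hj ih =>
    obtain ⟨cod', hA', hinc⟩ := exists_coding_pred hj hkm hA
    obtain ⟨cod₁, hperp, hle⟩ := ih (by omega) cod' hA'
    refine ⟨cod₁, hperp, ?_⟩
    have h : Def L M (fun c (p : TRs m 1 c × TRs m (j + 1) c) => ∃ q q' : TRs m 1 c,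
        ((∃ H : TRs m j c, LeR c q H ∧ LeR c H p.2) ∧
        (∃ H : TRs m j c, LeR c q' H ∧ LeR c H p.2)) ∧
        ∀ s : TRs m 1 c, PerpR c s q → PerpR c s q' → PerpR c s p.1) := by
      repeat' first
        | exact DMap.id | apply DMap.fst | apply DMap.snd | apply Def.comp₂ hperp
        | apply Def.comp₂ hinc | apply Def.comp₂ hle | apply Def.and | apply Def.imp
        | apply Def.ex | apply Def.all
    exact h.congr fun c p => (c.symp.point_le_iff hj p.1 p.2).symm

/-- For `k > m` each `U` is reread as representing its complement in dimension `2 * m - k < m`. A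
point lies in `U` iff it is orthogonal to all points of that complement. -/
theorem pointsDef {k : ℕ} (hk : 1 ≤ k) (hkm : k ≤ 2 * m - 1) (hne : k ≠ 2 * m - k)
    [Coding L M (TRs m k)] (hA : AdjDef L M k) : PointsDef L M k := by
  by_cases hlt : k < m
  · exact pointsDef_of_lt hk hlt inferInstance hA
  have hTR : ∀ (c : Ctx.{u, v} m) (U : TRs m k c), c.ξ.orthogonal U.1 ∈ TR c.ξ (2 * m - k) :=
    fun c U => by
      have h1 := c.symp.orth_mem_TR U.2
      rwa [c.dim] at h1
  have hTR' : ∀ (c : Ctx.{u, v} m) (W : TRs m (2 * m - k) c), c.ξ.orthogonal W.1 ∈ TR c.ξ k :=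
    fun c W => by
      have h1 := c.symp.orth_mem_TR W.2
      have h2 : 2 * m - (2 * m - k) = k := by omega
      rwa [c.dim, h2] at h1
  obtain ⟨cod, hr⟩ := Coding.exists_ofRel (L := L) (M := M) (X := TRs m k)
    (Y := TRs m (2 * m - k)) OrthR (fun c U W W' h h' => Subtype.ext (h.trans h'.symm))
    (fun c W => ⟨⟨_, hTR' c W⟩, (c.symp.orth_orth W.1).symm⟩)
    ((Def.eq DMap.id.fst DMap.id.snd).congr fun c p => by
      constructor
      · intro h
        exact ⟨⟨_, hTR c p.1⟩, rfl, h ▸ rfl⟩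
      · rintro ⟨W, h1, h2⟩
        exact Subtype.ext (c.symp.orth_inj.1 (h1.symm.trans h2)))
  have hA' : AdjDef L M (2 * m - k) := by
    have h : Def L M (fun c (p : TRs m (2 * m - k) c × TRs m (2 * m - k) c) =>
        ∃ U W : TRs m k c, (OrthR c U p.1 ∧ OrthR c W p.2) ∧ AdjR c U W) := by
      repeat' first
        | exact DMap.id | apply DMap.fst | apply DMap.snd | apply Def.comp₂ hr
        | apply Def.comp₂ hA | apply Def.and | apply Def.ex
    refine h.congr fun c p => ?_
    have hd := c.dim
    have key : ∀ U W : Submodule c.K c.V,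
        Adjacent c.ξ (2 * m - k) (c.ξ.orthogonal U) (c.ξ.orthogonal W) ↔
        Adjacent c.ξ k U W := fun U W => by
      rw [← c.symp.adjacent_orth hk (by omega), hd]
    constructor
    · rintro ⟨U, W, ⟨h1, h2⟩, h3⟩
      change Adjacent c.ξ (2 * m - k) p.1.1 p.2.1
      rw [h1, h2, key]
      exact h3
    · intro h
      refine ⟨⟨_, hTR' c p.1⟩, ⟨_, hTR' c p.2⟩,
        ⟨(c.symp.orth_orth _).symm, (c.symp.orth_orth _).symm⟩, ?_⟩
      change Adjacent c.ξ k _ _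
      rw [← key, c.symp.orth_orth, c.symp.orth_orth]
      exact h
  obtain ⟨cod₁, hperp, hle⟩ := pointsDef_of_lt (by omega) (by omega) cod hA'
  refine ⟨cod₁, hperp, ?_⟩
  have h : Def L M (fun c (p : TRs m 1 c × TRs m k c) => ∃ W : TRs m (2 * m - k) c,
      OrthR c p.2 W ∧ ∀ q : TRs m 1 c, LeR c q W → PerpR c p.1 q) := by
    repeat' first
      | exact DMap.id | apply DMap.fst | apply DMap.snd | apply Def.comp₂ hr
      | apply Def.comp₂ hle | apply Def.comp₂ hperp | apply Def.and | apply Def.imp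
      | apply Def.ex | apply Def.all
  refine h.congr fun c p => ⟨?_, fun h => ?_⟩
  · rintro ⟨W, h1, h2⟩
    exact (c.symp.le_iff_perp_points h1).2 h2
  · exact ⟨⟨_, hTR c p.2⟩, rfl, (c.symp.le_iff_perp_points rfl).1 h⟩

end Interpretation

/-! ### Definition schemes from interpretations -/

section Schemes

variable {I : Type*} {L L' : Language} [L'.IsRelational] {M N : I → Type*}
  [∀ i, L.Structure (M i)] [∀ i, L'.Structure (N i)]

theorem Def.rel₁ (R : L.Relations 1) :
    letI : Coding L M M := Coding.self
    Def L M (fun i (x : M i) => Language.Structure.RelMap R ![x]) := by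
  refine ⟨R.formula₁ (.var ()), fun i v => ?_⟩
  rw [Language.Formula.realize_rel₁]
  refine ⟨fun h => ⟨v (), rfl, h⟩, ?_⟩
  rintro ⟨x, rfl, h⟩
  exact h

theorem Def.rel₂ (R : L.Relations 2) :
    letI : Coding L M M := Coding.self
    Def L M (fun i (p : M i × M i) => Language.Structure.RelMap R ![p.1, p.2]) := by
  refine ⟨R.formula₂ (.var (.inl ())) (.var (.inr ())), fun i v => ?_⟩
  rw [Language.Formula.realize_rel₂]
  refine ⟨fun h => ⟨(v (.inl ()), v (.inr ())), ⟨rfl, rfl⟩, h⟩, ?_⟩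
  rintro ⟨⟨x, y⟩, ⟨rfl, rfl⟩, h⟩
  exact h

/-- The index type of a coding is finite, so enumerating it turns the uniform formulas into a scheme
on tuples of fixed length. -/
theorem exists_scheme [cod : Coding L M N]
    (hrel : ∀ (r : ℕ) (R : L'.Relations r),
      Def L M (fun i (f : Fin r → N i) => Language.Structure.RelMap R f))
    (E : ∀ i, N i → M i → Prop)
    (hE : letI : Coding L M M := Coding.self
      Def L M (fun i (p : N i × M i) => E i p.1 p.2)) :
    ∃ D : Scheme L L', ∀ i, D.Defines (M i) (N i) (E i) := by
  obtain ⟨d, ⟨e⟩⟩ := Finite.exists_equiv_fin cod.Idx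
  obtain ⟨dom, hdom⟩ := cod.dom_def
  obtain ⟨eqv, heqv⟩ := cod.eq_def
  choose rel hrel using hrel
  obtain ⟨link, hlink⟩ := hE
  refine ⟨⟨d, dom.relabel e, eqv.relabel (Sum.map e e),
    fun {r} R => (rel r R).relabel (Prod.map id e), link.relabel (Sum.map e id)⟩, fun i => ?_⟩
  have hd : ∀ t : {t : Fin d → M i // (dom.relabel e).Realize t}, ∃ x, cod.rep i (t.1 ∘ e) x :=
    fun t => (hdom i _).1 (Language.Formula.realize_relabel.1 t.2)
  choose code hcode using hd
  refine ⟨code, fun x => ?_, fun s t => ?_, fun r R t => ?_, fun t x => ?_⟩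
  · obtain ⟨t, ht⟩ := cod.rep_surj x
    have ht' : (t ∘ e.symm) ∘ e = t := by
      funext a
      simp
    refine ⟨⟨t ∘ e.symm, Language.Formula.realize_relabel.2 ((hdom i _).2 ⟨x, ?_⟩)⟩, ?_⟩
    · rwa [ht']
    · refine cod.rep_unique (hcode _) ?_
      rwa [ht']
  · rw [Language.Formula.realize_relabel, heqv]
    constructor
    · rintro ⟨x, h1, h2⟩
      exact (cod.rep_unique (hcode s) h1).trans (cod.rep_unique (hcode t) h2).symm
    · exact fun h => ⟨code s, hcode s, h ▸ hcode t⟩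
  · rw [Language.Formula.realize_relabel, hrel]
    constructor
    · rintro ⟨f, hf, h⟩
      have : f = fun j => code (t j) := funext fun j => cod.rep_unique (hf j) (hcode (t j))
      rwa [this] at h
    · exact fun h => ⟨fun j => code (t j), fun j => hcode (t j), h⟩
  · rw [Language.Formula.realize_relabel, hlink]
    constructor
    · rintro ⟨⟨y, z⟩, ⟨h1, rfl⟩, h3⟩
      obtain rfl := cod.rep_unique (hcode t) h1
      exact h3
    · exact fun h => ⟨(code t, x), ⟨hcode t, rfl⟩, h⟩

end Schemes

/-! ### The symplectic projective space from orthogonality of points -/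

section Projective

variable {m : ℕ} {L : Language} {M : Ctx.{u, v} m → Type*} [∀ c, L.Structure (M c)]

instance (c : Ctx.{u, v} m) : metricLang.Structure (SPs m c) :=
  inferInstanceAs (metricLang.Structure (SympProj c.ξ))

/-- `X` is spanned by the points `p` and `q`. -/
def SpanR (c : Ctx.{u, v} m) (p : TRs m 1 c × TRs m 1 c) (X : SPs m c) : Prop :=
  X.1 = p.1.1 ⊔ p.2.1

theorem exists_spanR (c : Ctx.{u, v} m) (X : SPs m c) : ∃ p, SpanR c p X := by
  obtain ⟨p, q, h⟩ := exists_eq_sup_points (ξ := c.ξ) X.2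
  exact ⟨(p, q), h⟩

/-- The span of the two points of `p` is contained in the span of those of `q`. -/
def SpanLe (c : Ctx.{u, v} m) (p q : TRs m 1 c × TRs m 1 c) : Prop :=
  ∀ s : TRs m 1 c, PerpR c s q.1 ∧ PerpR c s q.2 → PerpR c s p.1 ∧ PerpR c s p.2

theorem spanLe_iff (c : Ctx.{u, v} m) (p q : TRs m 1 c × TRs m 1 c) :
    SpanLe c p q ↔ p.1.1 ⊔ p.2.1 ≤ q.1.1 ⊔ q.2.1 := by
  rw [← c.symp.le_iff_perp]
  refine forall_congr' fun s => ?_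
  rw [IsSymp.perp_sup, IsSymp.perp_sup]
  rfl

/-- Pairs of points represent their span, with equal pairs giving points. Equality and inclusion of
spans are expressed by orthogonality through `SpanLe`, and orthogonality of spans is checked on
generators. -/
theorem exists_coding_sympProj {k : ℕ} [Coding L M (TRs m k)] (h : PointsDef L M k) :
    ∃ _ : Coding L M (SPs m),
      (∀ (r : ℕ) (R : metricLang.Relations r),
        Def L M (fun c (f : Fin r → SPs m c) => Language.Structure.RelMap R f)) ∧
      Def L M (fun c (p : SPs m c × TRs m k c) => p.1.1 ≤ p.2.1) := by
  obtain ⟨cod₁, hperp, hle⟩ := h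
  have hsl : Def L M (fun c (p : (TRs m 1 c × TRs m 1 c) × (TRs m 1 c × TRs m 1 c)) =>
      SpanLe c p.1 p.2) := by
    unfold SpanLe
    repeat' first
      | exact DMap.id | apply DMap.fst | apply DMap.snd | apply Def.comp₂ hperp
      | apply Def.and | apply Def.imp | apply Def.all
  obtain ⟨cod, hr⟩ := Coding.exists_ofRel (L := L) (M := M)
    (X := fun c => TRs m 1 c × TRs m 1 c) (Y := SPs m) SpanR
    (fun c p X Y h h' => Subtype.ext (h.trans h'.symm)) exists_spanR
    ((hsl.and (Def.comp₂ hsl DMap.id.snd DMap.id.fst)).congr fun c p => by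
      rw [spanLe_iff, spanLe_iff]
      constructor
      · intro h
        exact ⟨⟨p.1.1.1 ⊔ p.1.2.1, finrank_sup_point (ξ := c.ξ) p.1.1 p.1.2⟩, rfl,
          le_antisymm h.1 h.2⟩
      · rintro ⟨X, h1, h2⟩
        exact ⟨(h1.symm.trans h2).le, (h1.symm.trans h2).ge⟩)
  have hpoint : Def L M (fun c (X : SPs m c) => finrank c.K X.1 = 1) := by
    have h : Def L M (fun c (X : SPs m c) => ∃ p, SpanR c p X ∧ p.1 = p.2) := by
      repeat' first
        | exact DMap.id | apply DMap.fst | apply DMap.snd | apply Def.comp₂ hr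
        | apply Def.and | apply Def.ex | apply Def.eq
    refine h.congr fun c X => ⟨?_, fun h => ?_⟩
    · rintro ⟨p, h1, h2⟩
      rw [h1]
      exact (finrank_sup_point_eq_one (ξ := c.ξ) p.1 p.2).2 h2
    · obtain ⟨p, hp⟩ := exists_spanR c X
      rw [hp] at h
      exact ⟨p, hp, (finrank_sup_point_eq_one (ξ := c.ξ) p.1 p.2).1 h⟩
  have hline : Def L M (fun c (X : SPs m c) => finrank c.K X.1 = 2) := by
    refine hpoint.not.congr fun c X => ?_
    have := X.2
    omega
  have hXY : Def L M (fun c (p : SPs m c × SPs m c) => p.1.1 ≤ p.2.1) := by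
    have h : Def L M (fun c (X : SPs m c × SPs m c) => ∃ p q,
        (SpanR c p X.1 ∧ SpanR c q X.2) ∧ SpanLe c p q) := by
      repeat' first
        | exact DMap.id | apply DMap.fst | apply DMap.snd | apply Def.comp₂ hr
        | apply Def.comp₂ hsl | apply Def.and | apply Def.ex
    refine h.congr fun c X => ⟨?_, fun h => ?_⟩
    · rintro ⟨p, q, ⟨h1, h2⟩, h3⟩
      rw [h1, h2]
      exact (spanLe_iff c p q).1 h3
    · obtain ⟨p, hp⟩ := exists_spanR c X.1
      obtain ⟨q, hq⟩ := exists_spanR c X.2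
      rw [hp, hq] at h
      exact ⟨p, q, ⟨hp, hq⟩, (spanLe_iff c p q).2 h⟩
  have hXperp : Def L M (fun c (p : SPs m c × SPs m c) => Perp c.ξ p.1.1 p.2.1) := by
    have h : Def L M (fun c (X : SPs m c × SPs m c) => ∃ p q,
        (SpanR c p X.1 ∧ SpanR c q X.2) ∧ (PerpR c p.1 q.1 ∧ PerpR c p.1 q.2) ∧
          PerpR c p.2 q.1 ∧ PerpR c p.2 q.2) := by
      repeat' first
        | exact DMap.id | apply DMap.fst | apply DMap.snd | apply Def.comp₂ hr
        | apply Def.comp₂ hperp | apply Def.and | apply Def.ex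
    have key : ∀ (c : Ctx.{u, v} m) (p q : TRs m 1 c × TRs m 1 c),
        Perp c.ξ (p.1.1 ⊔ p.2.1) (q.1.1 ⊔ q.2.1) ↔ (PerpR c p.1 q.1 ∧ PerpR c p.1 q.2) ∧
          PerpR c p.2 q.1 ∧ PerpR c p.2 q.2 := by
      intro c p q
      rw [c.symp.perp_comm, IsSymp.perp_sup, c.symp.perp_comm, IsSymp.perp_sup,
        c.symp.perp_comm (W := p.2.1), IsSymp.perp_sup]
      rfl
    refine h.congr fun c X => ⟨?_, fun h => ?_⟩
    · rintro ⟨p, q, ⟨h1, h2⟩, h3⟩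
      rw [h1, h2]
      exact (key c p q).2 h3
    · obtain ⟨p, hp⟩ := exists_spanR c X.1
      obtain ⟨q, hq⟩ := exists_spanR c X.2
      rw [hp, hq] at h
      exact ⟨p, q, ⟨hp, hq⟩, (key c p q).1 h⟩
  refine ⟨cod, ?_, ?_⟩
  · intro r R
    match r, R with
    | _, .point => exact hpoint.comp (DMap.id.eval 0)
    | _, .line => exact hline.comp (DMap.id.eval 0)
    | _, .inc => exact (hpoint.comp (DMap.id.eval 0)).and ((hline.comp (DMap.id.eval 1)).and
        (hXY.comp ((DMap.id.eval 0).pair (DMap.id.eval 1))))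
    | _, .perp => exact hXperp.comp ((DMap.id.eval 0).pair (DMap.id.eval 1))
  · have h : Def L M (fun c (X : SPs m c × TRs m k c) => ∃ p,
        SpanR c p X.1 ∧ LeR c p.1 X.2 ∧ LeR c p.2 X.2) := by
      repeat' first
        | exact DMap.id | apply DMap.fst | apply DMap.snd | apply Def.comp₂ hr
        | apply Def.comp₂ hle | apply Def.and | apply Def.ex
    refine h.congr fun c X => ⟨?_, fun h => ?_⟩
    · rintro ⟨p, h1, h2, h3⟩
      rw [h1]
      exact sup_le h2 h3
    · obtain ⟨p, hp⟩ := exists_spanR c X.1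
      rw [hp] at h
      exact ⟨p, hp, le_sup_left.trans h, le_sup_right.trans h⟩

/-- A definition scheme from an interpretation of `TR k` with definable adjacency, where the
elements of `TR k` are represented by single elements. -/
theorem exists_scheme_of_adjDef {k : ℕ} (hk1 : 1 ≤ k) (hk2 : k ≤ 2 * m - 1)
    (hkm : k ≠ 2 * m - k) (r : ∀ c, M c → TRs m k c → Prop)
    (hu : ∀ c x U W, r c x U → r c x W → U = W) (hs : ∀ c U, ∃ x, r c x U)
    (hk : letI : Coding L M M := Coding.self
      Def L M (fun c (p : M c × M c) => ∃ U, r c p.1 U ∧ r c p.2 U))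
    (hA : letI : Coding L M M := Coding.self
      Def L M (fun c (p : M c × M c) => ∃ U W, (r c p.1 U ∧ r c p.2 W) ∧ AdjR c U W)) :
    ∃ D : Scheme L metricLang, ∀ c : Ctx.{u, v} m, D.Defines (M c) (SPs m c)
      (fun X x => ∃ U, r c x U ∧ X.1 ≤ U.1) := by
  let _ : Coding L M M := Coding.self
  obtain ⟨cod, hr⟩ := Coding.exists_ofRel (L := L) (M := M) (X := M) (Y := TRs m k) r hu hs hk
  have hadj : AdjDef L M k := by
    have h : Def L M (fun c (p : TRs m k c × TRs m k c) => ∃ x y, (r c x p.1 ∧ r c y p.2) ∧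
        ∃ U W, (r c x U ∧ r c y W) ∧ AdjR c U W) := by
      refine Def.ex (Y := M) (Def.ex (Y := M) (Def.and (Def.and ?_ ?_) ?_))
      · exact Def.comp₂ hr DMap.id.fst.snd DMap.id.fst.fst.fst
      · exact Def.comp₂ hr DMap.id.snd DMap.id.fst.fst.snd
      · exact Def.comp₂ (R := fun c x y => ∃ U W, (r c x U ∧ r c y W) ∧ AdjR c U W) hA
          DMap.id.fst.snd DMap.id.snd
    refine h.congr fun c p => ⟨?_, fun h => ?_⟩
    · rintro ⟨x, y, ⟨h1, h2⟩, U, W, ⟨h3, h4⟩, h5⟩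
      rwa [hu c x _ _ h1 h3, hu c y _ _ h2 h4]
    · obtain ⟨x, hx⟩ := hs c p.1
      obtain ⟨y, hy⟩ := hs c p.2
      exact ⟨x, y, ⟨hx, hy⟩, p.1, p.2, ⟨hx, hy⟩, h⟩
  obtain ⟨cod', hrel, hle⟩ := exists_coding_sympProj (pointsDef hk1 hk2 hkm hadj)
  refine exists_scheme hrel _ ?_
  refine Def.ex (X := fun c => SPs m c × M c) (Y := TRs m k) (Def.and ?_ ?_)
  · exact Def.comp₂ hr DMap.id.fst.snd DMap.id.snd
  · exact hle.comp (DMap.id.fst.fst.pair DMap.id.snd)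

end Projective

/-- The context of a symplectic space. -/
@[reducible] def Ctx.of {m : ℕ} (K : Type u) [Field K] (V : Type v) [AddCommGroup V] [Module K V]
    [FiniteDimensional K V] (ξ : LinearMap.BilinForm K V) (h2 : ringChar K ≠ 2)
    (hd : finrank K V = 2 * m) (ha : ξ.IsAlt) (hn : ξ.Nondegenerate) : Ctx.{u, v} m :=
  ⟨K, V, ξ, Ring.two_ne_zero h2, hd, ha, hn⟩

theorem exists_scheme_adjTR {m k : ℕ} (hk1 : 1 ≤ k) (hk2 : k ≤ 2 * m - 1)
    (hkm : k ≠ 2 * m - k) : ∃ D : Scheme Language.graph metricLang, ∀ c : Ctx.{u, v} m,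
      D.Defines (AdjTR c.ξ k) (SympProj c.ξ) (inAdjTR c.ξ k) := by
  let _ : Coding Language.graph (fun c : Ctx.{u, v} m => AdjTR c.ξ k) (fun c => AdjTR c.ξ k) :=
    Coding.self
  obtain ⟨D, hD⟩ := exists_scheme_of_adjDef (L := Language.graph)
    (M := fun c : Ctx.{u, v} m => AdjTR c.ξ k) hk1 hk2 hkm (fun c x U => x = U)
    (fun c x U W h h' => h.symm.trans h') (fun c U => ⟨U, rfl⟩)
    ((Def.eq DMap.id.fst DMap.id.snd).congr fun c p => ⟨fun h => ⟨p.1, rfl, h.symm⟩,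
      fun ⟨U, h1, h2⟩ => h1.trans h2.symm⟩)
    ((Def.rel₂ Language.adj).congr fun c p => ⟨fun h => ⟨p.1, p.2, ⟨rfl, rfl⟩, h⟩,
      fun ⟨U, W, ⟨h1, h2⟩, h⟩ => by subst h1 h2; exact h⟩)
  refine ⟨D, fun c => ?_⟩
  have hE : (fun (X : SPs m c) (x : AdjTR c.ξ k) => ∃ U : TRs m k c, x = U ∧ X.1 ≤ U.1) =
      inAdjTR c.ξ k := by
    funext X x
    exact propext ⟨fun ⟨U, h1, h2⟩ => h1 ▸ h2, fun h => ⟨x, rfl, h⟩⟩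
  exact hE ▸ hD c

/-! ### Adjacency inside the Grassmann space -/

section Grassmann

variable {m k : ℕ}

/-- The family of the Grassmann spaces. -/
def GRs (m k : ℕ) (c : Ctx.{u, v} m) : Type v := Grassmann c.ξ k

instance (c : Ctx.{u, v} m) : incLang.Structure (GRs m k c) :=
  inferInstanceAs (incLang.Structure (Grassmann c.ξ k))

/-- The element `x` of the Grassmann space is the point `U`. -/
def IsPt (c : Ctx.{u, v} m) (x : GRs m k c) (U : TRs m k c) : Prop := x = Sum.inl U

/-- Incidence in the Grassmann space. -/
def IncR (c : Ctx.{u, v} m) (x y : GRs m k c) : Prop :=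
  ∃ (U : TR c.ξ k) (g : pencils c.ξ k), x = Sum.inl U ∧ y = Sum.inr g ∧ U.1 ∈ g.1

theorem incR_adjR (c : Ctx.{u, v} m) (x y : GRs m k c) :
    (¬ x = y ∧ ∃ z, IncR c x z ∧ IncR c y z) ↔ ∃ U W, (IsPt c x U ∧ IsPt c y W) ∧ AdjR c U W := by
  constructor
  · rintro ⟨hne, z, ⟨U, g, hx, hz, hU⟩, W, g', hy, hz', hW⟩
    obtain rfl : g = g' := Sum.inr_injective (hz.symm.trans hz')
    refine ⟨U, W, ⟨hx, hy⟩, fun h => hne ?_, g.1, g.2, hU, hW⟩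
    exact hx.trans ((congrArg Sum.inl (Subtype.ext h)).trans hy.symm)
  · rintro ⟨U, W, ⟨h1, h2⟩, hne, g, hg, hU, hW⟩
    refine ⟨fun h => hne ?_, Sum.inr ⟨g, hg⟩, ⟨U, ⟨g, hg⟩, h1, rfl, hU⟩, W, ⟨g, hg⟩, h2, rfl, hW⟩
    exact congrArg Subtype.val (Sum.inl_injective (h1.symm.trans (h.trans h2)))

theorem exists_scheme_grassmann (hk1 : 1 ≤ k) (hk2 : k ≤ 2 * m - 1)
    (hkm : k ≠ 2 * m - k) : ∃ D : Scheme incLang metricLang, ∀ c : Ctx.{u, v} m,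
      D.Defines (Grassmann c.ξ k) (SympProj c.ξ) (inGrassmann c.ξ k) := by
  let _ : Coding incLang (GRs.{u, v} m k) (GRs m k) := Coding.self
  have hp : Def incLang (GRs.{u, v} m k) (fun c x => ∃ U, IsPt c x U) :=
    (Def.rel₁ (L := incLang) (M := GRs.{u, v} m k) IncRel.point).congr fun c x => Iff.rfl
  have hi : Def incLang (GRs.{u, v} m k)
      (fun c (p : GRs m k c × GRs m k c) => IncR c p.1 p.2) :=
    (Def.rel₂ (L := incLang) (M := GRs.{u, v} m k) IncRel.inc).congr fun c x => Iff.rfl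
  have ha : Def incLang (GRs.{u, v} m k) (fun c (p : GRs m k c × GRs m k c) =>
      ¬ p.1 = p.2 ∧ ∃ z, IncR c p.1 z ∧ IncR c p.2 z) :=
    (Def.eq DMap.id.fst DMap.id.snd).not.and (Def.ex
      ((Def.comp₂ hi DMap.id.fst.fst DMap.id.snd).and
        (Def.comp₂ hi DMap.id.fst.snd DMap.id.snd)))
  exact exists_scheme_of_adjDef (L := incLang) (M := GRs.{u, v} m k) hk1 hk2 hkm IsPt
    (fun c x U W h h' => Sum.inl_injective (h.symm.trans h')) (fun c U => ⟨Sum.inl U, rfl⟩)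
    -- Pencils are elements of the structure too, so representatives have to be restricted to
    -- points.
    (((hp.comp DMap.id.fst).and (Def.eq DMap.id.fst DMap.id.snd)).congr fun c p =>
      ⟨fun ⟨⟨U, h1⟩, h2⟩ => ⟨U, h1, h2.symm.trans h1⟩,
        fun ⟨U, h1, h2⟩ => ⟨⟨U, h1⟩, h1.trans h2.symm⟩⟩)
    (ha.congr fun c p => incR_adjR c p.1 p.2)

end Grassmann

theorem IsSymp.TR_eq_Reg {K V : Type*} [Field K] [AddCommGroup V] [Module K V]
    [FiniteDimensional K V] {ξ : LinearMap.BilinForm K V} (hξ : IsSymp ξ) {k : ℕ} (hk : Even k) :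
    TR ξ k = Reg ξ k :=
  Set.ext fun _ => hξ.mem_TR_even hk

theorem exists_scheme_adjReg {m k : ℕ} (hk1 : 1 ≤ k) (hk2 : k ≤ 2 * m - 1)
    (hkm : k ≠ 2 * m - k) (hk : Even k) :
    ∃ D : Scheme Language.graph metricLang, ∀ c : Ctx.{u, v} m,
      D.Defines (AdjReg c.ξ k) (SympProj c.ξ) (inAdjReg c.ξ k) := by
  let _ : Coding Language.graph (fun c : Ctx.{u, v} m => AdjReg c.ξ k) (fun c => AdjReg c.ξ k) :=
    Coding.self
  have htr : ∀ (c : Ctx.{u, v} m) (x : AdjReg c.ξ k), x.1 ∈ TR c.ξ k := fun c x =>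
    (c.symp.TR_eq_Reg hk).symm ▸ x.2
  obtain ⟨D, hD⟩ := exists_scheme_of_adjDef (L := Language.graph)
    (M := fun c : Ctx.{u, v} m => AdjReg c.ξ k) hk1 hk2 hkm
    (fun c x (U : TR c.ξ k) => x.1 = U.1)
    (fun c x U W h h' => Subtype.ext (h.symm.trans h'))
    (fun c U => ⟨⟨U.1, c.symp.TR_eq_Reg hk ▸ U.2⟩, rfl⟩)
    ((Def.eq DMap.id.fst DMap.id.snd).congr fun c p =>
      ⟨fun h => ⟨⟨p.1.1, htr c p.1⟩, rfl, congrArg Subtype.val h.symm⟩,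
      fun ⟨U, h1, h2⟩ => Subtype.ext (h1.trans h2.symm)⟩)
    ((Def.rel₂ Language.adj).congr fun c p =>
      ⟨fun h => ⟨⟨p.1.1, htr c p.1⟩, ⟨p.2.1, htr c p.2⟩, ⟨rfl, rfl⟩, h⟩, by
        rintro ⟨U, W, ⟨h1, h2⟩, h⟩
        change Adjacent c.ξ k p.1.1 p.2.1
        rw [h1, h2]
        exact h⟩)
  refine ⟨D, fun c => ?_⟩
  have hE : (fun (X : SPs m c) (x : AdjReg c.ξ k) => ∃ U : TR c.ξ k, x.1 = U.1 ∧ X.1 ≤ U.1) =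
      inAdjReg c.ξ k := by
    funext X x
    exact propext ⟨fun ⟨U, h1, h2⟩ => h2.trans h1.ge, fun h => ⟨⟨x.1, htr c x⟩, rfl, h⟩⟩
  exact hE ▸ hD c

end SympGrass

theorem theorem1 (m k : ℕ) (hk1 : 1 ≤ k) (hk2 : k ≤ 2 * m - 1) (hkm : k ≠ 2 * m - k) :
    (∃ D : SympGrass.Scheme Language.graph SympGrass.metricLang,
      ∀ (K : Type u) [Field K] (V : Type v) [AddCommGroup V] [Module K V]
        [FiniteDimensional K V] (ξ : LinearMap.BilinForm K V),
        ringChar K ≠ 2 → finrank K V = 2 * m → ξ.IsAlt → ξ.Nondegenerate →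
        D.Defines (SympGrass.AdjTR ξ k) (SympGrass.SympProj ξ) (SympGrass.inAdjTR ξ k)) ∧
    (∃ D : SympGrass.Scheme SympGrass.incLang SympGrass.metricLang,
      ∀ (K : Type u) [Field K] (V : Type v) [AddCommGroup V] [Module K V]
        [FiniteDimensional K V] (ξ : LinearMap.BilinForm K V),
        ringChar K ≠ 2 → finrank K V = 2 * m → ξ.IsAlt → ξ.Nondegenerate →
        D.Defines (SympGrass.Grassmann ξ k) (SympGrass.SympProj ξ)
          (SympGrass.inGrassmann ξ k)) ∧
    (Even k →
      ∃ D : SympGrass.Scheme Language.graph SympGrass.metricLang,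
      ∀ (K : Type u) [Field K] (V : Type v) [AddCommGroup V] [Module K V]
        [FiniteDimensional K V] (ξ : LinearMap.BilinForm K V),
        ringChar K ≠ 2 → finrank K V = 2 * m → ξ.IsAlt → ξ.Nondegenerate →
        SympGrass.TR ξ k = SympGrass.Reg ξ k ∧
        D.Defines (SympGrass.AdjReg ξ k) (SympGrass.SympProj ξ) (SympGrass.inAdjReg ξ k)) := by
  refine ⟨?_, ?_, fun hk => ?_⟩
  · obtain ⟨D, hD⟩ := SympGrass.exists_scheme_adjTR.{u, v} hk1 hk2 hkm
    exact ⟨D, fun K _ V _ _ _ ξ h2 hd ha hn => hD (.of K V ξ h2 hd ha hn)⟩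
  · obtain ⟨D, hD⟩ := SympGrass.exists_scheme_grassmann.{u, v} hk1 hk2 hkm
    exact ⟨D, fun K _ V _ _ _ ξ h2 hd ha hn => hD (.of K V ξ h2 hd ha hn)⟩
  · obtain ⟨D, hD⟩ := SympGrass.exists_scheme_adjReg.{u, v} hk1 hk2 hkm hk
    exact ⟨D, fun K _ V _ _ _ ξ h2 hd ha hn =>
      ⟨(SympGrass.Ctx.of K V ξ h2 hd ha hn).symp.TR_eq_Reg hk, hD (.of K V ξ h2 hd ha hn)⟩⟩
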